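/- All graphs are finite and simple. A circle graph is a graph isomorphic to the intersection graph of finitely many chords of a circle. For a graph $G$ and a vertex $u$, the local complementation $G\star u$ is the symmetric difference of $G$ with the complete graph on the neighbourhood $N_G(u)$. Let $r\ge 1$ be an integer and let $S$ be a multiset of vertices of $G$ with multiplicity function $S:V(G)\to\mathbb N$ and support $\mathrm{supp}(S)=\{u: S(u)\ge 1\}$. $S$ is independent if no two vertices of $\mathrm{supp}(S)$ are adjacent, and $r$-incident if for every integer $0\le k<r$ and every set $K\subseteq V(G)\setminus\mathrm{supp}(S)$ with $|K|=k+2$, the number $\sum_{u\in\bigcap_{v\in K}N_G(v)}S(u)$ is a multiple of $2^{r-k-\delta(k)}$, where $\delta(0)=1$ and $\delta(k)=0$ for $k\neq 0$. If $S$ is independent and $r$-incident, the $r$-local complementation $G\star^r S$ is the graph on $V(G)$ in which two distinct vertices $a,b$ are adjacent if and only if exactly one of the following holds: $a$ and $b$ are adjacent in $G$; $\sum_{u\in N_G(a)\cap N_G(b)}S(u)\equiv 2^{r-1}\pmod{2^r}$. A set $A$ of vertices is identified with the multiset in which each element of $A$ has multiplicity $1$. The graph state of $G$ is $|G\rangle=\bigl(\prod_{\{u,v\}\in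 E(G)}CZ_{uv}\bigr)|+\rangle^{\otimes V(G)}$, where $CZ\,|x_1\rangle|x_2\rangle=(-1)^{x_1x_2}|x_1\rangle|x_2\rangle$ and $|+\rangle=(|0\rangle+|1\rangle)/\sqrt2$. An $n$-qubit stabilizer state is a unit vector that is, up to a global phase, the unique common fixed unit vector of $n$ independent commuting operators of the form $\pm\bigotimes_u P_u$ with $P_u\in\{I,X,Y,Z\}$. Two states $|\psi_1\rangle,|\psi_2\rangle$ are LU-equivalent if $|\psi_2\rangle=\bigotimes_u U_u|\psi_1\rangle$ for some single-qubit unitaries $U_u$, and LC-equivalent if $|\psi_2\rangle=e^{i\phi}\bigotimes_u C_u|\psi_1\rangle$ for some real $\phi$ and some single-qubit unitaries $C_u$ that normalize the single-qubit Pauli group. One says that LU $=$ LC for a state $|\psi\rangle$ if every stabilizer state LU-equivalent to $|\psi\rangle$ is also LC-equivalent to $|\psi\rangle$. Theorem. Let $C$ be a circle graph. 1. For every integer $r\ge1$ and every independent $r$-incident multiset $S$ of vertices of $C$: (a) there is an independent set $A$ of vertices of $C$ with $C\star^r S=C\star^1 A$; (b) there are vertices $u_1,\dots,u_m$ (for some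 $m\ge 0$) with $C\star^r S=C\star u_1\star u_2\star\cdots\star u_m$; (c) $C\star^r S$ is a circle graph. 2. LU $=$ LC for the circle graph state $|C\rangle$. -/

import Mathlib

namespace CircleGraphStates

/-! ### Circle graphs -/

section Graphs

variable {V : Type*}

/-- The chord of the unit circle of `ℂ` with end points `p` and `q`. -/
def chord (p q : Circle) : Set ℂ :=
  segment ℝ (p : ℂ) (q : ℂ)

/-- `G` is a circle graph: its vertices can be represented by chords of a circle such that two
different vertices are adjacent exactly when their chords intersect. (All graphs to which this is
applied are finite. Chords are nondegenerate, and they may share end points.) -/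
def IsCircleGraph (G : SimpleGraph V) : Prop :=
  ∃ p q : V → Circle, (∀ v, p v ≠ q v) ∧
    ∀ u v, G.Adj u v ↔ u ≠ v ∧ (chord (p u) (q u) ∩ chord (p v) (q v)).Nonempty

/-! ### Local complementation and `r`-local complementation -/

/-- Local complementation at `u`: the symmetric difference of `G` with the complete graph on the
neighbourhood of `u`. -/
def localComplement (G : SimpleGraph V) (u : V) : SimpleGraph V :=
  symmDiff G (SimpleGraph.fromRel fun a b => a ∈ G.neighborSet u ∧ b ∈ G.neighborSet u)

/-- The graph `G ⋆ u₁ ⋆ u₂ ⋆ ⋯ ⋆ uₘ` for a list `[u₁, …, uₘ]` of vertices. -/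
def localComplementSeq (G : SimpleGraph V) (l : List V) : SimpleGraph V :=
  l.foldl localComplement G

/-- A multiset of vertices, given by its multiplicity function `S`, is independent if its support
is an independent set. -/
def IsIndependentMultiset (G : SimpleGraph V) (S : V → ℕ) : Prop :=
  G.IsIndepSet (Function.support S)

variable [Fintype V]

open Classical in
/-- The number of elements of the multiset `S`, counted with multiplicity, that are adjacent to
all vertices of `K`. -/
noncomputable def commonCount (G : SimpleGraph V) (S : V → ℕ) (K : Finset V) : ℕ :=
  ∑ u with ∀ v ∈ K, G.Adj v u, S u

/-- `S` is `r`-incident: for all `0 ≤ k < r` and all sets `K` of `k + 2` vertices outside of the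
support of `S`, the number of common neighbours of `K` in `S`, counted with multiplicity, is a
multiple of `2 ^ (r - k - δ(k))`, where `δ(0) = 1` and `δ(k) = 0` for `k ≠ 0`. -/
def IsIncident (G : SimpleGraph V) (r : ℕ) (S : V → ℕ) : Prop :=
  ∀ k < r, ∀ K : Finset V, (∀ v ∈ K, v ∉ Function.support S) → K.card = k + 2 →
    2 ^ (r - k - (if k = 0 then 1 else 0)) ∣ commonCount G S K

open Classical in
/-- The graph `G ⋆ʳ S`: for `a ≠ b`, adjacency of `a` and `b` is toggled exactly when the number
of common neighbours of `a` and `b` in `S`, counted with multiplicity, is `2 ^ (r - 1)` modulo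
`2 ^ r`. It is meaningful for `1 ≤ r` and independent `r`-incident `S`. -/
noncomputable def rLocalComplement (G : SimpleGraph V) (r : ℕ) (S : V → ℕ) : SimpleGraph V where
  Adj a b := a ≠ b ∧ Xor (G.Adj a b) (commonCount G S {a, b} ≡ 2 ^ (r - 1) [MOD 2 ^ r])
  symm := ⟨fun a b h => ⟨h.1.symm, by rw [G.adj_comm, Finset.pair_comm]; exact h.2⟩⟩
  loopless := ⟨fun a h => h.1 rfl⟩

end Graphs

/-! ### Qubits and graph states

A vector of the Hilbert space of the qubits in `V` is given by its amplitudes in the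
computational basis, so it is a function `(V → Fin 2) → ℂ`. -/

section States

variable {V : Type*} [Fintype V] [DecidableEq V]

/-- The vector `ψ` has norm one. -/
def IsUnitVector (ψ : (V → Fin 2) → ℂ) : Prop :=
  ∑ x, ‖ψ x‖ ^ 2 = 1

/-- The tensor product of the single-qubit operators `U u`, for `u` in `V`. -/
def tensorOp (U : V → Matrix (Fin 2) (Fin 2) ℂ) : Matrix (V → Fin 2) (V → Fin 2) ℂ :=
  Matrix.of fun x y => ∏ u, U u (x u) (y u)

/-- The state in which every qubit of `V` is in the state `(|0⟩ + |1⟩) / √2`. -/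
noncomputable def plusState (V : Type*) [Fintype V] : (V → Fin 2) → ℂ :=
  fun _ => ∏ _u : V, ((1 / √2 : ℝ) : ℂ)

/-- The eigenvalue `(-1) ^ (x u * x v)` of the gate `CZ` on the qubits of the unordered pair
`e = s(u, v)`, at the basis vector `|x⟩`. -/
def czPhase (x : V → Fin 2) (e : Sym2 V) : ℂ :=
  Sym2.lift ⟨fun u v => (-1) ^ ((x u : ℕ) * (x v : ℕ)), fun u v => by
    simp only [mul_comm]⟩ e

open Classical in
/-- The graph state `|G⟩`: the product of the (diagonal) gates `CZ` over all edges of `G`, applied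
to the state `plusState V`. -/
noncomputable def graphState (G : SimpleGraph V) : (V → Fin 2) → ℂ :=
  fun x => (∏ e : Sym2 V with e ∈ G.edgeSet, czPhase x e) * plusState V x

/-- The four Pauli matrices `I`, `X`, `Y`, `Z`. -/
def paulis : Set (Matrix (Fin 2) (Fin 2) ℂ) :=
  {1, !![0, 1; 1, 0], !![0, -Complex.I; Complex.I, 0], !![1, 0; 0, -1]}

/-- The operators `± ⨂ P u` with Pauli matrices `P u`. -/
def IsSignedPauliString (M : Matrix (V → Fin 2) (V → Fin 2) ℂ) : Prop :=
  ∃ P : V → Matrix (Fin 2) (Fin 2) ℂ, (∀ u, P u ∈ paulis) ∧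
    (M = tensorOp P ∨ M = -tensorOp P)

/-- Stabilizer states on `n` qubits: unit vectors that are, up to a global phase, the unique
common fixed unit vector of `n` independent commuting operators `± ⨂ P u`. Independent means that
none of the operators is generated by the others (the operators are involutions, so that the
submonoid and the subgroup they generate agree). -/
def IsStabilizerState (ψ : (V → Fin 2) → ℂ) : Prop :=
  IsUnitVector ψ ∧
  ∃ g : Fin (Fintype.card V) → Matrix (V → Fin 2) (V → Fin 2) ℂ,
    (∀ i, IsSignedPauliString (g i)) ∧
    (∀ i j, Commute (g i) (g j)) ∧
    (∀ i, g i ∉ Submonoid.closure (g '' {j | j ≠ i})) ∧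
    (∀ i, (g i).mulVec ψ = ψ) ∧
    ∀ φ : (V → Fin 2) → ℂ, IsUnitVector φ → (∀ i, (g i).mulVec φ = φ) →
      ∃ c : ℂ, ‖c‖ = 1 ∧ φ = c • ψ

/-- The single-qubit Pauli group: the products of a Pauli matrix with `±1` or `±i`. -/
def pauliGroup : Set (Matrix (Fin 2) (Fin 2) ℂ) :=
  {M | ∃ c ∈ ({1, -1, Complex.I, -Complex.I} : Set ℂ), ∃ P ∈ paulis, M = c • P}

/-- The single-qubit Clifford group: the unitary matrices that normalize the Pauli group. -/
def cliffordGroup : Set (Matrix (Fin 2) (Fin 2) ℂ) :=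
  {U | U ∈ Matrix.unitaryGroup (Fin 2) ℂ ∧
    (fun P => U * P * U.conjTranspose) '' pauliGroup = pauliGroup}

/-- LU-equivalence: some tensor product of single-qubit unitaries maps `ψ₁` to `ψ₂`. -/
def LUEquivalent (ψ₁ ψ₂ : (V → Fin 2) → ℂ) : Prop :=
  ∃ U : V → Matrix (Fin 2) (Fin 2) ℂ, (∀ u, U u ∈ Matrix.unitaryGroup (Fin 2) ℂ) ∧
    ψ₂ = (tensorOp U).mulVec ψ₁

/-- LC-equivalence: some tensor product of single-qubit Clifford operators maps `ψ₁` to `ψ₂`, up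
to a global phase. -/
def LCEquivalent (ψ₁ ψ₂ : (V → Fin 2) → ℂ) : Prop :=
  ∃ (θ : ℝ) (U : V → Matrix (Fin 2) (Fin 2) ℂ), (∀ u, U u ∈ cliffordGroup) ∧
    ψ₂ = Complex.exp (Complex.I * θ) • (tensorOp U).mulVec ψ₁

/-- `LU = LC` for the state `ψ`: every stabilizer state that is LU-equivalent to `ψ` is also
LC-equivalent to `ψ`. -/
def LUEqLC (ψ : (V → Fin 2) → ℂ) : Prop :=
  ∀ φ : (V → Fin 2) → ℂ, IsStabilizerState φ → LUEquivalent ψ φ → LCEquivalent ψ φ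

end States

end CircleGraphStates

/-! Both halves of the theorem rest on one property of circle graphs. Let `I` be an independent set
and `P v = N(v) ∩ I`. If `P x`, `P y`, `P z` have a common element `u`, then some pairwise
intersection lies in the third set. Otherwise there are chords `w₁, w₂, w₃` in `I`, each crossing
all but one of `x, y, z`, with a different one missed each time. Two of them lie on the same side of
`u`; the arcs they cut off there are nested or disjoint, and both are impossible
(`IsChordDiagram.not_cube_minor`).

A family with this Helly type property allows rounding (`exists_int_weight`): real weights on `I`
with integral sums over all `P x ∩ P y`, `x ≠ y`, can be replaced by integers with the same sums.
Among the vertices of nonintegral weight take a smallest nonempty trace `M` of such an intersection.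
Every `P z` contains `M` or misses it, so weight can be moved inside `M` without changing any sum.
The vertices of odd integral weight then form a set `A ⊆ I` that records the parities of all the
sums (`IsCircleGraph.exists_odd_weight`).

For `r`-local complementation the weights are `S u / 2 ^ (r - 1)`: incidence for pairs makes the
sums integral, and their parity decides which pairs are toggled. So `A` toggles the same pairs.
Since `A` is independent, this amounts to ordinary local complementations at its elements, and local
complementation of a chord diagram reverses the interval between the ends of a chord.

For LU = LC, let `φ` be a stabilizer state and the image of `|C⟩` under unitaries `U u`. An argument
with supports of stabilizers (`exists_stabSupport`, `exists_mapsPauli`) shows that each `U u` maps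
some Pauli axis to a Pauli axis. The exception is an isolated edge, where operators are first moved
to one end (`exists_all_mapsPauli`). Local complementations are Clifford operations that change the
axes; they lead to another circle graph `G` for which the qubits without a `Z`-axis form an
independent set `I` and have `X`-axes. Up to Clifford operators `φ` is then a state `χ` obtained
from `|G⟩` by phases that depend on one bit each or, for `u ∈ I`, on the parity of the bits at the
neighbours of `u`. Since `χ` has no zero amplitude, it is Clifford equivalent to a graph state
`|H⟩`, and the second differences of its amplitudes determine `H`
(`HasPauliDichotomy.exists_graph`). Comparison with `G` shows that `a`, `b` are toggled exactly when
the product of certain phases over the common neighbours of `a`, `b` in `I` is `-1` instead of `1`.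
The arguments of these phases, divided by `π`, are weights with integral pair sums, so rounding
exhibits `H` as a graph obtained from `G` by local complementations. -/

namespace CircleGraphStates
open Function

/-! ### Chord diagrams and a forbidden configuration. -/

variable {V : Type*}

/-- The pairs `(a v, b v)` of integers are the end points of the chords of a chord diagram of `G`:
all end points are different, and vertices are adjacent exactly when their chords interlace. -/
structure IsChordDiagram (G : SimpleGraph V) (a b : V → ℤ) : Prop where
  lt : ∀ v, a v < b v
  ne : ∀ u v, u ≠ v → a u ≠ a v ∧ a u ≠ b v ∧ b u ≠ b v
  adj : ∀ u v, G.Adj u v ↔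
    (a u < a v ∧ a v < b u ∧ b u < b v) ∨ (a v < a u ∧ a u < b v ∧ b v < b u)

/-- An end point of one of two nested chords can not be separated from the other. -/
theorem IsChordDiagram.false_of_same_side {G : SimpleGraph V} {a b : V → ℤ}
    (h : IsChordDiagram G a b) {u w w' x y z : V}
    (hu : ¬ G.Adj u w) (hu' : ¬ G.Adj u w') (hw : ¬ G.Adj w w')
    (hwx : G.Adj w x) (hwy : G.Adj w y) (hwz : ¬ G.Adj w z)
    (hwx' : G.Adj w' x) (hwy' : ¬ G.Adj w' y) (hwz' : G.Adj w' z)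
    (hux : G.Adj u x) (huy : G.Adj u y) (huz : G.Adj u z)
    (side : (a u < a w ∧ a w < b u) ↔ (a u < a w' ∧ a w' < b u)) : False := by
  -- A chord `t` crossing `s` has exactly one end `i` between the ends of `s`; its other end `o` is
  -- outside. From here on `x`, `y`, `z` enter only through such a pair of ends relative to `u`.
  have key : ∀ {s t}, G.Adj s t → ∃ i o, (a s < i ∧ i < b s) ∧ (o < a s ∨ b s < o) ∧
      ((i = a t ∧ o = b t) ∨ (i = b t ∧ o = a t)) := by
    intro s t hst
    have h1 := h.lt s
    have h2 := h.lt t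
    rcases (h.adj s t).1 hst with h3 | h3
    · exact ⟨a t, b t, by omega, by omega, Or.inl ⟨rfl, rfl⟩⟩
    · exact ⟨b t, a t, by omega, by omega, Or.inr ⟨rfl, rfl⟩⟩
  have key' : ∀ {s t i o}, ((i = a t ∧ o = b t) ∨ (i = b t ∧ o = a t)) → s ≠ t →
      (G.Adj s t ↔ ((a s < i ∧ i < b s) ↔ (o < a s ∨ b s < o))) := by
    intro s t i o hio hst
    have h1 := h.lt s
    have h2 := h.lt t
    have h3 := h.ne s t hst
    have h4 := h.ne t s hst.symm
    rw [h.adj s t]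
    omega
  have sep : ∀ {s t i o}, ((i = a t ∧ o = b t) ∨ (i = b t ∧ o = a t)) → s ≠ t →
      a s ≠ i ∧ b s ≠ i ∧ a s ≠ o ∧ b s ≠ o := by
    intro s t i o hio hst
    have h3 := h.ne s t hst
    have h4 := h.ne t s hst.symm
    omega
  have nz : w ≠ z := by rintro rfl; exact hu huz
  have ny : w' ≠ y := by rintro rfl; exact hu' huy
  have nu : u ≠ w := by rintro rfl; exact hwz huz
  have nu' : u ≠ w' := by rintro rfl; exact hwy' huy
  have nw : w ≠ w' := by rintro rfl; exact hwy' hwy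
  obtain ⟨ix, ox, hx1, hx2, hx⟩ := key hux
  obtain ⟨iy, oy, hy1, hy2, hy⟩ := key huy
  obtain ⟨iz, oz, hz1, hz2, hz⟩ := key huz
  have sz := sep hz nz
  have sy := sep hy ny
  rw [key' hx hwx.ne] at hwx
  rw [key' hy hwy.ne] at hwy
  rw [key' hz nz] at hwz
  rw [key' hx hwx'.ne] at hwx'
  rw [key' hy ny] at hwy'
  rw [key' hz hwz'.ne] at hwz'
  have l := h.lt u
  have l1 := h.lt w
  have l2 := h.lt w'
  have e1 := h.ne _ _ nu
  have e2 := h.ne _ _ nu'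
  have e3 := h.ne _ _ nw
  have f1 := (h.ne _ _ nu.symm).2.1
  have f2 := (h.ne _ _ nu'.symm).2.1
  have f3 := (h.ne _ _ nw.symm).2.1
  rw [h.adj] at hu hu' hw
  clear hux huy huz key key' sep nz ny nu nu' nw hx hy hz
  generalize a u = au at *
  generalize b u = bu at *
  generalize a w = aw at *
  generalize b w = bw at *
  generalize a w' = aw' at *
  generalize b w' = bw' at *
  -- A chord disjoint from `u` lies inside the interval of `u`, beside it or around it. In each case
  -- a chord that crosses `u` crosses it exactly when the end on its side of `u` lies in the arc
  -- that it cuts off from `u`. The arcs of `w` and `w'` both contain the end of `x`, and each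
  -- contains one of the ends of `y` and `z` that the other misses, which nested or disjoint arcs do
  -- not allow.
  have inside : ∀ {c d i o : ℤ}, au < c → d < bu → c < d → (au < i ∧ i < bu) →
      (o < au ∨ bu < o) → (((c < i ∧ i < d) ↔ (o < c ∨ d < o)) ↔ (c < i ∧ i < d)) := by
    omega
  have left : ∀ {c d i o : ℤ}, d < au ∨ bu < c → c < d → (au < i ∧ i < bu) →
      (((c < i ∧ i < d) ↔ (o < c ∨ d < o)) ↔ ¬ (o < c ∨ d < o)) := by
    omega
  have around : ∀ {c d i o : ℤ}, c < au ∧ bu < d → c < d → (au < i ∧ i < bu) →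
      (((c < i ∧ i < d) ↔ (o < c ∨ d < o)) ↔ (o < c ∨ d < o)) := by
    omega
  by_cases c : au < aw ∧ aw < bu
  · have c' := side.1 c
    have e : bw < bu := by omega
    have e' : bw' < bu := by omega
    rw [inside c.1 e l1 hx1 hx2] at hwx
    rw [inside c.1 e l1 hy1 hy2] at hwy
    rw [inside c.1 e l1 hz1 hz2] at hwz
    rw [inside c'.1 e' l2 hx1 hx2] at hwx'
    rw [inside c'.1 e' l2 hy1 hy2] at hwy'
    rw [inside c'.1 e' l2 hz1 hz2] at hwz'
    omega
  · have c' : ¬ (au < aw' ∧ aw' < bu) := fun d => c (side.2 d)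
    have d : (bw < au ∨ bu < aw) ∨ (aw < au ∧ bu < bw) := by omega
    have d' : (bw' < au ∨ bu < aw') ∨ (aw' < au ∧ bu < bw') := by omega
    clear c c' side
    rcases d with d | d <;> rcases d' with d' | d'
    · rw [left d l1 hx1] at hwx
      rw [left d l1 hy1] at hwy
      rw [left d l1 hz1] at hwz
      rw [left d' l2 hx1] at hwx'
      rw [left d' l2 hy1] at hwy'
      rw [left d' l2 hz1] at hwz'
      clear hx1 hy1 hz1 hu hu' hx2 hy2 hz2
      omega
    · rw [left d l1 hx1] at hwx
      rw [left d l1 hy1] at hwy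
      rw [left d l1 hz1] at hwz
      rw [around d' l2 hx1] at hwx'
      rw [around d' l2 hy1] at hwy'
      rw [around d' l2 hz1] at hwz'
      clear hx1 hy1 hz1 hu hu' hx2 hy2 hz2
      omega
    · rw [around d l1 hx1] at hwx
      rw [around d l1 hy1] at hwy
      rw [around d l1 hz1] at hwz
      rw [left d' l2 hx1] at hwx'
      rw [left d' l2 hy1] at hwy'
      rw [left d' l2 hz1] at hwz'
      clear hx1 hy1 hz1 hu hu' hx2 hy2 hz2
      omega
    · rw [around d l1 hx1] at hwx
      rw [around d l1 hy1] at hwy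
      rw [around d l1 hz1] at hwz
      rw [around d' l2 hx1] at hwx'
      rw [around d' l2 hy1] at hwy'
      rw [around d' l2 hz1] at hwz'
      clear hx1 hy1 hz1 hu hu' hx2 hy2 hz2
      omega

/-- The chord `u` has two sides, so two of the three chords `w₁, w₂, w₃` lie on the same side, and
`false_of_same_side` applies to them. Adjacencies among the `xᵢ` are irrelevant; without any, the
graph is a cube minus a vertex. -/
theorem IsChordDiagram.not_cube_minor {G : SimpleGraph V} {a b : V → ℤ}
    (h : IsChordDiagram G a b) {u w₁ w₂ w₃ x₁ x₂ x₃ : V}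
    (i₁ : ¬ G.Adj u w₁) (i₂ : ¬ G.Adj u w₂) (i₃ : ¬ G.Adj u w₃)
    (j₃ : ¬ G.Adj w₁ w₂) (j₂ : ¬ G.Adj w₁ w₃) (j₁ : ¬ G.Adj w₂ w₃)
    (u₁ : G.Adj u x₁) (u₂ : G.Adj u x₂) (u₃ : G.Adj u x₃)
    (m₁ : ¬ G.Adj w₁ x₁) (m₂ : G.Adj w₁ x₂) (m₃ : G.Adj w₁ x₃)
    (n₁ : G.Adj w₂ x₁) (n₂ : ¬ G.Adj w₂ x₂) (n₃ : G.Adj w₂ x₃)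
    (k₁ : G.Adj w₃ x₁) (k₂ : G.Adj w₃ x₂) (k₃ : ¬ G.Adj w₃ x₃) : False := by
  by_cases c₁ : a u < a w₁ ∧ a w₁ < b u <;> by_cases c₂ : a u < a w₂ ∧ a w₂ < b u <;>
    by_cases c₃ : a u < a w₃ ∧ a w₃ < b u
  all_goals first
  | exact h.false_of_same_side i₁ i₂ j₃ m₃ m₂ m₁ n₃ n₂ n₁ u₃ u₂ u₁ 
      (by first | exact iff_of_true c₁ c₂ | exact iff_of_false c₁ c₂)
  | exact h.false_of_same_side i₁ i₃ j₂ m₂ m₃ m₁ k₂ k₃ k₁ u₂ u₃ u₁ 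
      (by first | exact iff_of_true c₁ c₃ | exact iff_of_false c₁ c₃)
  | exact h.false_of_same_side i₂ i₃ j₁ n₁ n₃ n₂ k₁ k₃ k₂ u₁ u₃ u₂ 
      (by first | exact iff_of_true c₂ c₃ | exact iff_of_false c₂ c₃)
end CircleGraphStates

/-! ### Local complementation of chord diagrams. -/

namespace CircleGraphStates
open Function

variable {V : Type*}

theorem localComplement_adj (G : SimpleGraph V) (u v w : V) :
    (localComplement G u).Adj v w ↔ v ≠ w ∧ ¬ (G.Adj v w ↔ (G.Adj u v ∧ G.Adj u w)) := by
  unfold localComplement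
  simp only [symmDiff, SimpleGraph.sup_adj, SimpleGraph.sdiff_adj, SimpleGraph.fromRel_adj,
    SimpleGraph.mem_neighborSet]
  have := G.ne_of_adj (a := v) (b := w)
  tauto

/-- The reflection of the interval between `a` and `b`. -/
def reflectBetween (a b x : ℤ) : ℤ := if a < x ∧ x < b then a + b - x else x

set_option maxHeartbeats 1000000 in
-- Neighbours of `u` are the chords with exactly one end between the ends of `u`. Reversing that
-- interval exchanges the order of two such ends, which toggles crossing, and keeps the crossing
-- relation of every other pair. The reversal may exchange the ends of a chord inside it, hence
-- `min` and `max`.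
theorem IsChordDiagram.localComplement {G : SimpleGraph V} {a b : V → ℤ}
    (h : IsChordDiagram G a b) (u : V) :
    IsChordDiagram (localComplement G u)
      (fun v => min (reflectBetween (a u) (b u) (a v)) (reflectBetween (a u) (b u) (b v)))
      (fun v => max (reflectBetween (a u) (b u) (a v)) (reflectBetween (a u) (b u) (b v))) := by
  have inj : ∀ x y, reflectBetween (a u) (b u) x = reflectBetween (a u) (b u) y → x = y := by
    intro x y
    unfold reflectBetween
    split_ifs <;> omega
  -- The four positions of a chord relative to `u` (beside or around, inside, crossing on the left,
  -- crossing on the right) with the ends after the reversal.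
  have pos : ∀ v, v ≠ u → ∃ x y,
      min (reflectBetween (a u) (b u) (a v)) (reflectBetween (a u) (b u) (b v)) = x ∧
      max (reflectBetween (a u) (b u) (a v)) (reflectBetween (a u) (b u) (b v)) = y ∧
      ((b v < a u ∨ b u < a v ∨ (a v < a u ∧ b u < b v)) ∧ ¬ G.Adj u v ∧ x = a v ∧ y = b v ∨
      (a u < a v ∧ b v < b u) ∧ ¬ G.Adj u v ∧ x = a u + b u - b v ∧ y = a u + b u - a v ∨
      (a v < a u ∧ a u < b v ∧ b v < b u) ∧ G.Adj u v ∧ x = a v ∧ y = a u + b u - b v ∨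
      (a u < a v ∧ a v < b u ∧ b u < b v) ∧ G.Adj u v ∧ x = a u + b u - a v ∧ y = b v) := by
    intro v hv
    refine ⟨_, _, rfl, rfl, ?_⟩
    have h1 := h.lt u
    have h2 := h.lt v
    have h3 := h.ne u v hv.symm
    have h4 := h.ne v u hv
    rw [h.adj]
    unfold reflectBetween
    split_ifs <;> omega
  have hu : min (reflectBetween (a u) (b u) (a u)) (reflectBetween (a u) (b u) (b u)) = a u ∧
      max (reflectBetween (a u) (b u) (a u)) (reflectBetween (a u) (b u) (b u)) = b u := by
    simp [reflectBetween, (h.lt u).le]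
  refine ⟨fun v => ?_, fun v w hvw => ?_, fun v w => ?_⟩
  · exact min_lt_max.2 fun e => (h.lt v).ne (inj _ _ e)
  · have n := h.ne v w hvw
    have n' := h.ne w v hvw.symm
    have m1 := mt (inj (a v) (a w)) n.1
    have m2 := mt (inj (a v) (b w)) n.2.1
    have m3 := mt (inj (b v) (b w)) n.2.2
    have m4 := mt (inj (b v) (a w)) n'.2.1.symm
    omega
  · by_cases hvw : v = w
    · subst hvw
      simp
    have n := h.ne v w hvw
    have n' := h.ne w v (Ne.symm hvw)
    have lv := h.lt v
    have lw := h.lt w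
    have lu := h.lt u
    rw [localComplement_adj, and_iff_right hvw]
    by_cases hv : v = u
    · subst hv
      obtain ⟨x', y', hx', hy', c'⟩ := pos w (Ne.symm hvw)
      simp only [hu.1, hu.2, hx', hy', SimpleGraph.irrefl, false_and, iff_false, not_not]
      clear pos inj hu hx' hy'
      rcases c' with ⟨c', d', rfl, rfl⟩ | ⟨c', d', rfl, rfl⟩ | ⟨c', d', rfl, rfl⟩ |
        ⟨c', d', rfl, rfl⟩ <;> simp only [d', false_iff, true_iff] <;> omega
    by_cases hw : w = u
    · subst hw
      obtain ⟨x, y, hx, hy, c⟩ := pos v hv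
      simp only [hu.1, hu.2, hx, hy, SimpleGraph.irrefl, and_false, iff_false, not_not, G.adj_comm v w]
      clear pos inj hu hx hy
      rcases c with ⟨c, d, rfl, rfl⟩ | ⟨c, d, rfl, rfl⟩ | ⟨c, d, rfl, rfl⟩ |
        ⟨c, d, rfl, rfl⟩ <;> simp only [d, false_iff, true_iff] <;> omega
    obtain ⟨x, y, hx, hy, c⟩ := pos v hv
    obtain ⟨x', y', hx', hy', c'⟩ := pos w hw
    have nv := h.ne v u hv
    have nw := h.ne w u hw
    simp only [hx, hy, hx', hy']
    rw [h.adj v w]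
    clear pos inj hu hx' hy' hx hy
    generalize a u = au at *
    generalize b u = bu at *
    generalize a v = av at *
    generalize b v = bv at *
    generalize a w = aw at *
    generalize b w = bw at *
    rcases c with ⟨c, d, rfl, rfl⟩ | ⟨c, d, rfl, rfl⟩ | ⟨c, d, rfl, rfl⟩ | ⟨c, d, rfl, rfl⟩ <;>
    rcases c' with ⟨c', d', rfl, rfl⟩ | ⟨c', d', rfl, rfl⟩ | ⟨c', d', rfl, rfl⟩ |
      ⟨c', d', rfl, rfl⟩ <;>
    simp only [d, d', and_self, and_false, false_and, iff_false, iff_true, not_not] <;> clear d d' <;>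
    omega
end CircleGraphStates

/-! ### Translation between chords of the circle and chord diagrams. -/

namespace CircleGraphStates
open Function

variable {V : Type*}

/-- Twice the signed area of the triangle `p q r`. -/
def signedArea (p q r : ℂ) : ℝ :=
  (q.re - p.re) * (r.im - p.im) - (q.im - p.im) * (r.re - p.re)

/-- The area equals `4 sin x sin y sin (x + y)` with half the differences of the arguments as `x`
and `y`, and these three angles lie in `(0, π)`. -/
theorem signedArea_pos {p q r : Circle} (hpq : (p : ℂ).arg < (q : ℂ).arg)
    (hqr : (q : ℂ).arg < (r : ℂ).arg) : 0 < signedArea p q r := by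
  have hp := Complex.neg_pi_lt_arg (p : ℂ)
  have hr := Complex.arg_le_pi (r : ℂ)
  have h : ∀ z : Circle, (z : ℂ).re = Real.cos (z : ℂ).arg ∧ (z : ℂ).im = Real.sin (z : ℂ).arg := by
    intro z
    have hz : (z : ℂ) ≠ 0 := z.coe_ne_zero
    rw [Complex.cos_arg hz, Complex.sin_arg, Circle.norm_coe, div_one, div_one]
    exact ⟨rfl, rfl⟩
  unfold signedArea
  rw [(h p).1, (h p).2, (h q).1, (h q).2, (h r).1, (h r).2]
  generalize (p : ℂ).arg = α at *
  generalize (q : ℂ).arg = β at *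
  generalize (r : ℂ).arg = γ at *
  obtain ⟨x, hx⟩ : ∃ x, x = (β - α) / 2 := ⟨_, rfl⟩
  obtain ⟨y, hy⟩ : ∃ y, y = (γ - β) / 2 := ⟨_, rfl⟩
  have e : (Real.cos β - Real.cos α) * (Real.sin γ - Real.sin α) -
      (Real.sin β - Real.sin α) * (Real.cos γ - Real.cos α) =
      4 * Real.sin x * Real.sin y * Real.sin (x + y) := by
    have e1 : (Real.cos β - Real.cos α) * (Real.sin γ - Real.sin α) -
        (Real.sin β - Real.sin α) * (Real.cos γ - Real.cos α) =
        Real.sin (β - α) + Real.sin (γ - β) - Real.sin (γ - α) := by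
      rw [Real.sin_sub, Real.sin_sub, Real.sin_sub]
      ring
    have h1 : β - α = 2 * x := by linarith
    have h2 : γ - β = 2 * y := by linarith
    have h3 : γ - α = 2 * x + 2 * y := by linarith
    rw [e1, h1, h2, h3, Real.sin_add, Real.sin_add, Real.cos_two_mul', Real.cos_two_mul',
      Real.sin_two_mul, Real.sin_two_mul]
    have s1 := Real.sin_sq_add_cos_sq x
    have s2 := Real.sin_sq_add_cos_sq y
    linear_combination (-2 * Real.sin x * Real.cos x) * s2 - 2 * Real.sin y * Real.cos y * s1
  rw [e]
  have p1 : 0 < Real.sin x := Real.sin_pos_of_pos_of_lt_pi (by linarith) (by linarith)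
  have p2 : 0 < Real.sin y := Real.sin_pos_of_pos_of_lt_pi (by linarith) (by linarith)
  have p3 : 0 < Real.sin (x + y) := Real.sin_pos_of_pos_of_lt_pi (by linarith) (by linarith)
  positivity

theorem signedArea_segment {p q r s z : ℂ} {a b : ℝ} (hab : a + b = 1)
    (hz : a • r + b • s = z) :
    signedArea p q z = a * signedArea p q r + b * signedArea p q s := by
  subst hz
  obtain rfl : b = 1 - a := by linarith
  simp only [signedArea, Complex.add_re, Complex.add_im, Complex.smul_re, Complex.smul_im,
    smul_eq_mul]
  ring

theorem signedArea_eq_zero_of_mem {p q z : ℂ} (hz : z ∈ segment ℝ p q) :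
    signedArea p q z = 0 := by
  obtain ⟨a, b, -, -, hab, hz⟩ := hz
  rw [signedArea_segment hab hz]
  simp only [signedArea]
  ring

theorem signedArea_rotate (p q r : ℂ) : signedArea q r p = signedArea p q r := by
  simp only [signedArea]; ring

/-- The diagonals of a convex quadrilateral meet. The barycentric coordinates of the common point on
each diagonal are ratios of areas of triangles formed by the corners. -/
theorem chord_inter_of_lt {p q r s : Circle} (h₁ : (p : ℂ).arg < (r : ℂ).arg)
    (h₂ : (r : ℂ).arg < (q : ℂ).arg) (h₃ : (q : ℂ).arg < (s : ℂ).arg) :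
    (chord p q ∩ chord r s).Nonempty := by
  have a1 := signedArea_pos h₂ h₃
  have a2 := signedArea_pos h₁ (h₂.trans h₃)
  have a3 := signedArea_pos (h₁.trans h₂) h₃
  have a4 := signedArea_pos h₁ h₂
  have e0 : signedArea p q s + signedArea p r q = signedArea r q s + signedArea p r s := by
    simp only [signedArea]; ring
  have w : signedArea r q s + signedArea p r s ≠ 0 := by positivity
  refine ⟨(signedArea r q s / (signedArea r q s + signedArea p r s)) • (p : ℂ) +
    (signedArea p r s / (signedArea r q s + signedArea p r s)) • (q : ℂ),
    ⟨_, _, by positivity, by positivity, by field_simp, rfl⟩,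
    ⟨signedArea p q s / (signedArea r q s + signedArea p r s),
      signedArea p r q / (signedArea r q s + signedArea p r s), by positivity, by positivity,
      by rw [← add_div, e0, div_self w], ?_⟩⟩
  apply Complex.ext <;>
    simp only [Complex.add_re, Complex.add_im, Complex.smul_re, Complex.smul_im, smul_eq_mul] <;>
    field_simp <;> simp only [signedArea] <;> ring

theorem chord_disjoint_of_pos {p q r s : Circle}
    (h : (0 < signedArea p q r ∧ 0 < signedArea p q s) ∨
      (signedArea p q r < 0 ∧ signedArea p q s < 0)) :
    ¬ (chord p q ∩ chord r s).Nonempty := by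
  rintro ⟨z, hz, a, b, ha, hb, hab, hz'⟩
  have e := signedArea_segment (p := p) (q := q) hab hz'
  rw [signedArea_eq_zero_of_mem hz] at e
  obtain rfl : b = 1 - a := by linarith
  rcases ha.eq_or_lt with rfl | ha
  · rcases h with h | h <;> linarith
  rcases h with h | h
  · linarith [mul_pos ha h.1, mul_nonneg hb h.2.le]
  · linarith [mul_neg_of_pos_of_neg ha h.1, mul_nonpos_of_nonneg_of_nonpos hb h.2.le]

theorem Circle.arg_injective' {p q : Circle} (h : (p : ℂ).arg = (q : ℂ).arg) : p = q :=
  Circle.arg_eq_arg.1 h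

/-- The inequalities are weak because chords with a common end point intersect. -/
theorem chord_inter_iff {p q r s : Circle} (hpq : (p : ℂ).arg < (q : ℂ).arg)
    (hrs : (r : ℂ).arg < (s : ℂ).arg) :
    (chord p q ∩ chord r s).Nonempty ↔
      ((p : ℂ).arg ≤ (r : ℂ).arg ∧ (r : ℂ).arg ≤ (q : ℂ).arg ∧ (q : ℂ).arg ≤ (s : ℂ).arg) ∨
      ((r : ℂ).arg ≤ (p : ℂ).arg ∧ (p : ℂ).arg ≤ (s : ℂ).arg ∧ (s : ℂ).arg ≤ (q : ℂ).arg) := by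
  constructor
  · intro h
    by_contra hn
    have c : ((q : ℂ).arg < (r : ℂ).arg) ∨ ((s : ℂ).arg < (p : ℂ).arg) ∨
      ((p : ℂ).arg < (r : ℂ).arg ∧ (s : ℂ).arg < (q : ℂ).arg) ∨
      ((r : ℂ).arg < (p : ℂ).arg ∧ (q : ℂ).arg < (s : ℂ).arg) := by grind
    refine chord_disjoint_of_pos ?_ h
    rcases c with c | c | c | c
    · exact Or.inl ⟨signedArea_pos hpq c, signedArea_pos hpq (c.trans hrs)⟩
    · left
      rw [← signedArea_rotate, ← signedArea_rotate, ← signedArea_rotate (p : ℂ) q s,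
        ← signedArea_rotate (q : ℂ)]
      exact ⟨signedArea_pos (hrs.trans c) hpq, signedArea_pos c hpq⟩
    · right
      have e : ∀ z : Circle, signedArea p q z = - signedArea p z q := by
        intro z; simp only [signedArea]; ring
      rw [e, e, neg_neg_iff_pos, neg_neg_iff_pos]
      exact ⟨signedArea_pos c.1 (hrs.trans c.2), signedArea_pos (c.1.trans hrs) c.2⟩
    · left
      rw [signedArea_rotate (r : ℂ)]
      exact ⟨signedArea_pos c.1 hpq, signedArea_pos hpq c.2⟩
  · have shared : ∀ {x : ℂ}, x ∈ chord p q → x ∈ chord r s →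
        (chord p q ∩ chord r s).Nonempty := fun h1 h2 => ⟨_, h1, h2⟩
    rintro (⟨h1, h2, h3⟩ | ⟨h1, h2, h3⟩)
    · rcases h1.eq_or_lt with h1 | h1
      · obtain rfl := Circle.arg_injective' h1
        exact shared (left_mem_segment _ _ _) (left_mem_segment _ _ _)
      rcases h2.eq_or_lt with h2 | h2
      · obtain rfl := Circle.arg_injective' h2
        exact shared (right_mem_segment _ _ _) (left_mem_segment _ _ _)
      rcases h3.eq_or_lt with h3 | h3
      · obtain rfl := Circle.arg_injective' h3
        exact shared (right_mem_segment _ _ _) (right_mem_segment _ _ _)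
      exact chord_inter_of_lt h1 h2 h3
    · rcases h1.eq_or_lt with h1 | h1
      · obtain rfl := Circle.arg_injective' h1
        exact shared (left_mem_segment _ _ _) (left_mem_segment _ _ _)
      rcases h2.eq_or_lt with h2 | h2
      · obtain rfl := Circle.arg_injective' h2
        exact shared (left_mem_segment _ _ _) (right_mem_segment _ _ _)
      rcases h3.eq_or_lt with h3 | h3
      · obtain rfl := Circle.arg_injective' h3
        exact shared (right_mem_segment _ _ _) (right_mem_segment _ _ _)
      rw [Set.inter_comm]
      exact chord_inter_of_lt h1 h2 h3

/-- The rank is the number of smaller values. Ties stay ties, so distinctness has to come from `g`.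
-/
theorem exists_rank {ι α : Type*} [Finite ι] [LinearOrder α] (g : ι → α) :
    ∃ f : ι → ℤ, ∀ i j, f i < f j ↔ g i < g j := by
  classical
  have := Fintype.ofFinite ι
  have mono : ∀ i j, g i ≤ g j →
      (Finset.univ.filter fun k => g k < g i) ⊆ (Finset.univ.filter fun k => g k < g j) := by
    intro i j h k
    simp only [Finset.mem_filter, Finset.mem_univ, true_and]
    exact fun hk => hk.trans_le h
  refine ⟨fun i => ((Finset.univ.filter fun k => g k < g i).card : ℤ), fun i j => ?_⟩
  rw [Nat.cast_lt]
  constructor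
  · intro h
    by_contra hn
    exact absurd (Finset.card_le_card (mono j i (not_lt.1 hn))) (not_le.2 h)
  · intro h
    refine Finset.card_lt_card (Finset.ssubset_iff_subset_ne.2 ⟨mono i j h.le, fun e => ?_⟩)
    have : i ∈ Finset.univ.filter fun k => g k < g j := by simpa using h
    rw [← e] at this
    simp at this

theorem IsCircleGraph.exists_isChordDiagram [Finite V] {G : SimpleGraph V}
    (h : IsCircleGraph G) : ∃ a b : V → ℤ, IsChordDiagram G a b := by
  obtain ⟨p, q, hpq, hadj⟩ := h
  obtain ⟨p, q, hpq, hadj⟩ : ∃ p q : V → Circle, (∀ v, (p v : ℂ).arg < (q v : ℂ).arg) ∧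
      ∀ u v, G.Adj u v ↔ u ≠ v ∧ (chord (p u) (q u) ∩ chord (p v) (q v)).Nonempty := by
    refine ⟨fun v => if (p v : ℂ).arg < (q v : ℂ).arg then p v else q v,
      fun v => if (p v : ℂ).arg < (q v : ℂ).arg then q v else p v, fun v => ?_, fun u v => ?_⟩
    · dsimp only
      split_ifs with c
      · exact c
      · exact lt_of_le_of_ne (not_lt.1 c) fun e => hpq v (Circle.arg_injective' e).symm
    · rw [hadj]
      dsimp only
      have e : ∀ w, chord (if (p w : ℂ).arg < (q w : ℂ).arg then p w else q w)
          (if (p w : ℂ).arg < (q w : ℂ).arg then q w else p w) = chord (p w) (q w) := by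
        intro w
        split_ifs
        · rfl
        · exact segment_symm _ _ _
      rw [e, e]
  obtain ⟨i, hi⟩ := exists_injective_nat V
  -- Chords that share an end point have to become interlaced. At one point of the circle first ends
  -- precede second ends. Among first ends the chord that ends earlier comes first, among second
  -- ends the chord that starts earlier. The index puts equal chords in the same order at both ends,
  -- so that they interlace too.
  let o : V → ℝ ×ₗ ℕ ×ₗ ℝ ×ₗ ℕ := fun v =>
    toLex ((p v : ℂ).arg, toLex (0, toLex ((q v : ℂ).arg, i v)))
  let c : V → ℝ ×ₗ ℕ ×ₗ ℝ ×ₗ ℕ := fun v =>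
    toLex ((q v : ℂ).arg, toLex (1, toLex ((p v : ℂ).arg, i v)))
  obtain ⟨f, hf⟩ := exists_rank (Sum.elim o c)
  have hne : ∀ x y, f x ≠ f y ↔ Sum.elim o c x ≠ Sum.elim o c y := by
    intro x y
    rw [ne_iff_lt_or_gt, ne_iff_lt_or_gt]
    simp only [hf]
  refine ⟨fun v => f (Sum.inl v), fun v => f (Sum.inr v), fun v => ?_, fun u v huv => ?_,
    fun u v => ?_⟩
  · simp only [hf, Sum.elim_inl, Sum.elim_inr]
    simp only [o, c, Prod.Lex.toLex_lt_toLex]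
    exact Or.inl (hpq v)
  · simp only [hne, Sum.elim_inl, Sum.elim_inr]
    have := hi.ne huv
    simp only [o, c, ne_eq, EmbeddingLike.apply_eq_iff_eq, Prod.mk.injEq]
    simp [this]
  · simp only [hf, Sum.elim_inl, Sum.elim_inr]
    rw [hadj, chord_inter_iff (hpq u) (hpq v)]
    simp only [o, c, Prod.Lex.toLex_lt_toLex]
    have hu := hpq u
    have hv := hpq v
    by_cases huv : u = v
    · subst huv
      simp
    have hn := hi.ne huv
    generalize (p u : ℂ).arg = α at *
    generalize (q u : ℂ).arg = β at *
    generalize (p v : ℂ).arg = γ at *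
    generalize (q v : ℂ).arg = δ at *
    generalize i u = m at *
    generalize i v = n at *
    grind

/-- The map `Real.arctan` is increasing with values in `(-π/2, π/2)`, so it places the integers on
the circle in the order of their arguments. -/
theorem IsChordDiagram.isCircleGraph {G : SimpleGraph V} {a b : V → ℤ}
    (h : IsChordDiagram G a b) : IsCircleGraph G := by
  have arg : ∀ x : ℤ, (Circle.exp (Real.arctan x) : ℂ).arg = Real.arctan x := by
    intro x
    have h1 := Real.neg_pi_div_two_lt_arctan (x : ℝ)
    have h2 := Real.arctan_lt_pi_div_two (x : ℝ)
    have := Real.pi_pos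
    exact Circle.arg_exp (by linarith) (by linarith)
  have lt : ∀ x y : ℤ, (Circle.exp (Real.arctan x) : ℂ).arg <
      (Circle.exp (Real.arctan y) : ℂ).arg ↔ x < y := by
    intro x y
    rw [arg, arg, Real.arctan_strictMono.lt_iff_lt, Int.cast_lt]
  refine ⟨fun v => Circle.exp (Real.arctan (a v)), fun v => Circle.exp (Real.arctan (b v)),
    fun v e => ?_, fun u v => ?_⟩
  · have := (lt (a v) (b v)).2 (h.lt v)
    dsimp only at e
    rw [e] at this
    exact lt_irrefl _ this
  · rw [chord_inter_iff ((lt _ _).2 (h.lt u)) ((lt _ _).2 (h.lt v))]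
    simp only [← not_lt, lt]
    rw [h.adj]
    by_cases huv : u = v
    · subst huv
      simp
    have h1 := h.ne u v huv
    have h2 := h.ne v u (Ne.symm huv)
    have h3 := h.lt u
    have h4 := h.lt v
    simp only [not_lt, ne_eq, huv, not_false_eq_true, true_and]
    omega

theorem IsCircleGraph.localComplement [Finite V] {G : SimpleGraph V} (h : IsCircleGraph G)
    (u : V) : IsCircleGraph (localComplement G u) := by
  obtain ⟨a, b, h⟩ := h.exists_isChordDiagram
  exact (h.localComplement u).isCircleGraph

end CircleGraphStates

/-! ### Rounding of weights and `r`-local complementation. -/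

namespace CircleGraphStates
open Function

/-- Real weights with integral sums over the pairwise intersections of some sets can be replaced
by integral weights, provided that the sets satisfy a Helly type condition. -/
theorem exists_int_weight {ι V : Type*} [DecidableEq V] (P : ι → Finset V) (I : Finset V)
    (hP : ∀ x, P x ⊆ I)
    (helly : ∀ x y z, (P x ∩ P y ∩ P z).Nonempty →
      P x ∩ P y ⊆ P z ∨ P x ∩ P z ⊆ P y ∨ P y ∩ P z ⊆ P x)
    (s : V → ℝ) (hs : ∀ x y, x ≠ y → ∃ n : ℤ, ∑ u ∈ P x ∩ P y, s u = n) :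
    ∃ t : V → ℤ, ∀ x y, x ≠ y → ∑ u ∈ P x ∩ P y, s u = ((∑ u ∈ P x ∩ P y, t u : ℤ) : ℝ) := by
  classical
  induction hk : (I.filter fun u => s u ≠ ⌊s u⌋).card using Nat.strong_induction_on
    generalizing s with
  | _ k ih =>
  set E := I.filter fun u => s u ≠ ⌊s u⌋ with hE
  by_cases hne : ∃ p : ι × ι, p.1 ≠ p.2 ∧ (E ∩ (P p.1 ∩ P p.2)).Nonempty
  -- A smallest nonempty trace `M` on the set `E` of elements with nonintegral weight.
  · obtain ⟨⟨x, y⟩, ⟨hxy, hM⟩, hmin⟩ := exists_minimalFor_of_wellFoundedLT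
      (fun p : ι × ι => p.1 ≠ p.2 ∧ (E ∩ (P p.1 ∩ P p.2)).Nonempty)
      (fun p => (E ∩ (P p.1 ∩ P p.2)).card) hne
    dsimp only at hxy hM hmin
    set M := E ∩ (P x ∩ P y) with hMdef
    have minimal : ∀ p q, p ≠ q → (E ∩ (P p ∩ P q)).Nonempty → E ∩ (P p ∩ P q) ⊆ M →
        M ⊆ E ∩ (P p ∩ P q) := fun p q hpq h1 h2 =>
      (Finset.eq_of_subset_of_card_le h2
        (hmin (j := (p, q)) ⟨hpq, h1⟩ (Finset.card_le_card h2))).ge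
    -- In the second and third case of the Helly condition, the trace of `P x ∩ P z` or `P y ∩ P z`
    -- is contained in `M`, so it equals `M` by minimality.
    have sub : ∀ z u, u ∈ M → u ∈ P z → M ⊆ P z := by
      intro z u hu hz
      have huE : u ∈ E := (Finset.mem_inter.1 hu).1
      have hux : u ∈ P x := (Finset.mem_inter.1 (Finset.mem_inter.1 hu).2).1
      have huy : u ∈ P y := (Finset.mem_inter.1 (Finset.mem_inter.1 hu).2).2
      by_cases hzx : x = z
      · subst hzx
        exact fun w hw => (Finset.mem_inter.1 (Finset.mem_inter.1 hw).2).1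
      by_cases hzy : y = z
      · subst hzy
        exact fun w hw => (Finset.mem_inter.1 (Finset.mem_inter.1 hw).2).2
      rcases helly x y z ⟨u, by simp [hux, huy, hz]⟩ with h | h | h
      · exact fun w hw => h (Finset.mem_inter.1 hw).2
      · have := minimal x z hzx ⟨u, by simp [huE, hux, hz]⟩ (fun w hw => by
          simp only [Finset.mem_inter, hMdef] at hw ⊢
          exact ⟨hw.1, hw.2.1, h (Finset.mem_inter.2 hw.2)⟩)
        exact fun w hw => (Finset.mem_inter.1 (Finset.mem_inter.1 (this hw)).2).2
      · have := minimal y z hzy ⟨u, by simp [huE, huy, hz]⟩ (fun w hw => by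
          simp only [Finset.mem_inter, hMdef] at hw ⊢
          exact ⟨hw.1, h (Finset.mem_inter.2 hw.2), hw.2.1⟩)
        exact fun w hw => (Finset.mem_inter.1 (Finset.mem_inter.1 (this hw)).2).2
    obtain ⟨e, he⟩ := hM
    -- If `e` were the only element of `M`, all other weights in `P x ∩ P y` would be integral, and
    -- so would that of `e`.
    obtain ⟨e', he', hee⟩ : ∃ e' ∈ M, e ≠ e' := by
      by_contra hcon
      push Not at hcon
      have heE := (Finset.mem_inter.1 he).1
      obtain ⟨n, hn⟩ := hs x y hxy
      rw [← Finset.add_sum_erase _ _ (Finset.mem_inter.1 he).2] at hn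
      have hint : ∑ u ∈ (P x ∩ P y).erase e, s u =
          ((∑ u ∈ (P x ∩ P y).erase e, ⌊s u⌋ : ℤ) : ℝ) := by
        push_cast
        refine Finset.sum_congr rfl fun u hu => ?_
        by_contra hu'
        have huI : u ∈ I := hP x (Finset.mem_inter.1 (Finset.mem_of_mem_erase hu)).1
        have : u ∈ M := Finset.mem_inter.2
          ⟨Finset.mem_filter.2 ⟨huI, hu'⟩, Finset.mem_of_mem_erase hu⟩
        exact Finset.ne_of_mem_erase hu (hcon u this).symm
      rw [hint] at hn
      have h2 : s e = ((n - ∑ u ∈ (P x ∩ P y).erase e, ⌊s u⌋ : ℤ) : ℝ) := by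
        push_cast at hn ⊢
        linarith
      exact (Finset.mem_filter.1 heE).2 (by rw [h2, Int.floor_intCast])
    -- The weight of `e` moves to `e'`. No set `P z` separates the two, so the sums stay, while `e`
    -- leaves `E` and nothing enters it.
    let s' : V → ℝ := fun u => s u + ((if u = e' then s e else 0) - (if u = e then s e else 0))
    have sum_eq : ∀ p q, ∑ u ∈ P p ∩ P q, s' u = ∑ u ∈ P p ∩ P q, s u := by
      intro p q
      have : e ∈ P p ∩ P q ↔ e' ∈ P p ∩ P q := by
        simp only [Finset.mem_inter]
        exact ⟨fun h => ⟨sub p e he h.1 he', sub q e he h.2 he'⟩,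
          fun h => ⟨sub p e' he' h.1 he, sub q e' he' h.2 he⟩⟩
      simp only [s', Finset.sum_add_distrib, Finset.sum_sub_distrib, Finset.sum_ite_eq', this,
        sub_self, add_zero]
    have lt : (I.filter fun u => s' u ≠ ⌊s' u⌋).card < k := by
      rw [← hk]
      refine Finset.card_lt_card ((Finset.ssubset_iff_of_subset ?_).2
        ⟨e, (Finset.mem_inter.1 he).1, ?_⟩)
      · intro u hu
        rw [Finset.mem_filter] at hu
        by_cases h1 : u = e'
        · subst h1
          exact (Finset.mem_inter.1 he').1
        by_cases h2 : u = e
        · subst h2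
          exact (Finset.mem_inter.1 he).1
        have : s' u = s u := by simp [s', h1, h2]
        rw [this] at hu
        exact Finset.mem_filter.2 hu
      · rw [Finset.mem_filter]
        have : s' e = 0 := by simp [s', hee]
        rw [this]
        simp
    obtain ⟨t, ht⟩ := ih _ lt s' (fun p q hpq => by rw [sum_eq]; exact hs p q hpq) rfl
    exact ⟨t, fun p q hpq => by rw [← sum_eq, ht p q hpq]⟩
  -- No pair intersection meets `E`, so the floor changes no weight that matters.
  · push Not at hne
    refine ⟨fun u => ⌊s u⌋, fun x y hxy => ?_⟩
    push_cast
    refine Finset.sum_congr rfl fun u hu => ?_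
    by_contra hu'
    have h := hne (x, y) hxy
    have : u ∈ E ∩ (P x ∩ P y) := Finset.mem_inter.2
      ⟨Finset.mem_filter.2 ⟨hP x (Finset.mem_inter.1 hu).1, hu'⟩, hu⟩
    rw [h] at this
    simp at this

theorem odd_sum_int_iff {ι : Type*} (I : Finset ι) (t : ι → ℤ) :
    Odd (∑ u ∈ I, t u) ↔ Odd (I.filter fun u => Odd (t u)).card := by
  classical
  induction I using Finset.induction_on with
  | empty => simp
  | insert a I ha ih =>
    rw [Finset.sum_insert ha, Finset.filter_insert, Int.odd_add]
    by_cases h : Odd (t a)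
    · rw [if_pos h, Finset.card_insert_of_notMem (by simp [ha]), Nat.odd_add_one, ← ih,
        Int.not_odd_iff_even]
      simp [h]
    · rw [if_neg h, ← ih, ← Int.not_odd_iff_even]
      simp [h]

variable {V : Type*}

/-- The sets `N(v) ∩ I` satisfy the Helly condition of `exists_int_weight`, since a violation is the
configuration of `not_cube_minor`. The set `A` collects the odd rounded weights. -/
theorem IsCircleGraph.exists_odd_weight [Finite V] {G : SimpleGraph V} (hG : IsCircleGraph G)
    (I : Finset V) (hI : G.IsIndepSet (I : Set V)) (s : V → ℝ) (m : V → V → ℤ)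
    [DecidableRel G.Adj]
    (hs : ∀ a b, a ≠ b → ∑ u ∈ I with G.Adj a u ∧ G.Adj b u, s u = m a b) :
    ∃ A : Finset V, A ⊆ I ∧ ∀ a b, a ≠ b →
      (Odd (m a b) ↔ Odd (A.filter fun u => G.Adj a u ∧ G.Adj b u).card) := by
  classical
  obtain ⟨c, d, h⟩ := hG.exists_isChordDiagram
  have inter : ∀ a b, I.filter (G.Adj a) ∩ I.filter (G.Adj b) =
      I.filter fun u => G.Adj a u ∧ G.Adj b u := fun a b => (Finset.filter_and _ _ _).symm
  have nadj : ∀ {u v}, u ∈ I → v ∈ I → ¬ G.Adj u v := fun hu hv huv =>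
    hI hu hv huv.ne huv
  obtain ⟨t, ht⟩ := exists_int_weight (fun v => I.filter (G.Adj v)) I
    (fun _ => Finset.filter_subset _ _) (fun x y z ⟨u, hu⟩ => by
      by_contra hcon
      simp only [not_or, Finset.not_subset] at hcon
      obtain ⟨⟨w₁, h₁, k₁⟩, ⟨w₂, h₂, k₂⟩, ⟨w₃, h₃, k₃⟩⟩ := hcon
      simp only [Finset.mem_inter, Finset.mem_filter, not_and] at *
      have i₁ := h₁.1.1
      have i₂ := h₂.1.1
      have i₃ := h₃.1.1
      have i := hu.1.1.1
      exact h.not_cube_minor (nadj i i₁) (nadj i i₂) (nadj i i₃) (nadj i₁ i₂) (nadj i₁ i₃)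
        (nadj i₂ i₃) hu.2.2.symm hu.1.2.2.symm hu.1.1.2.symm
        (fun e => k₁ i₁ e.symm) h₁.2.2.symm h₁.1.2.symm
        h₂.2.2.symm (fun e => k₂ i₂ e.symm) h₂.1.2.symm
        h₃.2.2.symm h₃.1.2.symm (fun e => k₃ i₃ e.symm)) s
    (fun x y hxy => ⟨m x y, by rw [inter, hs x y hxy]⟩)
  refine ⟨I.filter fun u => Odd (t u), Finset.filter_subset _ _, fun a b hab => ?_⟩
  have e := ht a b hab
  rw [inter, hs a b hab, Int.cast_inj] at e
  rw [e, odd_sum_int_iff]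
  simp only [Finset.filter_filter, and_comm]

/-- Complementing at `u` changes only adjacencies between neighbours of `u`. The later vertices of
`l` are not among them, so their neighbourhoods persist and the toggles add up modulo two. -/
theorem localComplementSeq_adj (G : SimpleGraph V) [DecidableRel G.Adj] (l : List V)
    (hl : ∀ u ∈ l, ∀ v ∈ l, ¬ G.Adj u v) (a b : V) :
    (localComplementSeq G l).Adj a b ↔
      a ≠ b ∧ ¬ (G.Adj a b ↔ Odd (l.countP fun u => G.Adj a u ∧ G.Adj b u)) := by
  classical
  induction l generalizing G with
  | nil =>
    have := G.ne_of_adj (a := a) (b := b)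
    simp only [localComplementSeq, List.foldl_nil, List.countP_nil, Nat.not_odd_zero, iff_false,
      not_not]
    tauto
  | cons u l ih =>
    have adj : ∀ v ∈ l, ∀ w, (localComplement G u).Adj w v ↔ G.Adj w v := by
      intro v hv w
      have := hl u (by simp) v (by simp [hv])
      have := G.ne_of_adj (a := w) (b := v)
      rw [localComplement_adj]
      tauto
    have := ih (localComplement G u) (fun v hv w hw => by
      rw [adj w hw]
      exact hl v (by simp [hv]) w (by simp [hw]))
    rw [localComplementSeq, List.foldl_cons]
    rw [localComplementSeq] at this
    rw [this, List.countP_cons]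
    have e : (l.countP fun v => (localComplement G u).Adj a v ∧ (localComplement G u).Adj b v) =
        l.countP fun v => G.Adj a v ∧ G.Adj b v := by
      refine List.countP_congr fun v hv => ?_
      simp only [adj v hv]
    rw [e, localComplement_adj, G.adj_comm u a, G.adj_comm u b]
    by_cases h : G.Adj a u ∧ G.Adj b u
    · simp only [h, and_self, decide_true, if_true, Nat.odd_add_one]
      tauto
    · simp only [h, decide_false, Bool.false_eq_true, if_false, add_zero]
      tauto

open Classical in
theorem rLocalComplement_one_adj [Fintype V] (G : SimpleGraph V) (A : Finset V) (a b : V) :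
    (rLocalComplement G 1 ((A : Set V).indicator 1)).Adj a b ↔
      a ≠ b ∧ ¬ (G.Adj a b ↔ Odd (A.filter fun u => G.Adj a u ∧ G.Adj b u).card) := by
  have e : commonCount G ((A : Set V).indicator 1) {a, b} =
      (A.filter fun u => G.Adj a u ∧ G.Adj b u).card := by
    rw [commonCount, Finset.sum_filter, Finset.card_filter,
      ← Finset.sum_subset (Finset.subset_univ A) (fun u _ hu => by simp [hu])]
    refine Finset.sum_congr rfl fun u hu => ?_
    simp [hu]
  simp only [rLocalComplement, e]
  rw [xor_iff_not_iff]
  simp only [Nat.sub_self, pow_zero, pow_one, Nat.odd_iff, Nat.ModEq, Nat.mod_eq_of_lt Nat.one_lt_two]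

theorem IsCircleGraph.localComplementSeq [Finite V] {G : SimpleGraph V} (h : IsCircleGraph G)
    (l : List V) : IsCircleGraph (localComplementSeq G l) := by
  induction l generalizing G with
  | nil => exact h
  | cons u l ih => exact ih (h.localComplement u)

theorem rLocalComplement_one_eq_localComplementSeq [Fintype V] (G : SimpleGraph V)
    (A : Finset V) (hA : G.IsIndepSet (A : Set V)) :
    rLocalComplement G 1 ((A : Set V).indicator 1) = localComplementSeq G A.toList := by
  classical
  ext a b
  rw [rLocalComplement_one_adj, localComplementSeq_adj]
  · have : (A.filter fun u => G.Adj a u ∧ G.Adj b u).card =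
        A.toList.countP fun u => G.Adj a u ∧ G.Adj b u := by
      rw [← Multiset.coe_countP, Finset.coe_toList, Multiset.countP_eq_card_filter,
        Finset.card_def, Finset.filter_val]
    rw [this]
  · intro u hu v hv huv
    exact hA (by simpa using hu) (by simpa using hv) huv.ne huv

/-- Of incidence only the case `k = 0` is needed. It makes the pair sums of the weights `S u / 2 ^
(r - 1)` integral, and a pair is toggled exactly when its sum is odd. A pair that meets the support
has no common neighbours in it, by independence. -/
theorem IsCircleGraph.rLocalComplement_eq [Fintype V] {C : SimpleGraph V} (hC : IsCircleGraph C)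
    {r : ℕ} {S : V → ℕ} (hr : 1 ≤ r) (hS : IsIndependentMultiset C S) (hi : IsIncident C r S) :
    ∃ A : Finset V, C.IsIndepSet (A : Set V) ∧
      rLocalComplement C r S = rLocalComplement C 1 ((A : Set V).indicator 1) := by
  classical
  have dvd : ∀ a b, a ≠ b → 2 ^ (r - 1) ∣ commonCount C S {a, b} := by
    intro a b hab
    by_cases h : ∀ v ∈ ({a, b} : Finset V), v ∉ support S
    · have := hi 0 hr {a, b} h (by rw [Finset.card_pair hab])
      simpa using this
    · push Not at h
      obtain ⟨v, hv, hvS⟩ := h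
      have : commonCount C S {a, b} = 0 := by
        refine Finset.sum_eq_zero fun u hu => ?_
        have huv := (Finset.mem_filter.1 hu).2 v hv
        by_contra hne
        exact hS hvS hne huv.ne huv
      rw [this]
      exact dvd_zero _
  have hp : (2 : ℝ) ^ (r - 1) ≠ 0 := by positivity
  have hI : C.IsIndepSet ((Finset.univ.filter (· ∈ support S) : Finset V) : Set V) := by
    rw [Finset.coe_filter]
    simp only [Finset.mem_univ, true_and]
    exact hS
  obtain ⟨A, hA, hodd⟩ := hC.exists_odd_weight (Finset.univ.filter (· ∈ support S)) hI
    (fun u => S u / 2 ^ (r - 1)) (fun a b => (commonCount C S {a, b} / 2 ^ (r - 1) : ℕ))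
    (fun a b hab => by
      rw [Int.cast_natCast, Nat.cast_div (dvd a b hab) (by positivity), commonCount,
        ← Finset.sum_div, Nat.cast_sum, Finset.filter_filter]
      push_cast
      congr 1
      rw [Finset.sum_filter, Finset.sum_filter]
      refine Finset.sum_congr rfl fun u _ => ?_
      by_cases h : S u = 0 <;> simp [h])
  refine ⟨A, fun a ha b hb => hI (hA ha) (hA hb), ?_⟩
  ext a b
  rw [rLocalComplement_one_adj]
  simp only [rLocalComplement, xor_iff_not_iff]
  refine and_congr_right fun hab => ?_
  have e := hodd a b hab
  obtain ⟨m, hm⟩ := dvd a b hab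
  rw [hm, Nat.mul_div_cancel_left _ (by positivity), Int.odd_coe_nat] at e
  have : 2 ^ (r - 1) * m ≡ 2 ^ (r - 1) [MOD 2 ^ r] ↔ Odd m := by
    obtain ⟨k, rfl⟩ := Nat.exists_eq_add_of_le' hr
    rw [Nat.add_sub_cancel, pow_succ, Nat.odd_iff]
    have h2 : 0 < 2 ^ k := by positivity
    unfold Nat.ModEq
    conv_lhs => rhs; rw [← mul_one (2 ^ k)]
    rw [mul_assoc, one_mul, Nat.mul_mod_mul_left, Nat.mul_mod_mul_left]
    constructor
    · intro h
      exact Nat.eq_of_mul_eq_mul_left h2 h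
    · intro h
      rw [h, Nat.one_mod]
  rw [hm, this, e]

end CircleGraphStates

/-! ### Linear algebra of stabilizer supports. -/

namespace CircleGraphStates
open Function Matrix

section LocalSupport

set_option linter.unusedSectionVars false

variable {V : Type*} [Fintype V] [DecidableEq V]

/-- The support of the stabilizer with `X`-part `x` and `Z`-part `M *ᵥ x`. -/
def stabSupport (M : Matrix V V (ZMod 2)) (x : V → ZMod 2) : Finset V :=
  Finset.univ.filter fun w => x w ≠ 0 ∨ (M *ᵥ x) w ≠ 0

theorem mem_stabSupport {M : Matrix V V (ZMod 2)} {x : V → ZMod 2} {w : V} :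
    w ∈ stabSupport M x ↔ x w ≠ 0 ∨ (M *ᵥ x) w ≠ 0 := by
  simp [stabSupport]

theorem notMem_stabSupport {M : Matrix V V (ZMod 2)} {x : V → ZMod 2} {w : V} :
    w ∉ stabSupport M x ↔ x w = 0 ∧ (M *ᵥ x) w = 0 := by
  simp [stabSupport]

theorem stabSupport_zero (M : Matrix V V (ZMod 2)) : stabSupport M 0 = ∅ := by
  simp [stabSupport]

theorem sum_mulVec_comm {M : Matrix V V (ZMod 2)} (hM : M.IsSymm)
    (x y : V → ZMod 2) : ∑ w, x w * (M *ᵥ y) w = ∑ w, (M *ᵥ x) w * y w := by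
  change x ⬝ᵥ M *ᵥ y = (M *ᵥ x) ⬝ᵥ y
  rw [dotProduct_mulVec, ← mulVec_transpose, hM.eq]

/-- Symplectic duality: a functional that vanishes on all restrictions to `A` is pairing with an
element `(q, p)` supported in `A` that commutes with every stabilizer. As `M` is symmetric, this
forces `p = M *ᵥ q`, so the element is itself a stabilizer inside `A` and vanishes by `hA`. -/
theorem exists_restriction {M : Matrix V V (ZMod 2)} (hM : M.IsSymm) {A : Finset V}
    (hA : ∀ x, stabSupport M x ⊆ A → x = 0) (α β : V → ZMod 2) :
    ∃ x, ∀ w ∈ A, x w = α w ∧ (M *ᵥ x) w = β w := by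
  let R : Submodule (ZMod 2) ((V → ZMod 2) × (V → ZMod 2)) :=
    { carrier := {p | ∃ x, ∀ w ∈ A, x w = p.1 w ∧ (M *ᵥ x) w = p.2 w}
      add_mem' := by
        rintro p q ⟨x, hx⟩ ⟨y, hy⟩
        refine ⟨x + y, fun w hw => ?_⟩
        rw [mulVec_add]
        simp [hx w hw, hy w hw]
      zero_mem' := ⟨0, fun w _ => by simp⟩
      smul_mem' := by
        rintro c p ⟨x, hx⟩
        refine ⟨c • x, fun w hw => ?_⟩
        rw [mulVec_smul]
        simp [hx w hw] }
  suffices R = ⊤ by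
    have : (α, β) ∈ R := by rw [this]; trivial
    exact this
  by_contra hR
  obtain ⟨φ, hφ, hker⟩ := Submodule.exists_le_ker_of_lt_top R (lt_top_iff_ne_top.2 hR)
  have hker' : ∀ p, (∃ x, ∀ w ∈ A, x w = p.1 w ∧ (M *ᵥ x) w = p.2 w) → φ p = 0 :=
    fun p hp => hker hp
  let p : V → ZMod 2 := fun w => φ (fun j => if w = j then 1 else 0, 0)
  let q : V → ZMod 2 := fun w => φ (0, fun j => if w = j then 1 else 0)
  have hpq : ∀ a b, φ (a, b) = ∑ w, a w * p w + ∑ w, b w * q w := by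
    intro a b
    have h1 := LinearMap.pi_apply_eq_sum_univ (φ ∘ₗ LinearMap.inl (ZMod 2) _ _) a
    have h2 := LinearMap.pi_apply_eq_sum_univ (φ ∘ₗ LinearMap.inr (ZMod 2) _ _) b
    simp only [LinearMap.comp_apply, LinearMap.inl_apply, LinearMap.inr_apply, smul_eq_mul]
      at h1 h2
    rw [← h1, ← h2, ← map_add, Prod.mk_add_mk, add_zero, zero_add]
  have off : ∀ w, w ∉ A → p w = 0 ∧ q w = 0 := by
    intro w hw
    have : ∀ v ∈ A, w ≠ v := fun v hv e => hw (e ▸ hv)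
    exact ⟨hker' _ ⟨0, fun v hv => by simp [this v hv]⟩,
      hker' _ ⟨0, fun v hv => by simp [this v hv]⟩⟩
  have hp : p = M *ᵥ q := by
    have : ∀ x : V → ZMod 2, ∑ w, x w * (p w + (M *ᵥ q) w) = 0 := by
      intro x
      have h := hker' (x, M *ᵥ x) ⟨x, fun w _ => ⟨rfl, rfl⟩⟩
      rw [hpq, ← sum_mulVec_comm hM, ← Finset.sum_add_distrib] at h
      rw [← h]
      exact Finset.sum_congr rfl fun w _ => mul_add _ _ _
    funext w
    have := this (Pi.single w 1)
    simp only [Pi.single_apply, ite_mul, one_mul, zero_mul, Finset.sum_ite_eq', Finset.mem_univ,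
      if_true] at this
    rwa [CharTwo.add_eq_zero] at this
  have hq : q = 0 := by
    refine hA q fun w hw => ?_
    by_contra hwA
    rw [mem_stabSupport, ← hp] at hw
    exact hw.elim (· (off w hwA).2) (· (off w hwA).1)
  have hp0 : p = 0 := by rw [hp, hq, mulVec_zero]
  refine hφ (LinearMap.ext fun ab => ?_)
  obtain ⟨a, b⟩ := ab
  rw [hpq, hq, hp0]
  simp

/-- At the qubit `u`, the stabilizers with support exactly `ω` either all show the same Pauli
matrix, or they are just `x`, `y`, `x + y`. The set `ω` is the support of a stabilizer that meets
`u` and leaves a maximal stabilizer-free set `A` in one point only. -/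
theorem exists_stabSupport {M : Matrix V V (ZMod 2)} (hM : M.IsSymm) (u : V) :
    ∃ ω : Finset V, u ∈ ω ∧
      (((∃ x, stabSupport M x = ω) ∧ ∀ x y, stabSupport M x = ω → stabSupport M y = ω →
          x u = y u ∧ (M *ᵥ x) u = (M *ᵥ y) u) ∨
        ∃ x y, stabSupport M x = ω ∧ stabSupport M y = ω ∧ stabSupport M (x + y) = ω ∧
          ∀ z, stabSupport M z = ω → z = x ∨ z = y ∨ z = x + y) := by
  have one : ∀ a : ZMod 2, a ≠ 0 → a = 1 := by decide
  by_cases hu : ∃ x, x ≠ 0 ∧ stabSupport M x ⊆ {u}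
  · obtain ⟨x, hx0, hx⟩ := hu
    refine ⟨{u}, by simp, Or.inl ⟨⟨x, ?_⟩, ?_⟩⟩
    · refine (Finset.subset_singleton_iff.1 hx).resolve_left fun h => hx0 (funext fun w => ?_)
      exact (notMem_stabSupport.1 (h ▸ Finset.notMem_empty w)).1
    · have key : ∀ z, stabSupport M z = {u} → z = Pi.single u 1 := by
        intro z hz
        have h0 : ∀ w, w ≠ u → z w = 0 := fun w hw =>
          (notMem_stabSupport.1 (by rw [hz]; simpa using hw : w ∉ stabSupport M z)).1
        have h1 : z u = 1 := by
          refine one _ fun h => ?_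
          have : z = 0 := by
            funext w
            by_cases hw : w = u
            · rw [hw, h]; rfl
            · exact h0 w hw
          rw [this, stabSupport_zero] at hz
          simp at hz
        funext w
        by_cases hw : w = u
        · subst hw
          simp [h1]
        · rw [h0 w hw, Pi.single_eq_of_ne hw]
      intro y z hy hz
      rw [key y hy, key z hz]
      exact ⟨rfl, rfl⟩
  have hu' : ∀ x, stabSupport M x ⊆ {u} → x = 0 := by
    intro x hx
    by_contra h
    exact hu ⟨x, h, hx⟩
  obtain ⟨A, huA, hmax⟩ := (Set.toFinite
    {A : Finset V | ∀ x, stabSupport M x ⊆ A → x = 0}).exists_le_maximal (a := {u})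
    (show ({u} : Finset V) ∈ {A : Finset V | ∀ x, stabSupport M x ⊆ A → x = 0} from hu')
  have huA : u ∈ A := huA (by simp)
  have hA := hmax.prop
  have hbig : ∀ v, v ∉ A → ∃ x, stabSupport M x ⊆ insert v A ∧ x ≠ 0 := by
    intro v hv
    by_contra hcon
    push Not at hcon
    exact hv (hmax.le_of_ge (y := insert v A) hcon (Finset.subset_insert v A)
      (Finset.mem_insert_self v A))
  -- Otherwise take stabilizers `y`, `z` that are `X` and `Z` at `u` and trivial on the rest of `A`.
  -- At each `w ∉ A` both commute with the nontrivial entry of some `t` there, hence with each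
  -- other. They would then anticommute at `u` alone, although stabilizers commute.
  have hex : ∃ t, (∃ v, v ∉ A ∧ stabSupport M t ⊆ insert v A) ∧ u ∈ stabSupport M t := by
    by_contra hcon
    push Not at hcon
    obtain ⟨y, hy⟩ := exists_restriction hM hA (Pi.single u 1) 0
    obtain ⟨z, hz⟩ := exists_restriction hM hA 0 (Pi.single u 1)
    have hcomm := sum_mulVec_comm hM y z
    have out : ∀ w, w ∉ A → y w * (M *ᵥ z) w = (M *ᵥ y) w * z w := by
      intro w hw
      obtain ⟨t, ht, ht0⟩ := hbig w hw
      have htu := notMem_stabSupport.1 (hcon t ⟨w, hw, ht⟩)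
      have htw : t w ≠ 0 ∨ (M *ᵥ t) w ≠ 0 := by
        by_contra h
        refine ht0 (hA t fun v hv => ?_)
        rcases Finset.mem_insert.1 (ht hv) with rfl | h'
        · exact absurd (mem_stabSupport.1 hv) h
        · exact h'
      have only : ∀ v, v ≠ w → v ∉ A → t v = 0 ∧ (M *ᵥ t) v = 0 := fun v h1 h2 =>
        notMem_stabSupport.1 fun h => by
          rcases Finset.mem_insert.1 (ht h) with h | h
          · exact h1 h
          · exact h2 h
      have e1 := sum_mulVec_comm hM t y
      have e2 := sum_mulVec_comm hM t z
      have c1 : t w * (M *ᵥ y) w = (M *ᵥ t) w * y w := by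
        rw [← sub_eq_zero, ← Finset.sum_sub_distrib, Finset.sum_eq_single w] at e1
        · exact sub_eq_zero.1 e1
        · intro v _ hv
          by_cases hvA : v ∈ A
          · rw [(hy v hvA).1, (hy v hvA).2]
            by_cases hvu : v = u
            · subst hvu
              simp [htu]
            · simp [hvu]
          · simp [only v hv hvA]
        · exact fun h => absurd (Finset.mem_univ _) h
      have c2 : t w * (M *ᵥ z) w = (M *ᵥ t) w * z w := by
        rw [← sub_eq_zero, ← Finset.sum_sub_distrib, Finset.sum_eq_single w] at e2
        · exact sub_eq_zero.1 e2
        · intro v _ hv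
          by_cases hvA : v ∈ A
          · rw [(hz v hvA).1, (hz v hvA).2]
            by_cases hvu : v = u
            · subst hvu
              simp [htu]
            · simp [hvu]
          · simp [only v hv hvA]
        · exact fun h => absurd (Finset.mem_univ _) h
      have fin : ∀ a b c d e f : ZMod 2, a ≠ 0 ∨ b ≠ 0 → a * c = b * d → a * e = b * f →
          d * e = c * f := by decide
      exact fin _ _ _ _ _ _ htw c1 c2
    rw [← sub_eq_zero, ← Finset.sum_sub_distrib, Finset.sum_eq_single u] at hcomm
    · rw [(hy u huA).1, (hy u huA).2, (hz u huA).1, (hz u huA).2] at hcomm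
      simp at hcomm
    · intro v _ hvu
      by_cases hvA : v ∈ A
      · rw [(hy v hvA).1, (hy v hvA).2]
        simp [hvu]
      · rw [out v hvA, sub_self]
    · simp
  obtain ⟨t, ⟨⟨v, hv, ht⟩, hut⟩, hmin⟩ := exists_minimalFor_of_wellFoundedLT _
    (fun t => (stabSupport M t).card) hex
  dsimp only at hmin
  -- Stabilizers inside `insert v A` are determined by their entry at `v`, since a difference that
  -- is trivial there is supported in `A`. So at most three of them are nonzero.
  have inj : ∀ x y, stabSupport M x ⊆ insert v A → stabSupport M y ⊆ insert v A →
      x v = y v → (M *ᵥ x) v = (M *ᵥ y) v → x = y := by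
    intro x y hx hy h1 h2
    rw [← sub_eq_zero]
    refine hA _ fun w hw => ?_
    by_contra hwA
    by_cases hwv : w = v
    · subst hwv
      rw [mem_stabSupport, mulVec_sub] at hw
      simp [h1, h2] at hw
    · have a := notMem_stabSupport.1 fun h => (Finset.mem_insert.1 (hx h)).elim hwv hwA
      have b := notMem_stabSupport.1 fun h => (Finset.mem_insert.1 (hy h)).elim hwv hwA
      rw [mem_stabSupport, mulVec_sub] at hw
      simp [a, b] at hw
  refine ⟨stabSupport M t, hut, ?_⟩
  by_cases hall : ∀ x y, stabSupport M x = stabSupport M t → stabSupport M y = stabSupport M t →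
      x u = y u ∧ (M *ᵥ x) u = (M *ᵥ y) u
  · exact Or.inl ⟨⟨t, rfl⟩, hall⟩
  right
  push Not at hall
  obtain ⟨x, y, hx, hy, hxy⟩ := hall
  have sub : stabSupport M (x + y) ⊆ stabSupport M t := by
    intro w hw
    by_contra h
    have a := notMem_stabSupport.1 (hx ▸ h)
    have b := notMem_stabSupport.1 (hy ▸ h)
    rw [mem_stabSupport, mulVec_add] at hw
    simp [a, b] at hw
  have two : ∀ a b : ZMod 2, a + b = 0 → a = b := by decide
  have hxyu : u ∈ stabSupport M (x + y) := by
    by_contra h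
    have := notMem_stabSupport.1 h
    rw [mulVec_add] at this
    exact hxy (two _ _ this.1) (two _ _ this.2)
  -- The sum still meets `u`, because `x` and `y` differ there, so minimality of `t` applies to it.
  have hsum : stabSupport M (x + y) = stabSupport M t :=
    Finset.eq_of_subset_of_card_le sub
      (hmin (j := x + y) ⟨⟨v, hv, sub.trans ht⟩, hxyu⟩ (Finset.card_le_card sub))
  refine ⟨x, y, hx, hy, hsum, fun z hz => ?_⟩
  have hvt : v ∈ stabSupport M t := by
    by_contra h
    have : t = 0 := hA t fun w hw => by
      rcases Finset.mem_insert.1 (ht hw) with rfl | h'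
      · exact absurd hw h
      · exact h'
    rw [this, stabSupport_zero] at hut
    simp at hut
  have nz := mem_stabSupport.1 (hz ▸ hvt)
  have nx := mem_stabSupport.1 (hx ▸ hvt)
  have ny := mem_stabSupport.1 (hy ▸ hvt)
  have nxy := mem_stabSupport.1 (hsum ▸ hvt)
  rw [mulVec_add] at nxy
  have fin : ∀ a b c : ZMod 2 × ZMod 2, a ≠ 0 → b ≠ 0 → c ≠ 0 → a + b ≠ 0 →
      c = a ∨ c = b ∨ c = a + b := by decide
  have ne : ∀ a b : ZMod 2, a ≠ 0 ∨ b ≠ 0 → (a, b) ≠ 0 := by decide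
  rcases fin _ _ _ (ne _ _ nx) (ne _ _ ny) (ne _ _ nz) (ne _ _ nxy) with h | h | h <;>
    simp only [Prod.mk.injEq, Prod.mk_add_mk] at h
  · exact Or.inl (inj _ _ (hz ▸ ht) (hx ▸ ht) h.1 h.2)
  · exact Or.inr (Or.inl (inj _ _ (hz ▸ ht) (hy ▸ ht) h.1 h.2))
  · exact Or.inr (Or.inr (inj _ _ (hz ▸ ht) (hsum ▸ ht) h.1 (by rw [mulVec_add]; exact h.2)))

end LocalSupport

end CircleGraphStates

/-! ### Pauli matrices and product operators. -/

namespace CircleGraphStates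
open Function Matrix

section Pauli

/-- The Pauli matrix which is `X ^ c.1 * Z ^ c.2` up to a phase. -/
noncomputable def pauli (c : ZMod 2 × ZMod 2) : Matrix (Fin 2) (Fin 2) ℂ :=
  if c.1 = 0 then (if c.2 = 0 then 1 else !![1, 0; 0, -1])
  else (if c.2 = 0 then !![0, 1; 1, 0] else !![0, -Complex.I; Complex.I, 0])

theorem pauli_cases {p : ZMod 2 × ZMod 2 → Prop} (h00 : p (0, 0)) (h01 : p (0, 1))
    (h10 : p (1, 0)) (h11 : p (1, 1)) (c : ZMod 2 × ZMod 2) : p c := by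
  have : ∀ c : ZMod 2 × ZMod 2, c = (0, 0) ∨ c = (0, 1) ∨ c = (1, 0) ∨ c = (1, 1) := by decide
  rcases this c with rfl | rfl | rfl | rfl <;> assumption

@[simp] theorem pauli_zero : pauli (0, 0) = 1 := by simp [pauli]
@[simp] theorem pauli_z : pauli (0, 1) = !![1, 0; 0, -1] := by simp [pauli]
@[simp] theorem pauli_x : pauli (1, 0) = !![0, 1; 1, 0] := by simp [pauli]
@[simp] theorem pauli_y : pauli (1, 1) = !![0, -Complex.I; Complex.I, 0] := by simp [pauli]

theorem mem_paulis_iff {P : Matrix (Fin 2) (Fin 2) ℂ} : P ∈ paulis ↔ ∃ c, P = pauli c := by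
  constructor
  · rintro (rfl | rfl | rfl | rfl)
    exacts [⟨(0, 0), by simp⟩, ⟨(1, 0), by simp⟩, ⟨(1, 1), by simp⟩, ⟨(0, 1), by simp⟩]
  · rintro ⟨c, rfl⟩
    revert c
    apply pauli_cases <;> simp [paulis]

theorem one_eq_of : (1 : Matrix (Fin 2) (Fin 2) ℂ) = !![1, 0; 0, 1] := by
  ext i j; fin_cases i <;> fin_cases j <;> rfl

theorem conjTranspose_of (a b c d : ℂ) :
    (!![a, b; c, d])ᴴ = !![star a, star c; star b, star d] := by
  ext i j; fin_cases i <;> fin_cases j <;> rfl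

theorem pauli_conjTranspose (c : ZMod 2 × ZMod 2) : (pauli c)ᴴ = pauli c := by
  revert c
  apply pauli_cases <;> simp [conjTranspose_of]

theorem pauli_mul_self (c : ZMod 2 × ZMod 2) : pauli c * pauli c = 1 := by
  revert c
  apply pauli_cases <;> simp [one_eq_of]

theorem pauli_trace {c : ZMod 2 × ZMod 2} (hc : c ≠ 0) : (pauli c).trace = 0 := by
  revert hc
  refine pauli_cases (p := fun c => c ≠ 0 → (pauli c).trace = 0) ?_ ?_ ?_ ?_ c <;>
    simp [Matrix.trace_fin_two]

/-- The nontrivial character of `ZMod 2`. -/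
noncomputable def chi (a : ZMod 2) : ℂ := if a = 0 then 1 else -1

theorem zmod_two_cases (a : ZMod 2) : a = 0 ∨ a = 1 := by revert a; decide

@[simp] theorem chi_zero : chi 0 = 1 := by simp [chi]
@[simp] theorem chi_one : chi 1 = -1 := by simp [chi]

theorem chi_add (a b : ZMod 2) : chi (a + b) = chi a * chi b := by
  have : (1 : ZMod 2) + 1 = 0 := by decide
  rcases zmod_two_cases a with rfl | rfl <;> rcases zmod_two_cases b with rfl | rfl <;>
    simp [this]

theorem chi_sum {ι : Type*} (s : Finset ι) (f : ι → ZMod 2) :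
    chi (∑ i ∈ s, f i) = ∏ i ∈ s, chi (f i) := by
  classical
  induction s using Finset.induction_on with
  | empty => simp
  | insert a s ha ih => rw [Finset.sum_insert ha, Finset.prod_insert ha, chi_add, ih]

theorem pauli_mul_comm (c d : ZMod 2 × ZMod 2) :
    pauli c * pauli d = chi (c.1 * d.2 + c.2 * d.1) • (pauli d * pauli c) := by
  have : (1 : ZMod 2) + 1 = 0 := by decide
  revert c d
  refine pauli_cases ?_ ?_ ?_ ?_ <;> refine pauli_cases ?_ ?_ ?_ ?_ <;> simp [this]

/-- The coefficient of a Pauli matrix in the expansion of a matrix. -/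
noncomputable def pauliCoeff (M : Matrix (Fin 2) (Fin 2) ℂ) (c : ZMod 2 × ZMod 2) : ℂ :=
  (pauli c * M).trace / 2

theorem sum_zmod_two_prod {β : Type*} [AddCommMonoid β] (f : ZMod 2 × ZMod 2 → β) :
    ∑ c, f c = (f (0, 0) + f (0, 1)) + (f (1, 0) + f (1, 1)) := by
  rw [Fintype.sum_prod_type]
  have : ∀ g : ZMod 2 → β, ∑ a, g a = g 0 + g 1 := fun g => Fin.sum_univ_two g
  rw [this, this, this]

theorem sum_pauliCoeff (M : Matrix (Fin 2) (Fin 2) ℂ) :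
    ∑ c, pauliCoeff M c • pauli c = M := by
  rw [sum_zmod_two_prod]
  rw [Matrix.eta_fin_two M]
  simp only [pauliCoeff, pauli_zero, pauli_z, pauli_x, pauli_y, one_eq_of, Matrix.trace_fin_two]
  ext i j
  fin_cases i <;> fin_cases j <;> simp <;> ring_nf <;> simp <;> ring

/-- Parseval's identity: the Pauli matrices are orthonormal for half the trace form. -/
theorem sum_sq_pauliCoeff {M : Matrix (Fin 2) (Fin 2) ℂ} (hM : Mᴴ * M = 1) :
    ∑ c, ‖pauliCoeff M c‖ ^ 2 = 1 := by
  have h : ((∑ c, ‖pauliCoeff M c‖ ^ 2 : ℝ) : ℂ) = (Mᴴ * M).trace / 2 := by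
    rw [sum_zmod_two_prod]
    push_cast
    simp only [← Complex.mul_conj']
    rw [Matrix.eta_fin_two M]
    simp only [pauliCoeff, pauli_zero, pauli_z, pauli_x, pauli_y, one_eq_of,
      Matrix.trace_fin_two, conjTranspose_of]
    have h2 : (starRingEnd ℂ) 2 = 2 := map_ofNat _ 2
    simp [h2]
    ring_nf
    simp
    ring
  rw [hM] at h
  simp only [Matrix.trace_one, Fintype.card_fin] at h
  have h2 : ((∑ c, ‖pauliCoeff M c‖ ^ 2 : ℝ) : ℂ) = ((1 : ℝ) : ℂ) := by
    rw [h]; simp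
  exact Complex.ofReal_injective h2

theorem pauliCoeff_pauli (c d : ZMod 2 × ZMod 2) :
    pauliCoeff (pauli c) d = if c = d then 1 else 0 := by
  revert c d
  refine pauli_cases ?_ ?_ ?_ ?_ <;> refine pauli_cases ?_ ?_ ?_ ?_ <;>
    simp [pauliCoeff, Matrix.trace_fin_two, one_eq_of]

end Pauli

section TensorOp

set_option linter.unusedSectionVars false

variable {V : Type*} [Fintype V] [DecidableEq V]

theorem tensorOp_mul (A B : V → Matrix (Fin 2) (Fin 2) ℂ) :
    tensorOp A * tensorOp B = tensorOp fun u => A u * B u := by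
  ext x y
  simp only [tensorOp, Matrix.mul_apply, Matrix.of_apply]
  rw [Finset.prod_univ_sum, Fintype.piFinset_univ]
  simp only [Finset.prod_mul_distrib]

theorem tensorOp_one : tensorOp (fun _ : V => (1 : Matrix (Fin 2) (Fin 2) ℂ)) = 1 := by
  ext x y
  simp only [tensorOp, Matrix.of_apply, Matrix.one_apply]
  by_cases h : x = y
  · simp [h]
  · obtain ⟨u, hu⟩ := Function.ne_iff.1 h
    rw [if_neg h]
    exact Finset.prod_eq_zero (Finset.mem_univ u) (if_neg hu)

theorem tensorOp_conjTranspose (A : V → Matrix (Fin 2) (Fin 2) ℂ) :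
    (tensorOp A)ᴴ = tensorOp fun u => (A u)ᴴ := by
  ext x y
  simp [tensorOp, Matrix.conjTranspose_apply]

theorem tensorOp_smul (c : V → ℂ) (A : V → Matrix (Fin 2) (Fin 2) ℂ) :
    tensorOp (fun u => c u • A u) = (∏ u, c u) • tensorOp A := by
  ext x y
  simp [tensorOp, Finset.prod_mul_distrib]

theorem tensorOp_sum (m : V → ZMod 2 × ZMod 2 → ℂ) :
    tensorOp (fun u => ∑ c, m u c • pauli c) =
      ∑ q : V → ZMod 2 × ZMod 2, (∏ u, m u (q u)) • tensorOp fun u => pauli (q u) := by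
  ext x y
  simp only [tensorOp, Matrix.of_apply, Matrix.sum_apply, Matrix.smul_apply, smul_eq_mul]
  rw [Finset.prod_univ_sum, Fintype.piFinset_univ]
  simp only [Finset.prod_mul_distrib]

/-- The expectation value of a product operator. -/
noncomputable def expect (ψ : (V → Fin 2) → ℂ) (A : V → Matrix (Fin 2) (Fin 2) ℂ) : ℂ :=
  star ψ ⬝ᵥ (tensorOp A *ᵥ ψ)

theorem expect_eq_sum (ψ : (V → Fin 2) → ℂ) (A : V → Matrix (Fin 2) (Fin 2) ℂ) :
    expect ψ A = ∑ q : V → ZMod 2 × ZMod 2, (∏ u, pauliCoeff (A u) (q u)) *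
      expect ψ fun u => pauli (q u) := by
  have : A = fun u => ∑ c, pauliCoeff (A u) c • pauli c := by
    funext u
    rw [sum_pauliCoeff]
  conv_lhs => rw [this]
  rw [expect, tensorOp_sum, Matrix.sum_mulVec, dotProduct_sum]
  simp only [Matrix.smul_mulVec, dotProduct_smul, smul_eq_mul, expect]

theorem expect_mulVec (ψ : (V → Fin 2) → ℂ) (U A : V → Matrix (Fin 2) (Fin 2) ℂ) :
    expect (tensorOp U *ᵥ ψ) A = expect ψ fun u => (U u)ᴴ * A u * U u := by
  have : tensorOp (fun u => (U u)ᴴ * A u * U u) = (tensorOp U)ᴴ * tensorOp A * tensorOp U := by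
    rw [tensorOp_conjTranspose, tensorOp_mul, tensorOp_mul]
  rw [expect, expect, this, Matrix.star_mulVec, Matrix.mulVec_mulVec, ← Matrix.dotProduct_mulVec,
    Matrix.mulVec_mulVec, Matrix.mul_assoc]

/-- Product operators with one nonzero entry in each row act by a substitution and a phase. -/
theorem tensorOp_mulVec_of_monomial {A : V → Matrix (Fin 2) (Fin 2) ℂ} {f : V → Fin 2 → Fin 2}
    {d : V → Fin 2 → ℂ} (h : ∀ u i j, A u i j = if j = f u i then d u i else 0)
    (ψ : (V → Fin 2) → ℂ) (x : V → Fin 2) :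
    (tensorOp A *ᵥ ψ) x = (∏ u, d u (x u)) * ψ fun u => f u (x u) := by
  simp only [Matrix.mulVec, dotProduct, tensorOp, Matrix.of_apply]
  rw [Finset.sum_eq_single fun u => f u (x u)]
  · simp [h]
  · intro y _ hy
    obtain ⟨u, hu⟩ := Function.ne_iff.1 hy
    rw [Finset.prod_eq_zero (Finset.mem_univ u), zero_mul]
    rw [h, if_neg hu]
  · simp

end TensorOp

end CircleGraphStates

/-! ### Expectation values and Pauli strings. -/

namespace CircleGraphStates
open Function Matrix

section Vectors

set_option linter.unusedSectionVars false

variable {V : Type*} [Fintype V] [DecidableEq V]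

theorem star_dotProduct_self (ψ : (V → Fin 2) → ℂ) :
    star ψ ⬝ᵥ ψ = ((∑ x, ‖ψ x‖ ^ 2 : ℝ) : ℂ) := by
  simp [dotProduct, Complex.conj_mul']

theorem isUnitVector_iff {ψ : (V → Fin 2) → ℂ} : IsUnitVector ψ ↔ star ψ ⬝ᵥ ψ = 1 := by
  rw [star_dotProduct_self, IsUnitVector, ← Complex.ofReal_one, Complex.ofReal_inj]

theorem star_mulVec_dotProduct (A : Matrix (V → Fin 2) (V → Fin 2) ℂ) (ψ φ : (V → Fin 2) → ℂ) :
    star (A *ᵥ ψ) ⬝ᵥ φ = star ψ ⬝ᵥ (Aᴴ *ᵥ φ) := by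
  rw [Matrix.star_mulVec, ← Matrix.dotProduct_mulVec]

theorem IsUnitVector.mulVec {A : Matrix (V → Fin 2) (V → Fin 2) ℂ} (hA : Aᴴ * A = 1)
    {ψ : (V → Fin 2) → ℂ} (hψ : IsUnitVector ψ) : IsUnitVector (A *ᵥ ψ) := by
  rw [isUnitVector_iff] at hψ ⊢
  rw [star_mulVec_dotProduct, Matrix.mulVec_mulVec, hA, Matrix.one_mulVec, hψ]

theorem norm_star_dotProduct_le_one {ψ φ : (V → Fin 2) → ℂ} (hψ : IsUnitVector ψ)
    (hφ : IsUnitVector φ) : ‖star ψ ⬝ᵥ φ‖ ≤ 1 := by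
  calc ‖star ψ ⬝ᵥ φ‖ ≤ ∑ x, ‖star ψ x * φ x‖ := norm_sum_le _ _
    _ ≤ ∑ x, (‖ψ x‖ ^ 2 + ‖φ x‖ ^ 2) / 2 := by
        refine Finset.sum_le_sum fun x _ => ?_
        rw [norm_mul, Pi.star_apply, norm_star]
        nlinarith [sq_nonneg (‖ψ x‖ - ‖φ x‖)]
    _ = 1 := by
        rw [← Finset.sum_div, Finset.sum_add_distrib, hψ, hφ]
        norm_num

theorem tensorOp_unitary {U : V → Matrix (Fin 2) (Fin 2) ℂ} (hU : ∀ u, (U u)ᴴ * U u = 1) :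
    (tensorOp U)ᴴ * tensorOp U = 1 := by
  rw [tensorOp_conjTranspose, tensorOp_mul]
  simp only [hU, tensorOp_one]

theorem norm_expect_le_one {ψ : (V → Fin 2) → ℂ} (hψ : IsUnitVector ψ)
    {U : V → Matrix (Fin 2) (Fin 2) ℂ} (hU : ∀ u, (U u)ᴴ * U u = 1) : ‖expect ψ U‖ ≤ 1 :=
  norm_star_dotProduct_le_one hψ (hψ.mulVec (tensorOp_unitary hU))

/-- Inserting `K` on the right and moving it past `P` to the left shows that the value equals its
own negative. -/
theorem dotProduct_mulVec_eq_zero_of_anticommute {K P : Matrix (V → Fin 2) (V → Fin 2) ℂ}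
    {ψ : (V → Fin 2) → ℂ} (hK : Kᴴ = K) (hKψ : K *ᵥ ψ = ψ) (h : P * K = -(K * P)) :
    star ψ ⬝ᵥ (P *ᵥ ψ) = 0 := by
  have h1 : star ψ ⬝ᵥ (P *ᵥ ψ) = -(star ψ ⬝ᵥ (P *ᵥ ψ)) := by
    conv_lhs => rw [← hKψ]
    rw [hKψ]
    conv_lhs => rw [← hKψ, Matrix.mulVec_mulVec, h, Matrix.neg_mulVec, dotProduct_neg,
      ← Matrix.mulVec_mulVec]
    rw [hKψ]
    conv_lhs => rw [← hK, ← star_mulVec_dotProduct, hKψ]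
  exact self_eq_neg.1 h1

/-- The tensor product of Pauli matrices. -/
noncomputable def pauliString (q : V → ZMod 2 × ZMod 2) : Matrix (V → Fin 2) (V → Fin 2) ℂ :=
  tensorOp fun u => pauli (q u)

theorem expect_pauli (ψ : (V → Fin 2) → ℂ) (q : V → ZMod 2 × ZMod 2) :
    expect ψ (fun u => pauli (q u)) = star ψ ⬝ᵥ (pauliString q *ᵥ ψ) := rfl

theorem pauliString_conjTranspose (q : V → ZMod 2 × ZMod 2) :
    (pauliString q)ᴴ = pauliString q := by
  simp only [pauliString, tensorOp_conjTranspose, pauli_conjTranspose]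

theorem pauliString_mul_self (q : V → ZMod 2 × ZMod 2) :
    pauliString q * pauliString q = 1 := by
  simp only [pauliString, tensorOp_mul, pauli_mul_self, tensorOp_one]

theorem pauliString_mul_comm (q r : V → ZMod 2 × ZMod 2) :
    pauliString q * pauliString r =
      chi (∑ u, ((q u).1 * (r u).2 + (q u).2 * (r u).1)) • (pauliString r * pauliString q) := by
  simp only [pauliString, tensorOp_mul]
  rw [chi_sum, ← tensorOp_smul]
  simp only [pauli_mul_comm (q _) (r _)]

theorem eq_or_eq_neg_of_pauliString {ψ : (V → Fin 2) → ℂ} (hψ : ψ ≠ 0)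
    {q : V → ZMod 2 × ZMod 2} {c : ℂ} (h : pauliString q *ᵥ ψ = c • ψ) : c = 1 ∨ c = -1 := by
  have h2 : pauliString q *ᵥ (pauliString q *ᵥ ψ) = ψ := by
    rw [Matrix.mulVec_mulVec, pauliString_mul_self, Matrix.one_mulVec]
  rw [h, Matrix.mulVec_smul, h, smul_smul] at h2
  have h3 : (c * c - 1) • ψ = 0 := by rw [sub_smul, h2, one_smul, sub_self]
  have h4 := (smul_eq_zero.1 h3).resolve_right hψ
  exact mul_self_eq_one_iff.1 (sub_eq_zero.1 h4)

end Vectors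

/-! ### Amplitudes of graph states. -/

section GraphState

set_option linter.unusedSectionVars false

variable {V : Type*} [Fintype V] [DecidableEq V]

/-- The sign `(-1) ^ i`. -/
noncomputable def sgn (i : Fin 2) : ℂ := (-1) ^ (i : ℕ)

@[simp] theorem sgn_zero : sgn 0 = 1 := by simp [sgn]
@[simp] theorem sgn_one : sgn 1 = -1 := by simp [sgn]

theorem fin_two_cases (i : Fin 2) : i = 0 ∨ i = 1 := by revert i; decide

theorem sgn_mul_self (i : Fin 2) : sgn i * sgn i = 1 := by
  rcases fin_two_cases i with rfl | rfl <;> simp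

/-- The basis vector `x` with the bit `a` flipped. -/
def flipAt (x : V → Fin 2) (a : V) : V → Fin 2 := update x a (x a + 1)

@[simp] theorem flipAt_same (x : V → Fin 2) (a : V) : flipAt x a a = x a + 1 := by simp [flipAt]

theorem flipAt_of_ne (x : V → Fin 2) {a b : V} (h : b ≠ a) : flipAt x a b = x b := by
  simp [flipAt, h]

theorem fin_two_add_one_add_one (i : Fin 2) : i + 1 + 1 = i := by revert i; decide

theorem flipAt_flipAt (x : V → Fin 2) (a : V) : flipAt (flipAt x a) a = x := by
  funext b
  by_cases h : b = a
  · subst h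
    simp [fin_two_add_one_add_one]
  · rw [flipAt_of_ne _ h, flipAt_of_ne _ h]

theorem flipAt_comm (x : V → Fin 2) (a b : V) :
    flipAt (flipAt x a) b = flipAt (flipAt x b) a := by
  funext c
  by_cases h : a = b
  · rw [h]
  by_cases h1 : c = a
  · subst h1
    simp [flipAt, h]
  · by_cases h2 : c = b <;> simp [flipAt, h1, h2, Ne.symm h]

/-- The sign `(-1) ^ (∑ b, x b)` with the sum over the neighbours `b` of `a`. -/
noncomputable def nbrSign (G : SimpleGraph V) (x : V → Fin 2) (a : V) : ℂ :=
  open Classical in ∏ b with G.Adj a b, sgn (x b)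

theorem nbrSign_mul_self (G : SimpleGraph V) (x : V → Fin 2) (a : V) :
    nbrSign G x a * nbrSign G x a = 1 := by
  classical
  rw [nbrSign, ← Finset.prod_mul_distrib]
  exact Finset.prod_eq_one fun b _ => sgn_mul_self _

theorem nbrSign_congr {G : SimpleGraph V} {x y : V → Fin 2} {a : V}
    (h : ∀ b, G.Adj a b → x b = y b) : nbrSign G x a = nbrSign G y a := by
  classical
  refine Finset.prod_congr rfl fun b hb => ?_
  rw [h b (Finset.mem_filter.1 hb).2]

theorem nbrSign_flipAt_of_not_adj {G : SimpleGraph V} (x : V → Fin 2) {a b : V}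
    (h : ¬ G.Adj a b) : nbrSign G (flipAt x b) a = nbrSign G x a :=
  nbrSign_congr fun c hc => flipAt_of_ne _ (by rintro rfl; exact h hc)

theorem sgn_add_one (i : Fin 2) : sgn (i + 1) = - sgn i := by
  have : (1 : Fin 2) + 1 = 0 := by decide
  rcases fin_two_cases i with rfl | rfl <;> simp [this]

theorem nbrSign_flipAt_of_adj {G : SimpleGraph V} (x : V → Fin 2) {a b : V}
    (h : G.Adj a b) : nbrSign G (flipAt x b) a = - nbrSign G x a := by
  classical
  have hb : b ∈ Finset.univ.filter (G.Adj a) := by simpa using h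
  rw [nbrSign, nbrSign, ← Finset.mul_prod_erase _ _ hb, ← Finset.mul_prod_erase _ _ hb,
    flipAt_same, sgn_add_one, neg_mul]
  congr 2
  exact Finset.prod_congr rfl fun c hc => by rw [flipAt_of_ne _ (Finset.ne_of_mem_erase hc)]

/-- Only the edges at `a` notice the flip, and the edge to `b` contributes the sign of the bit at
`b`. -/
theorem graphState_flipAt (G : SimpleGraph V) (x : V → Fin 2) (a : V) :
    graphState G (flipAt x a) = nbrSign G x a * graphState G x := by
  classical
  have sq : ∀ e, czPhase x e * czPhase x e = 1 := by
    intro e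
    induction e with
    | _ u v =>
      simp only [czPhase, Sym2.lift_mk]
      rw [← mul_pow]
      norm_num
  have h1 : ∏ e : Sym2 V with e ∈ G.edgeSet, czPhase (flipAt x a) e =
      (∏ e : Sym2 V with e ∈ G.edgeSet, czPhase (flipAt x a) e * czPhase x e) *
        ∏ e : Sym2 V with e ∈ G.edgeSet, czPhase x e := by
    rw [← Finset.prod_mul_distrib]
    exact Finset.prod_congr rfl fun e _ => by rw [mul_assoc, sq, mul_one]
  have h2 : ∏ e : Sym2 V with e ∈ G.edgeSet, czPhase (flipAt x a) e * czPhase x e =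
      nbrSign G x a := by
    rw [nbrSign, ← Finset.prod_subset
      (s₁ := (Finset.univ.filter (G.Adj a)).image fun b => s(a, b))]
    · rw [Finset.prod_image]
      · refine Finset.prod_congr rfl fun b hb => ?_
        have hab := (Finset.mem_filter.1 hb).2.ne
        simp only [czPhase, Sym2.lift_mk, flipAt_same, flipAt_of_ne x hab.symm, sgn]
        have : (1 : Fin 2) + 1 = 0 := by decide
        rcases fin_two_cases (x a) with h | h <;> simp [h, this]
      · intro b _ c _ hbc
        rcases Sym2.eq_iff.1 hbc with h | h
        · exact h.2
        · exact h.2.trans h.1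
    · intro e he
      obtain ⟨b, hb, rfl⟩ := Finset.mem_image.1 he
      simpa using hb
    · intro e he he'
      induction e with
      | _ u v =>
        have hu : u ≠ a := by
          rintro rfl
          exact he' (Finset.mem_image.2 ⟨v, by simpa using he, rfl⟩)
        have hv : v ≠ a := by
          rintro rfl
          refine he' (Finset.mem_image.2 ⟨u, ?_, Sym2.eq_swap⟩)
          simpa [G.adj_comm] using he
        rw [← sq s(u, v)]
        simp only [czPhase, Sym2.lift_mk, flipAt_of_ne x hu, flipAt_of_ne x hv]
  rw [graphState, h1, h2, graphState]
  simp only [plusState]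
  ring

theorem plusState_ne_zero (x : V → Fin 2) : plusState V x ≠ 0 := by
  rw [plusState, Finset.prod_ne_zero_iff]
  intro _ _
  rw [Complex.ofReal_ne_zero]
  positivity

theorem graphState_ne_zero (G : SimpleGraph V) (x : V → Fin 2) : graphState G x ≠ 0 := by
  classical
  refine mul_ne_zero (Finset.prod_ne_zero_iff.2 fun e _ => ?_) (plusState_ne_zero x)
  induction e with
  | _ u v => simp [czPhase]

theorem isUnitVector_graphState (G : SimpleGraph V) : IsUnitVector (graphState G) := by
  classical
  have : ∀ x, ‖graphState G x‖ ^ 2 = (1 / 2) ^ Fintype.card V := by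
    intro x
    have h1 : ‖∏ e : Sym2 V with e ∈ G.edgeSet, czPhase x e‖ = 1 := by
      rw [norm_prod]
      refine Finset.prod_eq_one fun e _ => ?_
      induction e with
      | _ u v => simp [czPhase]
    rw [graphState, norm_mul, h1, one_mul, plusState, norm_prod, Finset.prod_const,
      Finset.card_univ, ← pow_mul, mul_comm, pow_mul]
    congr 1
    rw [Complex.norm_real, Real.norm_of_nonneg (by positivity), div_pow, one_pow,
      Real.sq_sqrt (by norm_num)]
  rw [IsUnitVector, Finset.sum_congr rfl fun x _ => this x]
  simp

/-- Up to a scalar, the graph state is determined by its behaviour under bit flips. -/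
theorem eq_smul_graphState {G : SimpleGraph V} {f : (V → Fin 2) → ℂ}
    (h : ∀ x a, f (flipAt x a) = nbrSign G x a * f x) :
    ∃ c : ℂ, f = c • graphState G := by
  classical
  refine ⟨f 0 / graphState G 0, funext fun x => ?_⟩
  induction hk : (Finset.univ.filter fun a => x a ≠ 0).card generalizing x with
  | zero =>
    have : x = 0 := by
      funext a
      by_contra ha
      exact (Finset.filter_eq_empty_iff.1 (Finset.card_eq_zero.1 hk)) (Finset.mem_univ a) ha
    rw [this, Pi.smul_apply, smul_eq_mul, div_mul_cancel₀ _ (graphState_ne_zero G 0)]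
  | succ k ih =>
    obtain ⟨a, ha⟩ : (Finset.univ.filter fun a => x a ≠ 0).Nonempty := by
      rw [← Finset.card_pos, hk]; omega
    have hxa : x a + 1 = 0 := by
      have := (Finset.mem_filter.1 ha).2
      revert this
      generalize x a = i
      revert i
      decide
    have e : (Finset.univ.filter fun b => flipAt x a b ≠ 0) =
        (Finset.univ.filter fun a => x a ≠ 0).erase a := by
      ext b
      by_cases hb : b = a
      · subst hb
        simp [hxa]
      · simp [flipAt_of_ne x hb, hb]
    have := ih (flipAt x a) (by rw [e, Finset.card_erase_of_mem ha, hk]; rfl)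
    have e2 := h (flipAt x a) a
    have e3 := graphState_flipAt G (flipAt x a) a
    rw [flipAt_flipAt] at e2 e3
    rw [e2, this, Pi.smul_apply, Pi.smul_apply, e3, smul_eq_mul, smul_eq_mul]
    ring

/-- The change of the amplitudes of a graph state under changes of an independent set of bits. -/
theorem graphState_eq_of_eq_off {G : SimpleGraph V} {I : Finset V}
    (hI : ∀ u ∈ I, ∀ v ∈ I, ¬ G.Adj u v) {x y : V → Fin 2} (hxy : ∀ u, u ∉ I → y u = x u) :
    graphState G y = (∏ u ∈ I, if y u = x u then 1 else nbrSign G x u) * graphState G x := by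
  classical
  induction hk : (I.filter fun u => y u ≠ x u).card generalizing y with
  | zero =>
    have h0 := Finset.filter_eq_empty_iff.1 (Finset.card_eq_zero.1 hk)
    have : y = x := by
      funext u
      by_cases hu : u ∈ I
      · exact not_not.1 (h0 hu)
      · exact hxy u hu
    simp [this]
  | succ k ih =>
    obtain ⟨a, ha⟩ : (I.filter fun u => y u ≠ x u).Nonempty := by
      rw [← Finset.card_pos, hk]; omega
    obtain ⟨haI, hya⟩ := Finset.mem_filter.1 ha
    have hya' : y a + 1 = x a := by
      revert hya
      generalize y a = i
      generalize x a = j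
      revert i j
      decide
    have e : (I.filter fun b => flipAt y a b ≠ x b) =
        (I.filter fun u => y u ≠ x u).erase a := by
      ext b
      by_cases hb : b = a
      · subst hb
        simp [hya']
      · simp [flipAt_of_ne y hb, hb]
    have := ih (y := flipAt y a) (fun u hu => by
      rw [flipAt_of_ne y (by rintro rfl; exact hu haI), hxy u hu])
      (by rw [e, Finset.card_erase_of_mem ha, hk]; rfl)
    rw [← flipAt_flipAt y a, graphState_flipAt, this, flipAt_flipAt, ← mul_assoc]
    congr 1
    rw [nbrSign_congr (y := x), ← Finset.mul_prod_erase I _ haI, ← Finset.mul_prod_erase I _ haI,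
      if_neg hya, flipAt_same, if_pos hya', one_mul]
    · congr 1
      exact Finset.prod_congr rfl fun b hb => by rw [flipAt_of_ne _ (Finset.ne_of_mem_erase hb)]
    · intro b hb
      have hbI : b ∉ I := fun h => hI a haI b h hb
      rw [flipAt_of_ne y hb.ne', hxy b hbI]

/-- The action on a graph state of a product of diagonal operators and, on an independent set, of
combinations of `1` and `X`. -/
theorem tensorOp_mulVec_graphState {G : SimpleGraph V} {I : Finset V}
    (hI : ∀ u ∈ I, ∀ v ∈ I, ¬ G.Adj u v) {D : V → Matrix (Fin 2) (Fin 2) ℂ}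
    {d : V → Fin 2 → ℂ} {α β : V → ℂ}
    (hd : ∀ u, u ∉ I → ∀ i j, D u i j = if j = i then d u i else 0)
    (hα : ∀ u ∈ I, ∀ i j, D u i j = if j = i then α u else β u) (x : V → Fin 2) :
    (tensorOp D *ᵥ graphState G) x =
      (∏ u, if u ∈ I then α u + β u * nbrSign G x u else d u (x u)) * graphState G x := by
  -- On the graph state `X` at `u` acts as the sign `nbrSign G x u`; independence of `I` keeps these
  -- signs unaffected by flips at other vertices of `I`. The product over `u` of the sums of `E u`
  -- expands to the sum over `y` in the matrix product.
  let E : V → Fin 2 → ℂ := fun u j =>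
    if u ∈ I then (if j = x u then α u else β u * nbrSign G x u)
    else (if j = x u then d u (x u) else 0)
  have hE : ∀ u, (if u ∈ I then α u + β u * nbrSign G x u else d u (x u)) = ∑ j, E u j := by
    intro u
    simp only [E, Fin.sum_univ_two]
    by_cases hu : u ∈ I
    · rcases fin_two_cases (x u) with h | h <;> simp [hu, h, add_comm]
    · rcases fin_two_cases (x u) with h | h <;> simp [hu, h]
  rw [Finset.prod_congr rfl fun u _ => hE u, Finset.prod_univ_sum, Fintype.piFinset_univ,
    Finset.sum_mul]
  simp only [Matrix.mulVec, dotProduct, tensorOp, Matrix.of_apply]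
  refine Finset.sum_congr rfl fun y _ => ?_
  by_cases hy : ∀ u, u ∉ I → y u = x u
  · rw [graphState_eq_of_eq_off hI hy, ← mul_assoc]
    congr 1
    have : ∀ f : V → ℂ, ∏ u ∈ I, f u = ∏ u, if u ∈ I then f u else 1 := fun f => by
      rw [Finset.prod_ite_mem, Finset.univ_inter]
    rw [this, ← Finset.prod_mul_distrib]
    refine Finset.prod_congr rfl fun u _ => ?_
    by_cases hu : u ∈ I
    · by_cases h : y u = x u <;> simp [E, hu, h, hα u hu]
    · simp [E, hu, hy u hu, hd u hu]
  · push Not at hy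
    obtain ⟨u, hu, hne⟩ := hy
    have h1 : ∏ w, D w (x w) (y w) = 0 :=
      Finset.prod_eq_zero (Finset.mem_univ u) (by simp [hd u hu, hne])
    have h2 : ∏ w, E w (y w) = 0 :=
      Finset.prod_eq_zero (Finset.mem_univ u) (by simp [E, hu, hne])
    rw [h1, h2, zero_mul, zero_mul]

end GraphState

end CircleGraphStates

/-! ### Stabilizers of graph states and the Pauli dichotomy. -/

namespace CircleGraphStates
open Function Matrix

section Stabilizers

set_option linter.unusedSectionVars false

variable {V : Type*} [Fintype V] [DecidableEq V]

open Classical in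
/-- The Pauli string of the canonical stabilizer of a graph state at the vertex `a`. -/
noncomputable def canonicalStabilizer (G : SimpleGraph V) (a : V) : V → ZMod 2 × ZMod 2 :=
  fun b => (if b = a then 1 else 0, if G.Adj a b then 1 else 0)

theorem pauliString_canonicalStabilizer_mulVec (G : SimpleGraph V) (a : V)
    (ψ : (V → Fin 2) → ℂ) (x : V → Fin 2) :
    (pauliString (canonicalStabilizer G a) *ᵥ ψ) x = nbrSign G x a * ψ (flipAt x a) := by
  classical
  rw [pauliString, tensorOp_mulVec_of_monomial (f := fun u i => if u = a then i + 1 else i)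
    (d := fun u i => if G.Adj a u then sgn i else 1)]
  · congr 1
    · rw [nbrSign, Finset.prod_filter]
    · congr 1
      funext u
      by_cases h : u = a
      · subst h
        simp
      · simp [h, flipAt_of_ne]
  · have : (1 : Fin 2) + 1 = 0 := by decide
    intro u i j
    by_cases h : u = a
    · subst h
      rcases fin_two_cases i with rfl | rfl <;> rcases fin_two_cases j with rfl | rfl <;>
        simp [canonicalStabilizer, this]
    · by_cases h' : G.Adj a u <;>
      rcases fin_two_cases i with rfl | rfl <;> rcases fin_two_cases j with rfl | rfl <;>
        simp [canonicalStabilizer, h, h']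

theorem canonicalStabilizer_mulVec_graphState (G : SimpleGraph V) (a : V) :
    pauliString (canonicalStabilizer G a) *ᵥ graphState G = graphState G := by
  funext x
  rw [pauliString_canonicalStabilizer_mulVec, graphState_flipAt, ← mul_assoc, nbrSign_mul_self,
    one_mul]

open Classical in
theorem sum_canonicalStabilizer (G : SimpleGraph V) (a : V) (q : V → ZMod 2 × ZMod 2) :
    ∑ u, ((q u).1 * (canonicalStabilizer G a u).2 + (q u).2 * (canonicalStabilizer G a u).1) =
      (G.adjMatrix (ZMod 2) *ᵥ fun u => (q u).1) a + (q a).2 := by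
  rw [Finset.sum_add_distrib]
  congr 1
  · simp [canonicalStabilizer, Matrix.mulVec, dotProduct, SimpleGraph.adjMatrix_apply]
  · simp [canonicalStabilizer]

open Classical in
-- Such a string anticommutes with the canonical stabilizer at `a`.
theorem expect_graphState_eq_zero {G : SimpleGraph V} {q : V → ZMod 2 × ZMod 2} {a : V}
    (h : (q a).2 ≠ (G.adjMatrix (ZMod 2) *ᵥ fun u => (q u).1) a) :
    expect (graphState G) (fun u => pauli (q u)) = 0 := by
  refine dotProduct_mulVec_eq_zero_of_anticommute (pauliString_conjTranspose _)
    (canonicalStabilizer_mulVec_graphState G a) ?_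
  change pauliString q * _ = _
  rw [pauliString_mul_comm, sum_canonicalStabilizer]
  have : ∀ b c : ZMod 2, c ≠ b → b + c = 1 := by decide
  rw [this _ _ h, chi_one, neg_one_smul]
  rfl

open Classical in
-- Such a string commutes with all canonical stabilizers, and these determine the graph state up to
-- a scalar. The scalar is a sign since the string squares to one.
theorem pauliString_mulVec_graphState {G : SimpleGraph V} {q : V → ZMod 2 × ZMod 2}
    (h : ∀ a, (q a).2 = (G.adjMatrix (ZMod 2) *ᵥ fun u => (q u).1) a) :
    pauliString q *ᵥ graphState G = graphState G ∨
      pauliString q *ᵥ graphState G = - graphState G := by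
  have hψ : graphState G ≠ 0 := fun h0 => graphState_ne_zero G 0 (by rw [h0]; rfl)
  obtain ⟨c, hc⟩ := eq_smul_graphState (G := G) (f := pauliString q *ᵥ graphState G) (by
    intro x a
    have e : pauliString (canonicalStabilizer G a) *ᵥ (pauliString q *ᵥ graphState G) =
        pauliString q *ᵥ graphState G := by
      have h2 : ∀ b : ZMod 2, b + b = 0 := by decide
      have := pauliString_mul_comm q (canonicalStabilizer G a)
      rw [sum_canonicalStabilizer, ← h, h2, chi_zero, one_smul] at this
      rw [Matrix.mulVec_mulVec, ← this, ← Matrix.mulVec_mulVec,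
        canonicalStabilizer_mulVec_graphState]
    have := congrFun e x
    rw [pauliString_canonicalStabilizer_mulVec] at this
    conv_rhs => rw [← this, ← mul_assoc, nbrSign_mul_self, one_mul])
  rcases eq_or_eq_neg_of_pauliString hψ hc with rfl | rfl
  · exact Or.inl (by rw [hc, one_smul])
  · exact Or.inr (by rw [hc, neg_one_smul])

open Classical in
theorem norm_expect_graphState {G : SimpleGraph V} {q : V → ZMod 2 × ZMod 2}
    (h : ∀ a, (q a).2 = (G.adjMatrix (ZMod 2) *ᵥ fun u => (q u).1) a) :
    ‖expect (graphState G) fun u => pauli (q u)‖ = 1 := by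
  have h1 := isUnitVector_iff.1 (isUnitVector_graphState G)
  rw [expect_pauli]
  rcases pauliString_mulVec_graphState h with e | e
  · rw [e, h1, norm_one]
  · rw [e, dotProduct_neg, h1, norm_neg, norm_one]

/-- The property of stabilizer states that every Pauli string stabilizes the state up to a sign
or has expectation value zero. -/
def HasPauliDichotomy (ψ : (V → Fin 2) → ℂ) : Prop :=
  ∀ q : V → ZMod 2 × ZMod 2, pauliString q *ᵥ ψ = ψ ∨ pauliString q *ᵥ ψ = -ψ ∨
    expect ψ (fun u => pauli (q u)) = 0

theorem IsUnitVector.ne_zero {ψ : (V → Fin 2) → ℂ} (h : IsUnitVector ψ) : ψ ≠ 0 := by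
  rintro rfl
  simp [IsUnitVector] at h

/-- A string that commutes with the generators maps `ψ` to a common fixed vector, so uniqueness
makes `ψ` an eigenvector; any other string anticommutes with some generator. -/
theorem IsStabilizerState.hasPauliDichotomy {ψ : (V → Fin 2) → ℂ} (h : IsStabilizerState ψ) :
    HasPauliDichotomy ψ := by
  obtain ⟨hψ, g, hg, -, -, hfix, huniq⟩ := h
  have hg' : ∀ i, ∃ q, g i = pauliString q ∨ g i = - pauliString q := by
    intro i
    obtain ⟨P, hP, h⟩ := hg i
    choose q hq using fun u => mem_paulis_iff.1 (hP u)
    obtain rfl : P = fun u => pauli (q u) := funext hq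
    exact ⟨q, h⟩
  intro q
  by_cases hcomm : ∀ i, pauliString q * g i = g i * pauliString q
  · have hfix' : ∀ i, g i *ᵥ (pauliString q *ᵥ ψ) = pauliString q *ᵥ ψ := by
      intro i
      rw [Matrix.mulVec_mulVec, ← hcomm i, ← Matrix.mulVec_mulVec, hfix i]
    have hunit : IsUnitVector (pauliString q *ᵥ ψ) :=
      hψ.mulVec (by rw [pauliString_conjTranspose, pauliString_mul_self])
    obtain ⟨c, -, hc⟩ := huniq _ hunit hfix'
    rcases eq_or_eq_neg_of_pauliString hψ.ne_zero hc with rfl | rfl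
    · exact Or.inl (by rw [hc, one_smul])
    · exact Or.inr (Or.inl (by rw [hc, neg_one_smul]))
  · push Not at hcomm
    obtain ⟨i, hi⟩ := hcomm
    obtain ⟨r, hr⟩ := hg' i
    refine Or.inr (Or.inr (dotProduct_mulVec_eq_zero_of_anticommute (K := g i) ?_ (hfix i) ?_))
    · rcases hr with e | e <;> rw [e] <;> simp [pauliString_conjTranspose]
    · have key := pauliString_mul_comm q r
      change pauliString q * g i = -(g i * pauliString q)
      rcases zmod_two_cases (∑ u, ((q u).1 * (r u).2 + (q u).2 * (r u).1)) with h0 | h1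
      · rw [h0, chi_zero, one_smul] at key
        exact absurd (by rcases hr with e | e <;> rw [e] <;> simp [key]) hi
      · rw [h1, chi_one, neg_one_smul] at key
        rcases hr with e | e <;> rw [e] <;> simp [key]

end Stabilizers

/-! ### Unitaries that respect a Pauli axis. -/

section Axes

set_option linter.unusedSectionVars false

/-- Conjugation by `U` maps the Pauli matrix `c` to the Pauli matrix `d`, up to a sign. -/
def MapsPauli (U : Matrix (Fin 2) (Fin 2) ℂ) (c d : ZMod 2 × ZMod 2) : Prop :=
  U * pauli c * Uᴴ = pauli d ∨ U * pauli c * Uᴴ = - pauli d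

/-- By Parseval one coefficient of absolute value at least one leaves no room for the others, so the
conjugate is a multiple of `pauli c`, and the factor is a sign because both square to one. -/
theorem mapsPauli_of_norm_pauliCoeff {U : Matrix (Fin 2) (Fin 2) ℂ} (hU : Uᴴ * U = 1)
    {c d : ZMod 2 × ZMod 2} (h : 1 ≤ ‖pauliCoeff (Uᴴ * pauli d * U) c‖) : MapsPauli U c d := by
  have hU' : U * Uᴴ = 1 := mul_eq_one_comm.1 hU
  set N := Uᴴ * pauli d * U with hN
  have hNN : N * N = 1 := by
    have : N * N = Uᴴ * pauli d * (U * Uᴴ) * pauli d * U := by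
      rw [hN]; noncomm_ring
    rw [this, hU', mul_one, Matrix.mul_assoc Uᴴ, pauli_mul_self, Matrix.mul_one, hU]
  have hNH : Nᴴ = N := by
    rw [hN]
    simp [Matrix.conjTranspose_mul, pauli_conjTranspose, Matrix.mul_assoc]
  have hsum := sum_sq_pauliCoeff (M := N) (by rw [hNH, hNN])
  have h0 : ∀ e, e ≠ c → pauliCoeff N e = 0 := by
    intro e he
    rw [← Finset.add_sum_erase _ _ (Finset.mem_univ c)] at hsum
    have h1 : ‖pauliCoeff N e‖ ^ 2 ≤ ∑ e ∈ Finset.univ.erase c, ‖pauliCoeff N e‖ ^ 2 :=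
      Finset.single_le_sum (f := fun e => ‖pauliCoeff N e‖ ^ 2) (fun _ _ => by positivity)
        (Finset.mem_erase.2 ⟨he, Finset.mem_univ e⟩)
    have h2 : ‖pauliCoeff N e‖ ^ 2 ≤ 0 := by nlinarith
    have h3 : ‖pauliCoeff N e‖ = 0 := by
      have := sq_nonneg ‖pauliCoeff N e‖
      exact pow_eq_zero_iff two_ne_zero |>.1 (le_antisymm h2 this)
    exact norm_eq_zero.1 h3
  have hNc : N = pauliCoeff N c • pauli c := by
    conv_lhs => rw [← sum_pauliCoeff N]
    rw [Finset.sum_eq_single c]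
    · intro e _ he
      rw [h0 e he, zero_smul]
    · simp
  have hm : pauliCoeff N c * pauliCoeff N c = 1 := by
    rw [hNc, smul_mul_smul_comm, pauli_mul_self] at hNN
    have := congrFun (congrFun hNN 0) 0
    simpa using this
  have back : U * N * Uᴴ = pauli d := by
    have : U * N * Uᴴ = (U * Uᴴ) * pauli d * (U * Uᴴ) := by
      rw [hN]; noncomm_ring
    rw [this, hU', mul_one, one_mul]
  rw [hNc] at back
  rcases mul_self_eq_one_iff.1 hm with e | e
  · rw [e, one_smul] at back
    exact Or.inl back
  · rw [e, neg_one_smul] at back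
    right
    rw [← back]
    noncomm_ring

theorem MapsPauli.symm {U : Matrix (Fin 2) (Fin 2) ℂ} (hU : Uᴴ * U = 1)
    {c d : ZMod 2 × ZMod 2} (h : MapsPauli U c d) : MapsPauli Uᴴ d c := by
  have e : Uᴴ * (U * pauli c * Uᴴ) * Uᴴᴴ = pauli c := by
    have : Uᴴ * (U * pauli c * Uᴴ) * Uᴴᴴ = (Uᴴ * U) * pauli c * (Uᴴ * U) := by
      rw [conjTranspose_conjTranspose]; noncomm_ring
    rw [this, hU, one_mul, mul_one]
  rcases h with h | h <;> rw [h] at e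
  · exact Or.inl e
  · right
    rw [← e]
    noncomm_ring

end Axes

end CircleGraphStates

/-! ### Existence of Pauli axes. -/

namespace CircleGraphStates
open Function Matrix

section ExistsAxis

set_option linter.unusedSectionVars false

variable {V : Type*} [Fintype V] [DecidableEq V]

theorem HasPauliDichotomy.norm_expect {ψ : (V → Fin 2) → ℂ} (h : HasPauliDichotomy ψ)
    (hψ : IsUnitVector ψ) {q : V → ZMod 2 × ZMod 2} (hq : expect ψ (fun u => pauli (q u)) ≠ 0) :
    ‖expect ψ fun u => pauli (q u)‖ = 1 := by
  have h1 := isUnitVector_iff.1 hψ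
  rw [expect_pauli]
  rcases h q with e | e | e
  · rw [e, h1, norm_one]
  · rw [e, dotProduct_neg, h1, norm_neg, norm_one]
  · exact absurd e hq

/-- The edge between `u` and `v` is a connected component of `G`. -/
def IsIsolatedEdge (G : SimpleGraph V) (u v : V) : Prop :=
  (∀ w, G.Adj u w ↔ w = v) ∧ ∀ w, G.Adj v w ↔ w = u

/-- Conjugation fixes the identity and preserves the trace. It follows that local unitaries preserve
the supports of Pauli strings in expansions. -/
theorem pauliCoeff_conj_eq_zero {U : Matrix (Fin 2) (Fin 2) ℂ} (hU : Uᴴ * U = 1)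
    {c d : ZMod 2 × ZMod 2} (h : pauliCoeff (Uᴴ * pauli c * U) d ≠ 0) : c = 0 ↔ d = 0 := by
  have h00 : ((0 : ZMod 2), (0 : ZMod 2)) = 0 := rfl
  constructor
  · rintro rfl
    by_contra hd
    rw [← h00, pauli_zero, mul_one, hU, ← pauli_zero, h00, pauliCoeff_pauli, if_neg (Ne.symm hd)]
      at h
    exact h rfl
  · rintro rfl
    by_contra hc
    rw [pauliCoeff, ← h00, pauli_zero, one_mul, Matrix.trace_mul_comm, ← Matrix.mul_assoc,
      mul_eq_one_comm.1 hU, one_mul, pauli_trace hc, zero_div] at h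
    exact h rfl

open Classical in
theorem mem_stabSupport_iff_of_expect_ne_zero {G : SimpleGraph V} {q : V → ZMod 2 × ZMod 2}
    (h : expect (graphState G) (fun u => pauli (q u)) ≠ 0) :
    ∃ x, (q = fun w => (x w, (G.adjMatrix (ZMod 2) *ᵥ x) w)) ∧
      ∀ w, w ∈ stabSupport (G.adjMatrix (ZMod 2)) x ↔ q w ≠ 0 := by
  have hq : ∀ a, (q a).2 = (G.adjMatrix (ZMod 2) *ᵥ fun u => (q u).1) a := by
    intro a
    by_contra ha
    exact h (expect_graphState_eq_zero ha)
  refine ⟨fun u => (q u).1, funext fun w => Prod.ext rfl (hq w), fun w => ?_⟩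
  rw [mem_stabSupport, ← hq, ne_eq (q w), Prod.ext_iff, not_and_or]
  rfl

/-- If the same elements of a family of weights are concentrated on few indices then one of the
coefficients has absolute value at least one. -/
theorem exists_one_le_of_one_le_sum {ι : Type*} (T : Finset ι) {a b c : ι → ℝ}
    (ha : ∀ i, 0 ≤ a i) (hb : ∀ i, 0 ≤ b i)
    (ha' : ∑ i ∈ T, a i ^ 2 ≤ 1) (hb' : ∑ i ∈ T, b i ^ 2 ≤ 1)
    (h : 1 ≤ ∑ i ∈ T, c i * (a i * b i)) : ∃ i ∈ T, 1 ≤ c i := by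
  by_contra hcon
  push Not at hcon
  have h1 : ∑ i ∈ T, a i * b i ≤ 1 := by
    calc ∑ i ∈ T, a i * b i ≤ ∑ i ∈ T, (a i ^ 2 + b i ^ 2) / 2 :=
          Finset.sum_le_sum fun i _ => by nlinarith [sq_nonneg (a i - b i)]
      _ ≤ 1 := by
          rw [← Finset.sum_div, Finset.sum_add_distrib]
          linarith
  have h2 : ∑ i ∈ T, (1 - c i) * (a i * b i) ≤ 0 := by
    simp only [sub_mul, one_mul, Finset.sum_sub_distrib]
    linarith
  have h3 : ∀ i ∈ T, 0 ≤ (1 - c i) * (a i * b i) := fun i hi =>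
    mul_nonneg (by linarith [hcon i hi]) (mul_nonneg (ha i) (hb i))
  have h4 := (Finset.sum_eq_zero_iff_of_nonneg h3).1 (le_antisymm h2 (Finset.sum_nonneg h3))
  have h5 : ∑ i ∈ T, c i * (a i * b i) = 0 := by
    refine Finset.sum_eq_zero fun i hi => ?_
    rcases mul_eq_zero.1 (h4 i hi) with e | e
    · linarith [hcon i hi]
    · rw [e, mul_zero]
  linarith

open Classical in
-- Nonzero vectors `x`, `y`, `x + y` supported in `ω` need two coordinates `u`, `v`, and then they
-- are all the nonzero vectors there. In particular the canonical stabilizers at `u` and `v` have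
-- support `ω`, which says that each vertex has only the other as a neighbour.
theorem exists_isIsolatedEdge {G : SimpleGraph V} {ω : Finset V} (hω : ω.card ≤ 2) {u : V}
    (hu : u ∈ ω) {x y : V → ZMod 2} (hx : stabSupport (G.adjMatrix (ZMod 2)) x = ω)
    (hy : stabSupport (G.adjMatrix (ZMod 2)) y = ω)
    (hxy : stabSupport (G.adjMatrix (ZMod 2)) (x + y) = ω) :
    ∃ v, v ≠ u ∧ ω = {u, v} ∧ IsIsolatedEdge G u v := by
  have off : ∀ z, stabSupport (G.adjMatrix (ZMod 2)) z = ω → ∀ w, w ∉ ω → z w = 0 :=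
    fun z hz w hw => (notMem_stabSupport.1 (hz ▸ hw)).1
  have nz : ∀ z, stabSupport (G.adjMatrix (ZMod 2)) z = ω → z ≠ 0 := by
    rintro z hz rfl
    rw [stabSupport_zero] at hz
    rw [← hz] at hu
    simp at hu
  obtain ⟨v, hvu, hv⟩ : ∃ v, v ≠ u ∧ ω = {u, v} := by
    have h1 : (ω.erase u).card ≤ 1 := by rw [Finset.card_erase_of_mem hu]; omega
    rcases Nat.le_one_iff_eq_zero_or_eq_one.1 h1 with h | h
    · exfalso
      have hω : ∀ w, w ≠ u → w ∉ ω := by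
        intro w hw hwω
        have : w ∈ ω.erase u := Finset.mem_erase.2 ⟨hw, hwω⟩
        rw [Finset.card_eq_zero.1 h] at this
        simp at this
      have one : ∀ z, stabSupport (G.adjMatrix (ZMod 2)) z = ω → z u = 1 := by
        intro z hz
        refine (zmod_two_cases (z u)).resolve_left fun h0 => nz z hz (funext fun w => ?_)
        by_cases hw : w = u
        · rw [hw, h0]; rfl
        · exact off z hz w (hω w hw)
      have h3 := one _ hxy
      rw [Pi.add_apply, one x hx, one y hy] at h3
      exact absurd h3 (by decide)
    · obtain ⟨v, hv⟩ := Finset.card_eq_one.1 h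
      refine ⟨v, Finset.ne_of_mem_erase (hv ▸ Finset.mem_singleton_self v), ?_⟩
      rw [← Finset.insert_erase hu, hv]
  refine ⟨v, hvu, hv, ?_⟩
  have offv : ∀ z, stabSupport (G.adjMatrix (ZMod 2)) z = ω → ∀ w, w ≠ u → w ≠ v → z w = 0 :=
    fun z hz w h1 h2 => off z hz w (by rw [hv]; simp [h1, h2])
  have ext : ∀ z z' : V → ZMod 2, (∀ w, w ≠ u → w ≠ v → z w = 0) → (∀ w, w ≠ u → w ≠ v → z' w = 0) →
      (z u, z v) = (z' u, z' v) → z = z' := by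
    intro z z' h h' e
    rw [Prod.mk.injEq] at e
    funext w
    by_cases h1 : w = u
    · rw [h1, e.1]
    by_cases h2 : w = v
    · rw [h2, e.2]
    rw [h w h1 h2, h' w h1 h2]
  have nzp : ∀ z, stabSupport (G.adjMatrix (ZMod 2)) z = ω → (z u, z v) ≠ 0 := by
    intro z hz h
    exact nz z hz (ext z 0 (offv z hz) (fun _ _ _ => rfl) h)
  have dec : ∀ a b c : ZMod 2 × ZMod 2, a ≠ 0 → b ≠ 0 → a + b ≠ 0 → c ≠ 0 →
      a = c ∨ b = c ∨ a + b = c := by decide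
  have all : ∀ z : V → ZMod 2, (∀ w, w ≠ u → w ≠ v → z w = 0) → (z u, z v) ≠ 0 →
      stabSupport (G.adjMatrix (ZMod 2)) z = ω := by
    intro z hz hz0
    rcases dec _ _ _ (nzp x hx) (nzp y hy) (nzp _ hxy) hz0 with h | h | h
    · rw [← ext x z (offv x hx) hz h, hx]
    · rw [← ext y z (offv y hy) hz h, hy]
    · rw [← ext (x + y) z (offv _ hxy) hz h, hxy]
  have edge : ∀ a b, a ≠ b → (∀ w, w ≠ a → w ≠ b → w ∉ ω) → b ∈ ω →
      stabSupport (G.adjMatrix (ZMod 2)) (Pi.single a 1) = ω → ∀ w, G.Adj a w ↔ w = b := by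
    intro a b hab hout hb hs w
    have hw : w ∈ stabSupport (G.adjMatrix (ZMod 2)) (Pi.single a 1) ↔ w = a ∨ G.Adj w a := by
      rw [mem_stabSupport]
      simp [Pi.single_apply]
    rw [hs] at hw
    constructor
    · intro h
      by_contra hne
      exact hout w h.ne' hne (hw.2 (Or.inr h.symm))
    · rintro rfl
      exact ((hw.1 hb).resolve_left hab.symm).symm
  constructor
  · refine edge u v hvu.symm (fun w h1 h2 => by rw [hv]; simp [h1, h2]) (by rw [hv]; simp)
      (all _ (fun w h1 _ => by simp [h1]) (by simp [hvu]))
  · refine edge v u hvu (fun w h1 h2 => by rw [hv]; simp [h1, h2]) (by rw [hv]; simp)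
      (all _ (fun w _ h1 => by simp [h1]) (by simp [hvu.symm]))

/-- Tensor products of unitary matrices that map a graph state to a state with the Pauli dichotomy
respect a Pauli axis at each qubit, with an exception for isolated edges. -/
theorem exists_mapsPauli {G : SimpleGraph V} {U : V → Matrix (Fin 2) (Fin 2) ℂ}
    (hU : ∀ u, (U u)ᴴ * U u = 1) (hQ : HasPauliDichotomy (tensorOp U *ᵥ graphState G)) (u : V)
    (hiso : ∀ v, IsIsolatedEdge G u v → U v = 1) :
    ∃ c d, c ≠ 0 ∧ MapsPauli (U u) c d := by
  classical
  have hU' : ∀ u, U u * (U u)ᴴ = 1 := fun u => mul_eq_one_comm.1 (hU u)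
  have hψ := isUnitVector_graphState G
  have hφ : IsUnitVector (tensorOp U *ᵥ graphState G) := hψ.mulVec (tensorOp_unitary hU)
  set M := G.adjMatrix (ZMod 2) with hM
  obtain ⟨ω, huω, hcase⟩ := exists_stabSupport (M := M) (G.isSymm_adjMatrix) u
  obtain ⟨x₀, hx₀⟩ : ∃ x, stabSupport M x = ω := by
    rcases hcase with h | ⟨x, -, h, -⟩
    exacts [h.1, ⟨x, h⟩]
  -- a Pauli string with support `ω` and nonzero expectation
  obtain ⟨p, hpω, hp⟩ : ∃ p : V → ZMod 2 × ZMod 2, (∀ w, w ∈ ω ↔ p w ≠ 0) ∧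
      expect (tensorOp U *ᵥ graphState G) (fun u => pauli (p u)) ≠ 0 := by
    have h1 : expect (graphState G) (fun w => pauli (x₀ w, (M *ᵥ x₀) w)) ≠ 0 := by
      intro h
      have := norm_expect_graphState (G := G) (q := fun w => (x₀ w, (M *ᵥ x₀) w)) (fun _ => rfl)
      rw [h, norm_zero] at this
      exact zero_ne_one this
    have h2 : graphState G = tensorOp (fun u => (U u)ᴴ) *ᵥ (tensorOp U *ᵥ graphState G) := by
      rw [Matrix.mulVec_mulVec, tensorOp_mul]
      simp only [hU, tensorOp_one, Matrix.one_mulVec]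
    rw [h2, expect_mulVec, expect_eq_sum] at h1
    obtain ⟨p, -, hp⟩ := Finset.exists_ne_zero_of_sum_ne_zero h1
    refine ⟨p, fun w => ?_, right_ne_zero_of_mul hp⟩
    have := pauliCoeff_conj_eq_zero (U := (U w)ᴴ)
      (by rw [conjTranspose_conjTranspose, hU']) (Finset.prod_ne_zero_iff.1
        (left_ne_zero_of_mul hp) w (Finset.mem_univ w))
    rw [ne_eq, ← this, ← hx₀, mem_stabSupport, Prod.ext_iff, not_and_or]
    rfl
  have hnorm := hQ.norm_expect hφ hp
  rw [expect_mulVec] at hnorm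
  set N : V → Matrix (Fin 2) (Fin 2) ℂ := fun w => (U w)ᴴ * pauli (p w) * U w with hN
  have hNU : ∀ w, (N w)ᴴ * N w = 1 := by
    intro w
    have : (N w)ᴴ * N w = (U w)ᴴ * (pauli (p w) * (U w * (U w)ᴴ) * pauli (p w)) * U w := by
      simp only [hN, Matrix.conjTranspose_mul, conjTranspose_conjTranspose, pauli_conjTranspose]
      noncomm_ring
    rw [this, hU', mul_one, pauli_mul_self, mul_one, hU]
  have hterm : ∀ q : V → ZMod 2 × ZMod 2, (∏ w, pauliCoeff (N w) (q w)) *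
      expect (graphState G) (fun u => pauli (q u)) ≠ 0 →
      ∃ x, (q = fun w => (x w, (M *ᵥ x) w)) ∧ stabSupport M x = ω := by
    intro q hq
    obtain ⟨x, hx, hxs⟩ := mem_stabSupport_iff_of_expect_ne_zero (right_ne_zero_of_mul hq)
    refine ⟨x, hx, Finset.ext fun w => ?_⟩
    have := pauliCoeff_conj_eq_zero (hU w) (Finset.prod_ne_zero_iff.1
      (left_ne_zero_of_mul hq) w (Finset.mem_univ w))
    rw [hpω, hxs, ne_eq, ne_eq, this]
  have nonzero : ∀ x, stabSupport M x = ω → ∀ w ∈ ω, (x w, (M *ᵥ x) w) ≠ 0 := by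
    intro x hx w hw h
    rw [← hx, mem_stabSupport] at hw
    rw [Prod.ext_iff] at h
    exact hw.elim (· h.1) (· h.2)
  rcases hcase with ⟨-, hsame⟩ | ⟨x, y, hx, hy, hxy, hall⟩
  · set a := (x₀ u, (M *ᵥ x₀) u) with ha
    refine ⟨a, p u, nonzero x₀ hx₀ u huω, mapsPauli_of_norm_pauliCoeff (hU u) ?_⟩
    change 1 ≤ ‖pauliCoeff (N u) a‖
    -- All contributing stabilizers have the entry `a` at `u`, so `N u` may be replaced by its
    -- component along `pauli a`. The remaining expectation is at most one in absolute value, so the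
    -- coefficient is at least one.
    have e : expect (graphState G) N = pauliCoeff (N u) a *
        expect (graphState G) fun w => if w = u then pauli a else N w := by
      have e1 : pauliCoeff (N u) a * (expect (graphState G) fun w => if w = u then pauli a else N w)
          = expect (graphState G) fun w => (if w = u then pauliCoeff (N u) a else 1) •
            if w = u then pauli a else N w := by
        rw [expect, expect, tensorOp_smul, Matrix.smul_mulVec, dotProduct_smul, smul_eq_mul,
          Finset.prod_ite_eq' Finset.univ u, if_pos (Finset.mem_univ u)]
      rw [e1, expect_eq_sum, expect_eq_sum]
      refine Finset.sum_congr rfl fun q _ => ?_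
      by_cases hq : expect (graphState G) (fun u => pauli (q u)) = 0
      · rw [hq, mul_zero, mul_zero]
      congr 1
      by_cases hqa : q u = a
      · refine Finset.prod_congr rfl fun w _ => ?_
        by_cases hw : w = u
        · subst hw
          have : pauliCoeff (pauliCoeff (N w) a • pauli a) a = pauliCoeff (N w) a := by
            have h := pauliCoeff_pauli a a
            rw [if_pos rfl] at h
            unfold pauliCoeff at h ⊢
            rw [Matrix.mul_smul, Matrix.trace_smul, smul_eq_mul, mul_div_assoc, h, mul_one]
          simp only [if_true, hqa, this]
        · simp [hw]
      · have h0 : pauliCoeff (pauliCoeff (N u) a • pauli a) (q u) = 0 := by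
          have h := pauliCoeff_pauli a (q u)
          rw [if_neg (Ne.symm hqa)] at h
          unfold pauliCoeff at h ⊢
          rw [Matrix.mul_smul, Matrix.trace_smul, smul_eq_mul, mul_div_assoc, h, mul_zero]
        have h1 : ∏ w, pauliCoeff ((if w = u then pauliCoeff (N u) a else 1) •
            if w = u then pauli a else N w) (q w) = 0 :=
          Finset.prod_eq_zero (Finset.mem_univ u) (by simpa using h0)
        rw [h1]
        by_contra hne
        obtain ⟨x, rfl, hx⟩ := hterm q (mul_ne_zero hne hq)
        have := hsame x x₀ hx hx₀
        exact hqa (Prod.ext this.1 this.2)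
    have hle : ‖expect (graphState G) fun w => if w = u then pauli a else N w‖ ≤ 1 := by
      refine norm_expect_le_one hψ fun w => ?_
      by_cases hw : w = u
      · simp only [hw, if_true, pauli_conjTranspose, pauli_mul_self]
      · simp only [hw, if_false, hNU]
    change ‖expect (graphState G) N‖ = 1 at hnorm
    rw [e, norm_mul] at hnorm
    nlinarith [norm_nonneg (pauliCoeff (N u) a)]
  · let typ : (V → ZMod 2) → V → ZMod 2 × ZMod 2 := fun x w => (x w, (M *ᵥ x) w)
    have typ_add : ∀ x y w, typ (x + y) w = typ x w + typ y w := by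
      intro x y w
      simp only [typ, mulVec_add, Pi.add_apply, Prod.mk_add_mk]
    let T : Finset (V → ZMod 2) := {x, y, x + y}
    have hT : ∀ z ∈ T, stabSupport M z = ω := by
      intro z hz
      simp only [T, Finset.mem_insert, Finset.mem_singleton] at hz
      rcases hz with rfl | rfl | rfl <;> assumption
    have hTinj : ∀ w ∈ ω, ∀ z ∈ T, ∀ z' ∈ T, typ z w = typ z' w → z = z' := by
      intro w hw
      have n1 := nonzero x hx w hw
      have n2 := nonzero y hy w hw
      have n3 := nonzero _ hxy w hw
      change typ (x + y) w ≠ 0 at n3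
      change typ x w ≠ 0 at n1
      change typ y w ≠ 0 at n2
      rw [typ_add] at n3
      have dec : ∀ a b : ZMod 2 × ZMod 2, a ≠ 0 → b ≠ 0 → a + b ≠ 0 →
          a ≠ b ∧ a ≠ a + b ∧ b ≠ a + b := by decide
      obtain ⟨d1, d2, d3⟩ := dec _ _ n1 n2 n3
      intro z hz z' hz' e
      simp only [T, Finset.mem_insert, Finset.mem_singleton] at hz hz'
      rcases hz with rfl | rfl | rfl <;> rcases hz' with rfl | rfl | rfl <;>
        first
        | rfl
        | (try simp only [typ_add] at e
           first
           | exact absurd e d1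
           | exact absurd e d2
           | exact absurd e d3
           | exact absurd e.symm d1
           | exact absurd e.symm d2
           | exact absurd e.symm d3)
    have hle : ∀ w c, ‖pauliCoeff (N w) c‖ ≤ 1 := by
      intro w c
      have h1 := sum_sq_pauliCoeff (hNU w)
      have h2 := Finset.single_le_sum (f := fun c => ‖pauliCoeff (N w) c‖ ^ 2)
        (fun _ _ => by positivity) (Finset.mem_univ c)
      rw [h1] at h2
      exact (sq_le_one_iff₀ (norm_nonneg _)).1 h2
    have hsq : ∀ w ∈ ω, ∑ z ∈ T, ‖pauliCoeff (N w) (typ z w)‖ ^ 2 ≤ 1 := by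
      intro w hw
      rw [← sum_sq_pauliCoeff (hNU w), ← Finset.sum_image (s := T) (g := fun z => typ z w)
        (f := fun c => ‖pauliCoeff (N w) c‖ ^ 2)
        (fun z hz z' hz' e => hTinj w hw z hz z' hz' e)]
      exact Finset.sum_le_sum_of_subset_of_nonneg (Finset.subset_univ _)
        fun _ _ _ => by positivity
    -- The expectation has absolute value one and at most three terms.
    have hbound : 1 ≤ ∑ z ∈ T, ∏ w, ‖pauliCoeff (N w) (typ z w)‖ := by
      rw [← hnorm]
      rw [expect_eq_sum, ← Finset.sum_subset (Finset.subset_univ (T.image typ))]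
      · rw [Finset.sum_image fun z hz z' hz' e =>
          hTinj u huω z hz z' hz' (congrFun e u)]
        refine (norm_sum_le _ _).trans (Finset.sum_le_sum fun z _ => ?_)
        rw [norm_mul, norm_prod, norm_expect_graphState (fun _ => rfl), mul_one]
      · intro q _ hq
        by_contra hne
        obtain ⟨z, rfl, hz⟩ := hterm q hne
        refine hq (Finset.mem_image.2 ⟨z, ?_, rfl⟩)
        simp only [T, Finset.mem_insert, Finset.mem_singleton]
        exact hall z hz
    suffices ∃ z ∈ T, 1 ≤ ‖pauliCoeff (N u) (typ z u)‖ by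
      obtain ⟨z, hz, h⟩ := this
      exact ⟨typ z u, p u, nonzero z (hT z hz) u huω, mapsPauli_of_norm_pauliCoeff (hU u) h⟩
    obtain ⟨v, w, hv, hw, hvw⟩ : ∃ v w, v ∈ ω ∧ w ∈ ω ∧ ∀ z ∈ T,
        ∏ w, ‖pauliCoeff (N w) (typ z w)‖ ≤ ‖pauliCoeff (N u) (typ z u)‖ *
          (‖pauliCoeff (N v) (typ z v)‖ * ‖pauliCoeff (N w) (typ z w)‖) := by
      -- With two further qubits `v`, `w` in `ω`, their coefficients form vectors of norm at most
      -- one, and `exists_one_le_of_one_le_sum` applies. On an isolated edge `U v = 1` makes the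
      -- coefficients at `v` equal to zero or one, hence idempotent, so `v` can serve twice.
      by_cases hcard : ω.card ≤ 2
      · obtain ⟨v, hvu, hωv, hedge⟩ := exists_isIsolatedEdge hcard huω hx hy hxy
        refine ⟨v, v, by rw [hωv]; simp, by rw [hωv]; simp, fun z _ => ?_⟩
        have hUv := hiso v hedge
        have hv2 : ‖pauliCoeff (N v) (typ z v)‖ * ‖pauliCoeff (N v) (typ z v)‖ =
            ‖pauliCoeff (N v) (typ z v)‖ := by
          simp only [hN, hUv, conjTranspose_one, one_mul, mul_one, pauliCoeff_pauli]
          split_ifs <;> simp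
        rw [hv2, ← Finset.mul_prod_erase _ _ (Finset.mem_univ u),
          ← Finset.mul_prod_erase _ _ (Finset.mem_erase.2 ⟨hvu, Finset.mem_univ v⟩), ← mul_assoc]
        refine mul_le_of_le_one_right (by positivity)
          (Finset.prod_le_one (fun _ _ => norm_nonneg _) fun _ _ => hle _ _)
      · have h1 : 1 < (ω.erase u).card := by rw [Finset.card_erase_of_mem huω]; omega
        obtain ⟨v, hv, w, hw, hvw⟩ := Finset.one_lt_card.1 h1
        rw [Finset.mem_erase] at hv hw
        refine ⟨v, w, hv.2, hw.2, fun z _ => ?_⟩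
        rw [← Finset.mul_prod_erase _ _ (Finset.mem_univ u),
          ← Finset.mul_prod_erase _ _ (Finset.mem_erase.2 ⟨hv.1, Finset.mem_univ v⟩),
          ← Finset.mul_prod_erase _ _ (Finset.mem_erase.2 ⟨hvw.symm, Finset.mem_erase.2
            ⟨hw.1, Finset.mem_univ w⟩⟩), ← mul_assoc, ← mul_assoc, ← mul_assoc]
        refine mul_le_of_le_one_right (by positivity)
          (Finset.prod_le_one (fun _ _ => norm_nonneg _) fun _ _ => hle _ _)
    exact exists_one_le_of_one_le_sum T (fun z => norm_nonneg _) (fun z => norm_nonneg _)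
      (hsq v hv) (hsq w hw) (hbound.trans (Finset.sum_le_sum hvw))

end ExistsAxis

end CircleGraphStates

/-! ### Single-qubit Clifford operators. -/

namespace CircleGraphStates
open Function Matrix

section Cliffords

/-- `U` is unitary, and conjugation by `U` and by its inverse permutes the Pauli matrices up to
signs. -/
structure IsClifford (U : Matrix (Fin 2) (Fin 2) ℂ) : Prop where
  unitary : Uᴴ * U = 1
  maps : ∀ c, ∃ d, MapsPauli U c d
  maps_symm : ∀ c, ∃ d, MapsPauli Uᴴ c d

theorem MapsPauli.mul {U W : Matrix (Fin 2) (Fin 2) ℂ} {c d e : ZMod 2 × ZMod 2}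
    (h : MapsPauli W c d) (h' : MapsPauli U d e) : MapsPauli (U * W) c e := by
  have key : U * W * pauli c * (U * W)ᴴ = U * (W * pauli c * Wᴴ) * Uᴴ := by
    rw [conjTranspose_mul]; noncomm_ring
  unfold MapsPauli
  rw [key]
  rcases h with h | h <;> rcases h' with h' | h' <;> rw [h]
  · exact Or.inl h'
  · exact Or.inr h'
  · right; rw [← h']; noncomm_ring
  · left; rw [← neg_eq_iff_eq_neg.2 h']; noncomm_ring

theorem IsClifford.mul {U W : Matrix (Fin 2) (Fin 2) ℂ} (hU : IsClifford U)
    (hW : IsClifford W) : IsClifford (U * W) := by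
  refine ⟨?_, fun c => ?_, fun c => ?_⟩
  · rw [conjTranspose_mul, Matrix.mul_assoc, ← Matrix.mul_assoc Uᴴ, hU.unitary, Matrix.one_mul,
      hW.unitary]
  · obtain ⟨d, hd⟩ := hW.maps c
    obtain ⟨e, he⟩ := hU.maps d
    exact ⟨e, hd.mul he⟩
  · obtain ⟨d, hd⟩ := hU.maps_symm c
    obtain ⟨e, he⟩ := hW.maps_symm d
    exact ⟨e, by rw [conjTranspose_mul]; exact hd.mul he⟩

theorem IsClifford.unitary' {U : Matrix (Fin 2) (Fin 2) ℂ} (hU : IsClifford U) : U * Uᴴ = 1 :=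
  mul_eq_one_comm.1 hU.unitary

theorem IsClifford.conjTranspose {U : Matrix (Fin 2) (Fin 2) ℂ} (hU : IsClifford U) :
    IsClifford Uᴴ :=
  ⟨by rw [conjTranspose_conjTranspose, hU.unitary'], hU.maps_symm,
    by rw [conjTranspose_conjTranspose]; exact hU.maps⟩

theorem isClifford_pauli (d : ZMod 2 × ZMod 2) : IsClifford (pauli d) := by
  have key : ∀ c, MapsPauli (pauli d) c c := by
    intro c
    unfold MapsPauli
    rw [pauli_conjTranspose, pauli_mul_comm, Matrix.smul_mul, Matrix.mul_assoc, pauli_mul_self,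
      Matrix.mul_one]
    rcases zmod_two_cases (d.1 * c.2 + d.2 * c.1) with h | h <;> rw [h] <;> simp
  exact ⟨by rw [pauli_conjTranspose, pauli_mul_self], fun c => ⟨c, key c⟩,
    fun c => ⟨c, by rw [pauli_conjTranspose]; exact key c⟩⟩

theorem isClifford_one : IsClifford 1 := by
  have := isClifford_pauli (0, 0)
  rwa [pauli_zero] at this

theorem IsClifford.mem_cliffordGroup {U : Matrix (Fin 2) (Fin 2) ℂ} (hU : IsClifford U) :
    U ∈ cliffordGroup := by
  have maps : ∀ {W : Matrix (Fin 2) (Fin 2) ℂ}, (∀ c, ∃ d, MapsPauli W c d) →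
      ∀ P ∈ pauliGroup, W * P * Wᴴ ∈ pauliGroup := by
    rintro W hW P ⟨z, hz, Q, hQ, rfl⟩
    obtain ⟨c, rfl⟩ := mem_paulis_iff.1 hQ
    obtain ⟨d, hd⟩ := hW c
    have e : W * (z • pauli c) * Wᴴ = z • (W * pauli c * Wᴴ) := by simp
    rw [e]
    rcases hd with hd | hd <;> rw [hd]
    · exact ⟨z, hz, _, mem_paulis_iff.2 ⟨d, rfl⟩, rfl⟩
    · refine ⟨-z, ?_, _, mem_paulis_iff.2 ⟨d, rfl⟩, by simp⟩
      rcases hz with rfl | rfl | rfl | rfl <;> simp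
  refine ⟨?_, Set.Subset.antisymm ?_ fun P hP => ?_⟩
  · rw [Matrix.mem_unitaryGroup_iff]
    exact hU.unitary'
  · rintro _ ⟨P, hP, rfl⟩
    exact maps hU.maps P hP
  · refine ⟨Uᴴ * P * Uᴴᴴ, maps hU.maps_symm P hP, ?_⟩
    have e : U * (Uᴴ * P * Uᴴᴴ) * Uᴴ = (U * Uᴴ) * P * (U * Uᴴ) := by
      rw [conjTranspose_conjTranspose]; noncomm_ring
    dsimp only
    rw [e, hU.unitary', one_mul, mul_one]

theorem isClifford_of_maps {U : Matrix (Fin 2) (Fin 2) ℂ} (hU : Uᴴ * U = 1)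
    {f : ZMod 2 × ZMod 2 → ZMod 2 × ZMod 2} (hf : Surjective f) (h : ∀ c, MapsPauli U c (f c)) :
    IsClifford U := by
  refine ⟨hU, fun c => ⟨_, h c⟩, fun c => ?_⟩
  obtain ⟨d, rfl⟩ := hf c
  exact ⟨d, (h d).symm hU⟩

/-- The Hadamard matrix. -/
noncomputable def hadamard : Matrix (Fin 2) (Fin 2) ℂ :=
  ((√2 : ℝ) : ℂ)⁻¹ • !![1, 1; 1, -1]

theorem hadamard_conjTranspose : hadamardᴴ = hadamard := by
  rw [hadamard, conjTranspose_smul, conjTranspose_of]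
  simp

theorem hadamard_mul_mul (A : Matrix (Fin 2) (Fin 2) ℂ) :
    hadamard * A * hadamard = (1 / 2 : ℂ) • (!![1, 1; 1, -1] * A * !![1, 1; 1, -1]) := by
  have : ((√2 : ℝ) : ℂ)⁻¹ * ((√2 : ℝ) : ℂ)⁻¹ = 1 / 2 := by
    rw [← mul_inv, ← Complex.ofReal_mul, Real.mul_self_sqrt (by norm_num)]
    norm_num
  rw [hadamard, Matrix.smul_mul, Matrix.smul_mul, Matrix.mul_smul, smul_smul, this]

theorem hadamard_mul_self : hadamard * hadamard = 1 := by
  have := hadamard_mul_mul 1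
  rw [Matrix.mul_one, Matrix.mul_one] at this
  rw [this]
  ext i j
  fin_cases i <;> fin_cases j <;> simp <;> norm_num

theorem hadamard_conj (c : ZMod 2 × ZMod 2) :
    MapsPauli hadamard c (c.2, c.1) := by
  unfold MapsPauli
  rw [hadamard_conjTranspose, hadamard_mul_mul]
  revert c
  apply pauli_cases
  · left; ext i j; fin_cases i <;> fin_cases j <;> simp <;> norm_num
  · left; ext i j; fin_cases i <;> fin_cases j <;> simp <;> norm_num
  · left; ext i j; fin_cases i <;> fin_cases j <;> simp <;> norm_num
  · right; ext i j; fin_cases i <;> fin_cases j <;> simp <;> ring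

theorem isClifford_hadamard : IsClifford hadamard :=
  isClifford_of_maps (by rw [hadamard_conjTranspose, hadamard_mul_self])
    (f := fun c => (c.2, c.1)) (fun c => ⟨(c.2, c.1), rfl⟩) hadamard_conj

/-- The diagonal matrix with entries `1` and `z`. -/
def phaseMatrix (z : ℂ) : Matrix (Fin 2) (Fin 2) ℂ := !![1, 0; 0, z]

theorem phaseMatrix_unitary {z : ℂ} (hz : ‖z‖ = 1) :
    (phaseMatrix z)ᴴ * phaseMatrix z = 1 := by
  have : (starRingEnd ℂ) z * z = 1 := by rw [Complex.conj_mul', hz]; simp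
  rw [phaseMatrix, conjTranspose_of, one_eq_of]
  simp [this]

theorem phaseMatrix_mapsPauli {z : ℂ} (hz : z = Complex.I ∨ z = -Complex.I)
    (c : ZMod 2 × ZMod 2) : MapsPauli (phaseMatrix z) c (c.1, c.1 + c.2) := by
  have hI := Complex.I_mul_I
  have h11 : (1 : ZMod 2) + 1 = 0 := by decide
  revert c
  rcases hz with rfl | rfl
  · apply pauli_cases <;> unfold MapsPauli <;> rw [phaseMatrix, conjTranspose_of]
    · left; simp [one_eq_of]
    · left; simp
    · left; simp
    · right; simp [h11]
  · apply pauli_cases <;> unfold MapsPauli <;> rw [phaseMatrix, conjTranspose_of]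
    · left; simp [one_eq_of]
    · left; simp
    · right; simp
    · left; simp [h11]

theorem isClifford_phaseMatrix {z : ℂ} (hz : z = 1 ∨ z = -1 ∨ z = Complex.I ∨ z = -Complex.I) :
    IsClifford (phaseMatrix z) := by
  have h : z = Complex.I ∨ z = -Complex.I → IsClifford (phaseMatrix z) := fun hz =>
    isClifford_of_maps (phaseMatrix_unitary (by rcases hz with rfl | rfl <;> simp))
      (f := fun c => (c.1, c.1 + c.2)) (by decide) (phaseMatrix_mapsPauli hz)
  rcases hz with rfl | rfl | hz
  · have : phaseMatrix 1 = 1 := by rw [phaseMatrix, one_eq_of]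
    rw [this]
    exact isClifford_one
  · have : phaseMatrix (-1) = pauli (0, 1) := by rw [phaseMatrix, pauli_z]
    rw [this]
    exact isClifford_pauli _
  · exact h hz

end Cliffords

/-! ### Isolated edges and axes at all qubits. -/

section SingleQubit

set_option linter.unusedSectionVars false

variable {V : Type*} [Fintype V] [DecidableEq V]

/-- The operator `A` at the qubit `v`. -/
def singleOp (v : V) (A : Matrix (Fin 2) (Fin 2) ℂ) : V → Matrix (Fin 2) (Fin 2) ℂ :=
  fun w => if w = v then A else 1

theorem tensorOp_singleOp_add (v : V) (A B : Matrix (Fin 2) (Fin 2) ℂ) :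
    tensorOp (singleOp v (A + B)) = tensorOp (singleOp v A) + tensorOp (singleOp v B) := by
  ext x y
  simp only [tensorOp, Matrix.of_apply, Matrix.add_apply, singleOp]
  rw [← Finset.mul_prod_erase _ _ (Finset.mem_univ v), ← Finset.mul_prod_erase _ _
    (Finset.mem_univ v), ← Finset.mul_prod_erase _ _ (Finset.mem_univ v), if_pos rfl, if_pos rfl,
    if_pos rfl, Matrix.add_apply, add_mul]
  congr 2 <;> refine Finset.prod_congr rfl fun w hw => ?_ <;>
    rw [if_neg (Finset.ne_of_mem_erase hw), if_neg (Finset.ne_of_mem_erase hw)]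

theorem tensorOp_singleOp_mulVec (v : V) (A : Matrix (Fin 2) (Fin 2) ℂ) (ψ : (V → Fin 2) → ℂ)
    (x : V → Fin 2) : (tensorOp (singleOp v A) *ᵥ ψ) x =
      A (x v) (x v) * ψ x + A (x v) (x v + 1) * ψ (flipAt x v) := by
  have e : A = Matrix.of (fun i j => if j = i then A i i else 0) +
      Matrix.of (fun i j => if j = i + 1 then A i (i + 1) else 0) := by
    have : (1 : Fin 2) + 1 = 0 := by decide
    ext i j
    fin_cases i <;> fin_cases j <;> simp [this]
  conv_lhs => rw [e, tensorOp_singleOp_add, Matrix.add_mulVec]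
  rw [Pi.add_apply, tensorOp_mulVec_of_monomial (f := fun _ i => i)
    (d := fun w i => if w = v then A i i else 1), tensorOp_mulVec_of_monomial
    (f := fun w i => if w = v then i + 1 else i)
    (d := fun w i => if w = v then A i (i + 1) else 1)]
  · congr 1
    · rw [Finset.prod_ite_eq' Finset.univ v, if_pos (Finset.mem_univ v)]
    · rw [Finset.prod_ite_eq' Finset.univ v, if_pos (Finset.mem_univ v)]
      congr 2
      funext w
      by_cases hw : w = v
      · subst hw; simp
      · simp [hw, flipAt_of_ne]
  · intro w i j
    by_cases hw : w = v
    · simp [singleOp, hw]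
    · simp [singleOp, hw, Matrix.one_apply, eq_comm]
  · intro w i j
    by_cases hw : w = v
    · simp [singleOp, hw]
    · simp [singleOp, hw, Matrix.one_apply, eq_comm]

theorem nbrSign_of_isIsolatedEdge {G : SimpleGraph V} {u v : V} (h : ∀ w, G.Adj v w ↔ w = u)
    (x : V → Fin 2) : nbrSign G x v = sgn (x u) := by
  classical
  rw [nbrSign]
  simp only [h]
  rw [Finset.filter_eq' Finset.univ u, if_pos (Finset.mem_univ u), Finset.prod_singleton]

/-- An operator at one end of an isolated edge acts as an operator at the other end. -/
theorem tensorOp_singleOp_of_isIsolatedEdge {G : SimpleGraph V} {u v : V}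
    (h : IsIsolatedEdge G u v) (A : Matrix (Fin 2) (Fin 2) ℂ) :
    tensorOp (singleOp v A) *ᵥ graphState G =
      tensorOp (singleOp u (hadamard * Aᵀ * hadamard)) *ᵥ graphState G := by
  funext x
  have h11 : (1 : Fin 2) + 1 = 0 := by decide
  rw [tensorOp_singleOp_mulVec, tensorOp_singleOp_mulVec, graphState_flipAt, graphState_flipAt,
    nbrSign_of_isIsolatedEdge h.1, nbrSign_of_isIsolatedEdge h.2, hadamard_mul_mul]
  obtain ⟨a, b, c, d, rfl⟩ : ∃ a b c d, A = !![a, b; c, d] := ⟨_, _, _, _, Matrix.eta_fin_two A⟩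
  have e : (1 / 2 : ℂ) • (!![1, 1; 1, -1] * !![a, b; c, d]ᵀ * !![1, 1; 1, -1]) =
      !![(a + b + c + d) / 2, (a + b - c - d) / 2; (a - b + c - d) / 2, (a - b - c + d) / 2] := by
    have : !![a, b; c, d]ᵀ = !![a, c; b, d] := by
      ext i j; fin_cases i <;> fin_cases j <;> rfl
    rw [this]
    ext i j
    fin_cases i <;> fin_cases j <;> simp <;> ring
  rw [e]
  rcases fin_two_cases (x u) with hu | hu <;> rcases fin_two_cases (x v) with hv | hv <;>
    simp [hu, hv, h11] <;> ring

theorem transpose_unitary {A : Matrix (Fin 2) (Fin 2) ℂ} (hA : Aᴴ * A = 1) : Aᵀᴴ * Aᵀ = 1 := by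
  have h : (A * Aᴴ)ᵀ = Aᵀᴴ * Aᵀ := by
    rw [Matrix.transpose_mul]
    rfl
  rw [← h, mul_eq_one_comm.1 hA, transpose_one]

/-- Every tensor product of unitaries that maps a graph state to a state with the Pauli dichotomy
can be replaced by one that respects a Pauli axis at every qubit. -/
theorem exists_all_mapsPauli {G : SimpleGraph V} {φ : (V → Fin 2) → ℂ}
    (hφ : HasPauliDichotomy φ) {U : V → Matrix (Fin 2) (Fin 2) ℂ} (hU : ∀ u, (U u)ᴴ * U u = 1)
    (h : φ = tensorOp U *ᵥ graphState G) :
    ∃ U : V → Matrix (Fin 2) (Fin 2) ℂ, (∀ u, (U u)ᴴ * U u = 1) ∧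
      (∀ u, ∃ c d, c ≠ 0 ∧ MapsPauli (U u) c d) ∧ φ = tensorOp U *ᵥ graphState G := by
  classical
  induction hk : (Finset.univ.filter fun u => ¬ ∃ c d, c ≠ 0 ∧ MapsPauli (U u) c d).card
    using Nat.strong_induction_on generalizing U with
  | _ k ih =>
  by_cases hall : ∀ u, ∃ c d, c ≠ 0 ∧ MapsPauli (U u) c d
  · exact ⟨U, hU, hall, h⟩
  push Not at hall
  obtain ⟨u, hu⟩ := hall
  have hno : ¬ ∃ c d, c ≠ 0 ∧ MapsPauli (U u) c d := by
    push Not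
    exact hu
  have hv : ∃ v, IsIsolatedEdge G u v := by
    by_contra hv
    exact hno (exists_mapsPauli hU (h ▸ hφ) u fun v hv' => absurd ⟨v, hv'⟩ hv)
  obtain ⟨v, hv⟩ := hv
  have huv : u ≠ v := ((hv.1 v).2 rfl).ne
  -- The operator at `v` is moved to the other end `u`. Now `v` carries the identity, and
  -- `exists_mapsPauli` applies at `u`, so the number of qubits without an axis drops.
  let U' : V → Matrix (Fin 2) (Fin 2) ℂ := fun w =>
    if w = v then 1 else if w = u then U u * (hadamard * (U v)ᵀ * hadamard) else U w
  have hU' : ∀ w, (U' w)ᴴ * U' w = 1 := by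
    intro w
    simp only [U']
    split_ifs with h1 h2
    · simp
    · have e : (U u * (hadamard * (U v)ᵀ * hadamard))ᴴ * (U u * (hadamard * (U v)ᵀ * hadamard)) =
          hadamardᴴ * ((U v)ᵀᴴ * (hadamardᴴ * ((U u)ᴴ * U u) * hadamard) * (U v)ᵀ) * hadamard := by
        simp only [conjTranspose_mul]; noncomm_ring
      rw [e, hU, hadamard_conjTranspose, mul_one, hadamard_mul_self, mul_one,
        transpose_unitary (hU v), mul_one, hadamard_mul_self]
    · exact hU w
  have hφ' : φ = tensorOp U' *ᵥ graphState G := by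
    have e1 : tensorOp U = tensorOp (fun w => if w = v then 1 else U w) *
        tensorOp (singleOp v (U v)) := by
      rw [tensorOp_mul]
      congr 1
      funext w
      by_cases hw : w = v
      · simp [hw, singleOp]
      · simp [hw, singleOp]
    rw [h, e1, ← Matrix.mulVec_mulVec, tensorOp_singleOp_of_isIsolatedEdge hv,
      Matrix.mulVec_mulVec, tensorOp_mul]
    congr 2
    funext w
    by_cases hw : w = v
    · subst hw
      simp [U', singleOp, huv.symm]
    · by_cases hw' : w = u
      · subst hw'
        simp [U', singleOp, huv]
      · simp [U', singleOp, hw, hw']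
  have hv' : ∃ c d, c ≠ 0 ∧ MapsPauli (U' v) c d :=
    ⟨(0, 1), (0, 1), by decide, Or.inl (by simp [U'])⟩
  have hu' : ∃ c d, c ≠ 0 ∧ MapsPauli (U' u) c d :=
    exists_mapsPauli hU' (hφ' ▸ hφ) u fun w hw => by
      obtain rfl : w = v := (hv.1 w).1 ((hw.1 w).2 rfl)
      simp [U']
  refine ih _ ?_ hU' hφ' rfl
  rw [← hk]
  refine Finset.card_lt_card ((Finset.ssubset_iff_of_subset ?_).2
    ⟨u, Finset.mem_filter.2 ⟨Finset.mem_univ u, hno⟩, fun h => (Finset.mem_filter.1 h).2 hu'⟩)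
  intro w hw
  rw [Finset.mem_filter] at hw ⊢
  refine ⟨Finset.mem_univ w, ?_⟩
  by_cases h1 : w = v
  · subst h1; exact absurd hv' hw.2
  by_cases h2 : w = u
  · subst h2; exact absurd hu' hw.2
  simpa [U', h1, h2] using hw.2

end SingleQubit

end CircleGraphStates

/-! ### Clifford equivalence and local complementation. -/

namespace CircleGraphStates
open Function Matrix

section CliffordEquivalence

set_option linter.unusedSectionVars false

variable {V : Type*} [Fintype V] [DecidableEq V]

/-- Equivalence up to single-qubit Clifford operators and a nonzero scalar. -/
def CliffordEquiv (ψ φ : (V → Fin 2) → ℂ) : Prop :=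
  ∃ z : ℂ, z ≠ 0 ∧ ∃ K : V → Matrix (Fin 2) (Fin 2) ℂ, (∀ u, IsClifford (K u)) ∧
    φ = z • (tensorOp K *ᵥ ψ)

theorem CliffordEquiv.refl (ψ : (V → Fin 2) → ℂ) : CliffordEquiv ψ ψ :=
  ⟨1, one_ne_zero, fun _ => 1, fun _ => isClifford_one, by
    rw [tensorOp_one, Matrix.one_mulVec, one_smul]⟩

theorem CliffordEquiv.symm {ψ φ : (V → Fin 2) → ℂ} (h : CliffordEquiv ψ φ) :
    CliffordEquiv φ ψ := by
  obtain ⟨z, hz, K, hK, rfl⟩ := h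
  refine ⟨z⁻¹, inv_ne_zero hz, fun u => (K u)ᴴ, fun u => (hK u).conjTranspose, ?_⟩
  rw [Matrix.mulVec_smul, smul_smul, inv_mul_cancel₀ hz, one_smul, Matrix.mulVec_mulVec,
    tensorOp_mul]
  simp only [fun u => (hK u).unitary, tensorOp_one, Matrix.one_mulVec]

theorem CliffordEquiv.trans {ψ φ χ : (V → Fin 2) → ℂ} (h : CliffordEquiv ψ φ)
    (h' : CliffordEquiv φ χ) : CliffordEquiv ψ χ := by
  obtain ⟨z, hz, K, hK, rfl⟩ := h
  obtain ⟨z', hz', K', hK', rfl⟩ := h'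
  refine ⟨z' * z, mul_ne_zero hz' hz, fun u => K' u * K u, fun u => (hK' u).mul (hK u), ?_⟩
  rw [Matrix.mulVec_smul, smul_smul, Matrix.mulVec_mulVec, tensorOp_mul]

/-- Conjugation by Clifford operators turns Pauli strings into Pauli strings up to a sign. -/
theorem HasPauliDichotomy.tensorOp {ψ : (V → Fin 2) → ℂ} (h : HasPauliDichotomy ψ)
    {K : V → Matrix (Fin 2) (Fin 2) ℂ} (hK : ∀ u, IsClifford (K u)) :
    HasPauliDichotomy (CircleGraphStates.tensorOp K *ᵥ ψ) := by
  intro q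
  have hq : ∀ u, ∃ (e : ℂ) (d : ZMod 2 × ZMod 2), (e = 1 ∨ e = -1) ∧
      pauli (q u) * K u = e • (K u * pauli d) := by
    intro u
    obtain ⟨d, hd⟩ := (hK u).maps_symm (q u)
    rw [MapsPauli, conjTranspose_conjTranspose] at hd
    have key : pauli (q u) * K u = K u * ((K u)ᴴ * pauli (q u) * K u) := by
      rw [← Matrix.mul_assoc, ← Matrix.mul_assoc, (hK u).unitary', Matrix.one_mul]
    rcases hd with hd | hd <;> rw [hd] at key
    · exact ⟨1, d, Or.inl rfl, by rw [key, one_smul]⟩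
    · exact ⟨-1, d, Or.inr rfl, by rw [key, neg_one_smul, Matrix.mul_neg]⟩
  choose e d he hd using hq
  have hprod : (∏ u, e u) = 1 ∨ (∏ u, e u) = -1 := by
    refine Finset.prod_induction e (fun c => c = 1 ∨ c = -1) ?_ (Or.inl rfl) fun u _ => he u
    rintro a b (rfl | rfl) (rfl | rfl) <;> simp
  have key : pauliString q * CircleGraphStates.tensorOp K =
      (∏ u, e u) • (CircleGraphStates.tensorOp K * pauliString d) := by
    simp only [pauliString, tensorOp_mul]
    rw [← tensorOp_smul]
    simp only [hd]
  have hun := tensorOp_unitary fun u => (hK u).unitary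
  have e1 : pauliString q *ᵥ (CircleGraphStates.tensorOp K *ᵥ ψ) =
      (∏ u, e u) • (CircleGraphStates.tensorOp K *ᵥ (pauliString d *ᵥ ψ)) := by
    rw [Matrix.mulVec_mulVec, key, Matrix.smul_mulVec, ← Matrix.mulVec_mulVec]
  have e2 : expect (CircleGraphStates.tensorOp K *ᵥ ψ) (fun u => pauli (q u)) =
      (∏ u, e u) * expect ψ fun u => pauli (d u) := by
    rw [expect_pauli, e1, star_mulVec_dotProduct, Matrix.mulVec_smul, Matrix.mulVec_mulVec, hun,
      Matrix.one_mulVec, dotProduct_smul, ← expect_pauli, smul_eq_mul]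
  rw [e1, e2]
  rcases h d with e' | e' | e'
  · rw [e']
    rcases hprod with h1 | h1 <;> rw [h1] <;> simp
  · rw [e', Matrix.mulVec_neg]
    rcases hprod with h1 | h1 <;> rw [h1] <;> simp
  · rw [e']
    simp

end CliffordEquivalence

section LocalComplement

set_option linter.unusedSectionVars false

variable {V : Type*} [Fintype V] [DecidableEq V]

theorem prod_flipAt (d : V → Fin 2 → ℂ) (x : V → Fin 2) (a : V) :
    d a (x a) * ∏ w, d w (flipAt x a w) = d a (x a + 1) * ∏ w, d w (x w) := by
  rw [← Finset.mul_prod_erase _ _ (Finset.mem_univ a), ← Finset.mul_prod_erase _ _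
    (Finset.mem_univ a), flipAt_same]
  have : ∏ w ∈ Finset.univ.erase a, d w (flipAt x a w) = ∏ w ∈ Finset.univ.erase a, d w (x w) :=
    Finset.prod_congr rfl fun w hw => by rw [flipAt_of_ne _ (Finset.ne_of_mem_erase hw)]
  rw [this]
  ring

open Classical in
/-- The Clifford operators which implement local complementation at `u`. -/
noncomputable def localComplementOp (G : SimpleGraph V) (u w : V) : Matrix (Fin 2) (Fin 2) ℂ :=
  if w = u then hadamard * phaseMatrix Complex.I * hadamard
  else if G.Adj u w then phaseMatrix (-Complex.I) else 1

open Classical in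
/-- The action of `localComplementOp` on the Pauli matrices. -/
noncomputable def localComplementMap (G : SimpleGraph V) (u w : V) (c : ZMod 2 × ZMod 2) :
    ZMod 2 × ZMod 2 :=
  if w = u then (c.2 + c.1, c.2) else if G.Adj u w then (c.1, c.1 + c.2) else c

theorem isClifford_localComplementOp (G : SimpleGraph V) (u w : V) :
    IsClifford (localComplementOp G u w) := by
  rw [localComplementOp]
  split_ifs
  · exact (isClifford_hadamard.mul (isClifford_phaseMatrix (by simp))).mul isClifford_hadamard
  · exact isClifford_phaseMatrix (by simp)
  · exact isClifford_one

theorem mapsPauli_localComplementOp (G : SimpleGraph V) (u w : V) (c : ZMod 2 × ZMod 2) :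
    MapsPauli (localComplementOp G u w) c (localComplementMap G u w c) := by
  rw [localComplementOp, localComplementMap]
  split_ifs
  · exact (hadamard_conj c).mul ((phaseMatrix_mapsPauli (Or.inl rfl) _).mul (hadamard_conj _))
  · exact phaseMatrix_mapsPauli (Or.inr rfl) _
  · exact Or.inl (by simp)

theorem hadamard_mul_diagonal_mul (a b : ℂ) : hadamard * !![a, 0; 0, b] * hadamard =
    !![(a + b) / 2, (a - b) / 2; (a - b) / 2, (a + b) / 2] := by
  rw [hadamard_mul_mul]
  ext i j
  fin_cases i <;> fin_cases j <;> simp <;> ring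

theorem nbrSign_localComplement_of_not_adj {G : SimpleGraph V} (x : V → Fin 2) {u a : V}
    (h : ¬ G.Adj u a) : nbrSign (localComplement G u) x a = nbrSign G x a := by
  classical
  rw [nbrSign, nbrSign]
  congr 1
  refine Finset.filter_congr fun b _ => ?_
  rw [localComplement_adj]
  by_cases hb : G.Adj a b
  · simp [h, hb, hb.ne]
  · simp [h, hb]

theorem nbrSign_localComplement_of_adj {G : SimpleGraph V} (x : V → Fin 2) {u a : V}
    (h : G.Adj u a) : nbrSign (localComplement G u) x a =
      nbrSign G x u * sgn (x a) * nbrSign G x a := by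
  classical
  have ha : a ∈ Finset.univ.filter (G.Adj u) := by simpa using h
  have e1 : nbrSign G x u * sgn (x a) = ∏ b, if G.Adj u b ∧ b ≠ a then sgn (x b) else 1 := by
    rw [nbrSign, ← Finset.mul_prod_erase _ _ ha, mul_right_comm, sgn_mul_self, one_mul,
      ← Finset.prod_filter]
    refine Finset.prod_congr ?_ fun _ _ => rfl
    ext b
    simp [and_comm]
  rw [e1, nbrSign, nbrSign, Finset.prod_filter, Finset.prod_filter, ← Finset.prod_mul_distrib]
  refine Finset.prod_congr rfl fun b _ => ?_
  have hs := sgn_mul_self (x b)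
  simp only [localComplement_adj, h, true_and]
  by_cases hba : b = a
  · subst hba
    simp
  · by_cases h1 : G.Adj a b <;> by_cases h2 : G.Adj u b <;> simp [h1, h2, hba, Ne.symm hba, hs]

/-- The image of the graph state obeys the flip rule of the complemented graph, and
`eq_smul_graphState` then identifies it up to a scalar. -/
theorem cliffordEquiv_localComplement (G : SimpleGraph V) (u : V) :
    ∃ z : ℂ, z ≠ 0 ∧ tensorOp (localComplementOp G u) *ᵥ graphState G =
      z • graphState (localComplement G u) := by
  classical
  let d : V → Fin 2 → ℂ := fun w i => if G.Adj u w then (if i = 0 then 1 else -Complex.I) else 1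
  -- The factor from the operator at `u`: `g 1 = 1` and `g (-1) = Complex.I`. A flip at a neighbour
  -- of `u` changes it by `Complex.I * s`, and this `Complex.I` cancels against the phase at that
  -- neighbour.
  let g : ℂ → ℂ := fun s => (1 + Complex.I) / 2 + (1 - Complex.I) / 2 * s
  have hf : ∀ x, (tensorOp (localComplementOp G u) *ᵥ graphState G) x =
      (g (nbrSign G x u) * ∏ w, d w (x w)) * graphState G x := by
    intro x
    rw [tensorOp_mulVec_graphState (I := {u}) (d := d) (α := fun _ => (1 + Complex.I) / 2)
      (β := fun _ => (1 - Complex.I) / 2)]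
    · congr 1
      rw [← Finset.mul_prod_erase _ _ (Finset.mem_univ u), ← Finset.mul_prod_erase
        Finset.univ (fun w => d w (x w)) (Finset.mem_univ u), if_pos (Finset.mem_singleton_self u)]
      have : d u (x u) = 1 := by simp [d]
      rw [this, one_mul]
      congr 1
      refine Finset.prod_congr rfl fun w hw => ?_
      rw [if_neg (by simpa using Finset.ne_of_mem_erase hw)]
    · simp
    · intro w hw i j
      have hw' : w ≠ u := by simpa using hw
      by_cases h : G.Adj u w
      · rcases fin_two_cases i with rfl | rfl <;> rcases fin_two_cases j with rfl | rfl <;>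
          simp [localComplementOp, hw', h, d, phaseMatrix]
      · rcases fin_two_cases i with rfl | rfl <;> rcases fin_two_cases j with rfl | rfl <;>
          simp [localComplementOp, hw', h, d]
    · intro w hw i j
      obtain rfl := Finset.mem_singleton.1 hw
      rw [localComplementOp, if_pos rfl, phaseMatrix, hadamard_mul_diagonal_mul]
      rcases fin_two_cases i with rfl | rfl <;> rcases fin_two_cases j with rfl | rfl <;> simp
  have hI := Complex.I_mul_I
  have hg : ∀ s : ℂ, s * s = 1 → g (-s) = Complex.I * s * g s := by
    intro s hs
    simp only [g]
    linear_combination (-(1 + Complex.I) / 2) * hs + ((s * s - s) / 2) * hI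
  obtain ⟨z, hz⟩ := eq_smul_graphState (G := localComplement G u)
    (f := tensorOp (localComplementOp G u) *ᵥ graphState G) (by
      intro x a
      rw [hf, hf, graphState_flipAt]
      have hp := prod_flipAt d x a
      by_cases ha : G.Adj u a
      · rw [nbrSign_localComplement_of_adj x ha, nbrSign_flipAt_of_adj x ha,
          hg _ (nbrSign_mul_self G x u)]
        have : ∏ w, d w (flipAt x a w) = -Complex.I * sgn (x a) * ∏ w, d w (x w) := by
          have h11 : (1 : Fin 2) + 1 = 0 := by decide
          rcases fin_two_cases (x a) with h | h <;> rw [h] at hp ⊢ <;>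
            simp only [d, ha, if_true, h11] at hp ⊢
          · simpa using hp
          · simp at hp ⊢
            linear_combination Complex.I * hp + (∏ w, d w (flipAt x a w)) * hI
        rw [this]
        linear_combination (-(nbrSign G x u * g (nbrSign G x u) * sgn (x a) *
          (∏ w, d w (x w)) * nbrSign G x a * graphState G x)) * hI
      · rw [nbrSign_localComplement_of_not_adj x ha, nbrSign_flipAt_of_not_adj x ha]
        have : ∏ w, d w (flipAt x a w) = ∏ w, d w (x w) := by
          simpa [d, ha] using hp
        rw [this]
        ring)
  refine ⟨z, ?_, hz⟩
  rintro rfl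
  have := (isUnitVector_graphState G).mulVec
    (tensorOp_unitary fun w => (isClifford_localComplementOp G u w).unitary)
  rw [hz, zero_smul] at this
  exact this.ne_zero rfl

theorem CliffordEquiv.localComplementSeq (G : SimpleGraph V) (l : List V) :
    CliffordEquiv (graphState G) (graphState (localComplementSeq G l)) := by
  induction l generalizing G with
  | nil => exact CliffordEquiv.refl _
  | cons u l ih =>
    obtain ⟨z, hz, h⟩ := cliffordEquiv_localComplement G u
    refine CliffordEquiv.trans ⟨z⁻¹, inv_ne_zero hz, localComplementOp G u,
      isClifford_localComplementOp G u, ?_⟩ (ih (localComplement G u))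
    rw [h, smul_smul, inv_mul_cancel₀ hz, one_smul]

end LocalComplement

end CircleGraphStates

/-! ### Clifford decompositions and the normal form. -/

namespace CircleGraphStates
open Function Matrix

section Decomposition

theorem MapsPauli.ne_zero {U : Matrix (Fin 2) (Fin 2) ℂ} (hU : Uᴴ * U = 1)
    {c d : ZMod 2 × ZMod 2} (hc : c ≠ 0) (h : MapsPauli U c d) : d ≠ 0 := by
  rintro rfl
  apply hc
  have h0 : pauli 0 = 1 := pauli_zero
  have key : ∀ e : ℂ, pauli c = e • 1 → c = 0 := by
    intro e he
    by_contra hc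
    have := pauli_trace hc
    rw [he] at this
    have he0 : e = 0 := by simpa using this
    have h1 := pauli_mul_self c
    rw [he, he0, zero_smul, zero_mul] at h1
    simpa using congrFun (congrFun h1 0) 0
  rcases h.symm hU with h | h <;> rw [h0, mul_one, conjTranspose_conjTranspose, hU] at h
  · exact key 1 (by rw [← h, one_smul])
  · exact key (-1) (by rw [neg_one_smul, h, neg_neg])

/-- Clifford operators carry the `Z`-axis to any Pauli axis, and an additional `X` corrects the
sign. -/
theorem exists_isClifford_conj_eq {U : Matrix (Fin 2) (Fin 2) ℂ} (hU : Uᴴ * U = 1)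
    {d : ZMod 2 × ZMod 2} (h : MapsPauli U (0, 1) d) :
    ∃ K, IsClifford K ∧ K * pauli (0, 1) * Kᴴ = U * pauli (0, 1) * Uᴴ := by
  have hK : ∀ d : ZMod 2 × ZMod 2, d ≠ 0 → ∃ K, IsClifford K ∧ MapsPauli K (0, 1) d := by
    apply pauli_cases
    · exact fun h => absurd rfl h
    · exact fun _ => ⟨1, isClifford_one, Or.inl (by simp)⟩
    · exact fun _ => ⟨hadamard, isClifford_hadamard, hadamard_conj _⟩
    · exact fun _ => ⟨phaseMatrix Complex.I * hadamard,
        (isClifford_phaseMatrix (by simp)).mul isClifford_hadamard,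
        (hadamard_conj (0, 1)).mul (phaseMatrix_mapsPauli (Or.inl rfl) _)⟩
  obtain ⟨K, hK, hd⟩ := hK d (h.ne_zero hU (by decide))
  have flip : (K * pauli (1, 0)) * pauli (0, 1) * (K * pauli (1, 0))ᴴ =
      -(K * pauli (0, 1) * Kᴴ) := by
    have : pauli (1, 0) * pauli (0, 1) * pauli (1, 0) = - pauli (0, 1) := by simp
    rw [conjTranspose_mul, pauli_conjTranspose, Matrix.mul_assoc K, ← Matrix.mul_assoc,
      Matrix.mul_assoc K, this, Matrix.mul_neg, Matrix.neg_mul]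
  have hK' := hK.mul (isClifford_pauli (1, 0))
  rcases hd with hd | hd <;> rcases h with h | h
  · exact ⟨K, hK, by rw [hd, h]⟩
  · exact ⟨_, hK', by rw [flip, hd, h]⟩
  · exact ⟨_, hK', by rw [flip, hd, h, neg_neg]⟩
  · exact ⟨K, hK, by rw [hd, h]⟩

theorem eq_diagonal_of_commute_pauli_z {M : Matrix (Fin 2) (Fin 2) ℂ}
    (h : M * pauli (0, 1) = pauli (0, 1) * M) : M = !![M 0 0, 0; 0, M 1 1] := by
  rw [pauli_z] at h
  have h1 := congrFun (congrFun h 0) 1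
  have h2 := congrFun (congrFun h 1) 0
  simp [Matrix.mul_apply, Fin.sum_univ_two] at h1 h2
  have h1' : M 0 1 = 0 := by linear_combination (-1 / 2) * h1
  have h2' : M 1 0 = 0 := by linear_combination (1 / 2) * h2
  conv_lhs => rw [Matrix.eta_fin_two M, h1', h2']

/-- A unitary which maps the `Z`-axis to a Pauli axis is diagonal up to a Clifford operator. -/
theorem exists_eq_mul_diagonal {U : Matrix (Fin 2) (Fin 2) ℂ} (hU : Uᴴ * U = 1)
    {d : ZMod 2 × ZMod 2} (h : MapsPauli U (0, 1) d) :
    ∃ K, IsClifford K ∧ ∃ e : Fin 2 → ℂ, (∀ i, ‖e i‖ = 1) ∧ U = K * !![e 0, 0; 0, e 1] := by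
  -- As `K` and `U` act alike on `Z`, the product `Kᴴ * U` commutes with `Z` and is diagonal.
  obtain ⟨K, hK, hKU⟩ := exists_isClifford_conj_eq hU h
  set M := Kᴴ * U with hM
  have hKM : K * M = U := by rw [hM, ← Matrix.mul_assoc, hK.unitary', Matrix.one_mul]
  have hMu : Mᴴ * M = 1 := by
    have : Mᴴ * M = Uᴴ * (K * Kᴴ) * U := by
      rw [hM, conjTranspose_mul, conjTranspose_conjTranspose]; noncomm_ring
    rw [this, hK.unitary', mul_one, hU]
  have hcomm : M * pauli (0, 1) = pauli (0, 1) * M := by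
    have : M * pauli (0, 1) = Kᴴ * (U * pauli (0, 1) * Uᴴ) * U := by
      have : Kᴴ * (U * pauli (0, 1) * Uᴴ) * U = M * pauli (0, 1) * (Uᴴ * U) := by
        rw [hM]; noncomm_ring
      rw [this, hU, mul_one]
    rw [this, ← hKU]
    have : Kᴴ * (K * pauli (0, 1) * Kᴴ) * U = (Kᴴ * K) * pauli (0, 1) * M := by
      rw [hM]; noncomm_ring
    rw [this, hK.unitary, one_mul]
  have hdiag := eq_diagonal_of_commute_pauli_z hcomm
  have hnorm : ∀ i, ‖M i i‖ = 1 := by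
    have hn : ∀ z : ℂ, (starRingEnd ℂ) z * z = 1 → ‖z‖ = 1 := by
      intro z hz
      rw [Complex.conj_mul'] at hz
      have : ‖z‖ ^ 2 = 1 := by exact_mod_cast hz
      exact (pow_eq_one_iff_of_nonneg (norm_nonneg z) two_ne_zero).1 this
    have h00 := congrFun (congrFun hMu 0) 0
    have h11 := congrFun (congrFun hMu 1) 1
    rw [hdiag, conjTranspose_of] at h00 h11
    intro i
    rcases fin_two_cases i with rfl | rfl
    · exact hn _ (by simpa using h00)
    · exact hn _ (by simpa using h11)
  exact ⟨K, hK, fun i => M i i, hnorm, by rw [← hdiag, hKM]⟩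

/-- A unitary which maps the `X`-axis to a Pauli axis is diagonal in the Hadamard basis up to a
Clifford operator. -/
theorem exists_eq_mul_hadamard_diagonal {U : Matrix (Fin 2) (Fin 2) ℂ} (hU : Uᴴ * U = 1)
    {d : ZMod 2 × ZMod 2} (h : MapsPauli U (1, 0) d) :
    ∃ K, IsClifford K ∧ ∃ e : Fin 2 → ℂ, (∀ i, ‖e i‖ = 1) ∧
      U = K * (hadamard * !![e 0, 0; 0, e 1] * hadamard) := by
  obtain ⟨K, hK, e, he, hKe⟩ := exists_eq_mul_diagonal (U := U * hadamard) (by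
    have : (U * hadamard)ᴴ * (U * hadamard) = hadamardᴴ * (Uᴴ * U) * hadamard := by
      rw [conjTranspose_mul]; noncomm_ring
    rw [this, hU, mul_one, isClifford_hadamard.unitary]) ((hadamard_conj (0, 1)).mul h)
  refine ⟨K * hadamard, hK.mul isClifford_hadamard, e, he, ?_⟩
  have : K * hadamard * (hadamard * !![e 0, 0; 0, e 1] * hadamard) =
      K * (hadamard * hadamard) * !![e 0, 0; 0, e 1] * hadamard := by noncomm_ring
  rw [this, hadamard_mul_self, mul_one, ← hKe, Matrix.mul_assoc, hadamard_mul_self, mul_one]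

end Decomposition

section NormalForm

set_option linter.unusedSectionVars false

variable {V : Type*} [Fintype V] [DecidableEq V]

/-- A representation of the state `φ`, up to a scalar, by a graph state and unitaries which respect
a Pauli axis at each qubit. -/
structure IsAxisRepresentation (φ : (V → Fin 2) → ℂ) (G : SimpleGraph V)
    (U : V → Matrix (Fin 2) (Fin 2) ℂ) : Prop where
  unitary : ∀ u, (U u)ᴴ * U u = 1
  axis : ∀ u, ∃ c d, c ≠ 0 ∧ MapsPauli (U u) c d
  eq_smul : ∃ z : ℂ, z ≠ 0 ∧ φ = z • (tensorOp U *ᵥ graphState G)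

theorem MapsPauli.mul_localComplementOp {G : SimpleGraph V} {U : V → Matrix (Fin 2) (Fin 2) ℂ}
    {w : V} {c d : ZMod 2 × ZMod 2} (h : MapsPauli (U w) c d) (u : V) :
    MapsPauli (U w * (localComplementOp G u w)ᴴ) (localComplementMap G u w c) d :=
  ((mapsPauli_localComplementOp G u w c).symm (isClifford_localComplementOp G u w).unitary).mul h

theorem localComplementMap_ne_zero {G : SimpleGraph V} {u w : V} {c : ZMod 2 × ZMod 2}
    (hc : c ≠ 0) : localComplementMap G u w c ≠ 0 :=
  (mapsPauli_localComplementOp G u w c).ne_zero (isClifford_localComplementOp G u w).unitary hc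

theorem IsAxisRepresentation.localComplement {φ : (V → Fin 2) → ℂ} {G : SimpleGraph V}
    {U : V → Matrix (Fin 2) (Fin 2) ℂ} (h : IsAxisRepresentation φ G U) (u : V) :
    IsAxisRepresentation φ (localComplement G u) fun w => U w * (localComplementOp G u w)ᴴ := by
  have hL := fun w => (isClifford_localComplementOp G u w)
  refine ⟨fun w => ?_, fun w => ?_, ?_⟩
  · have : (U w * (localComplementOp G u w)ᴴ)ᴴ * (U w * (localComplementOp G u w)ᴴ) =
        localComplementOp G u w * ((U w)ᴴ * U w) * (localComplementOp G u w)ᴴ := by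
      rw [conjTranspose_mul, conjTranspose_conjTranspose]; noncomm_ring
    rw [this, h.unitary, mul_one, (hL w).unitary']
  · obtain ⟨c, d, hc, hd⟩ := h.axis w
    exact ⟨_, d, localComplementMap_ne_zero hc, hd.mul_localComplementOp u⟩
  · obtain ⟨z, hz, hφ⟩ := h.eq_smul
    obtain ⟨y, hy, hyG⟩ := cliffordEquiv_localComplement G u
    refine ⟨z * y, mul_ne_zero hz hy, ?_⟩
    have : graphState (CircleGraphStates.localComplement G u) =
        y⁻¹ • (tensorOp (localComplementOp G u) *ᵥ graphState G) := by
      rw [hyG, smul_smul, inv_mul_cancel₀ hy, one_smul]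
    have e : ∀ w, U w * (localComplementOp G u w)ᴴ * localComplementOp G u w = U w := fun w => by
      rw [Matrix.mul_assoc, (hL w).unitary, Matrix.mul_one]
    rw [hφ, this, Matrix.mulVec_smul, smul_smul, mul_assoc, mul_inv_cancel₀ hy, mul_one,
      Matrix.mulVec_mulVec, tensorOp_mul]
    simp only [e]

/-- The unitary `U` maps the `Z`-axis to a Pauli axis. -/
def HasZAxis (U : Matrix (Fin 2) (Fin 2) ℂ) : Prop := ∃ d, MapsPauli U (0, 1) d

theorem HasZAxis.mul_localComplementOp {G : SimpleGraph V} {U : V → Matrix (Fin 2) (Fin 2) ℂ}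
    {u w : V} (hw : w ≠ u) (h : HasZAxis (U w)) : HasZAxis (U w * (localComplementOp G u w)ᴴ) := by
  obtain ⟨d, hd⟩ := h
  refine ⟨d, ?_⟩
  have := hd.mul_localComplementOp (G := G) (U := U) u
  have e : localComplementMap G u w (0, 1) = (0, 1) := by simp [localComplementMap, hw]
  rwa [e] at this

/-- Local complementations turn an axis representation of a state into one in which the qubits
without a `Z`-axis are independent and have `X`-axes. -/
theorem IsAxisRepresentation.exists_isIndepSet {φ : (V → Fin 2) → ℂ} {G : SimpleGraph V}
    {U : V → Matrix (Fin 2) (Fin 2) ℂ} (h : IsAxisRepresentation φ G U) :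
    ∃ (l : List V) (U' : V → Matrix (Fin 2) (Fin 2) ℂ),
      IsAxisRepresentation φ (localComplementSeq G l) U' ∧
      (∀ u, ¬ HasZAxis (U' u) → ∃ d, MapsPauli (U' u) (1, 0) d) ∧
      ∀ u v, ¬ HasZAxis (U' u) → ¬ HasZAxis (U' v) → ¬ (localComplementSeq G l).Adj u v := by
  classical
  induction hk : (Finset.univ.filter fun u => ¬ HasZAxis (U u)).card
    using Nat.strong_induction_on generalizing G U with
  | _ k ih =>
  -- Induction applies after any complementations that create a `Z`-axis at `u` and destroy none.
  have step : ∀ (l : List V) (U' : V → Matrix (Fin 2) (Fin 2) ℂ) (u : V),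
      IsAxisRepresentation φ (localComplementSeq G l) U' → ¬ HasZAxis (U u) → HasZAxis (U' u) →
      (∀ w, HasZAxis (U w) → HasZAxis (U' w)) → ∃ (l : List V) (U' : V → _),
        IsAxisRepresentation φ (localComplementSeq G l) U' ∧
        (∀ u, ¬ HasZAxis (U' u) → ∃ d, MapsPauli (U' u) (1, 0) d) ∧
        ∀ u v, ¬ HasZAxis (U' u) → ¬ HasZAxis (U' v) →
          ¬ (localComplementSeq G l).Adj u v := by
    intro l U' u hU' hu hu' hmono
    obtain ⟨l', U'', h'⟩ := ih _ (by
      rw [← hk]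
      refine Finset.card_lt_card ((Finset.ssubset_iff_of_subset fun w hw => ?_).2
        ⟨u, Finset.mem_filter.2 ⟨Finset.mem_univ u, hu⟩, fun h => (Finset.mem_filter.1 h).2 hu'⟩)
      rw [Finset.mem_filter] at hw ⊢
      exact ⟨hw.1, fun h => hw.2 (hmono w h)⟩) hU' rfl
    refine ⟨l ++ l', U'', ?_⟩
    have : localComplementSeq G (l ++ l') = localComplementSeq (localComplementSeq G l) l' :=
      List.foldl_append
    rw [this]
    exact h'
  -- Complementing at `u` turns a `Y`-axis there into a `Z`-axis and keeps `Z`-axes elsewhere.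
  by_cases hY : ∃ u, ¬ HasZAxis (U u) ∧ ∃ d, MapsPauli (U u) (1, 1) d
  · obtain ⟨u, hu, d, hd⟩ := hY
    refine step [u] _ u (h.localComplement u) hu ⟨d, ?_⟩ fun w hw => ?_
    · have := hd.mul_localComplementOp (G := G) (U := U) u
      have e : localComplementMap G u u (1, 1) = (0, 1) := by
        simp [localComplementMap]; decide
      rwa [e] at this
    · exact hw.mul_localComplementOp (by rintro rfl; exact hu hw)
  have hX : ∀ u, ¬ HasZAxis (U u) → ∃ d, MapsPauli (U u) (1, 0) d := by
    intro u hu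
    obtain ⟨c, d, hc, hd⟩ := h.axis u
    revert hc hd
    refine pauli_cases (p := fun c => c ≠ 0 → MapsPauli (U u) c d → _) ?_ ?_ ?_ ?_ c
    · exact fun h => absurd rfl h
    · exact fun _ hd => absurd ⟨d, hd⟩ hu
    · exact fun _ hd => ⟨d, hd⟩
    · exact fun _ hd => absurd ⟨u, hu, d, hd⟩ hY
  -- Complementing at the neighbour `v` turns the `X`-axis at `u` into a `Y`-axis, and complementing
  -- at `u` makes it a `Z`-axis. No `Z`-axis is lost since neither `u` nor `v` had one.
  by_cases hadj : ∃ u v, ¬ HasZAxis (U u) ∧ ¬ HasZAxis (U v) ∧ G.Adj u v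
  · obtain ⟨u, v, hu, hv, huv⟩ := hadj
    obtain ⟨d, hd⟩ := hX u hu
    refine step [v, u] _ u ((h.localComplement v).localComplement u) hu ⟨d, ?_⟩ fun w hw => ?_
    · have := (hd.mul_localComplementOp (G := G) (U := U) v).mul_localComplementOp
        (G := CircleGraphStates.localComplement G v) (U := fun w => U w * (localComplementOp G v w)ᴴ) u
      have e : localComplementMap (CircleGraphStates.localComplement G v) u u (localComplementMap G v u (1, 0)) =
          (0, 1) := by
        simp [localComplementMap, huv.ne, huv.symm]; decide
      rwa [e] at this
    · exact HasZAxis.mul_localComplementOp (U := fun w => U w * (localComplementOp G v w)ᴴ)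
        (by rintro rfl; exact hu hw) (hw.mul_localComplementOp (by rintro rfl; exact hv hw))
  · exact ⟨[], U, h, hX, fun u v hu hv huv => hadj ⟨u, v, hu, hv, huv⟩⟩

/-- The normal form: up to Clifford operators, the state is a graph state with phases. -/
theorem IsAxisRepresentation.exists_phases {φ : (V → Fin 2) → ℂ} {G : SimpleGraph V}
    {U : V → Matrix (Fin 2) (Fin 2) ℂ} (h : IsAxisRepresentation φ G U) {I : Finset V}
    (hI : ∀ u ∈ I, ∀ v ∈ I, ¬ G.Adj u v) (hX : ∀ u ∈ I, ∃ d, MapsPauli (U u) (1, 0) d)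
    (hZ : ∀ u, u ∉ I → HasZAxis (U u)) :
    ∃ (χ : (V → Fin 2) → ℂ) (K : V → Matrix (Fin 2) (Fin 2) ℂ) (e : V → Fin 2 → ℂ),
      (∀ u, IsClifford (K u)) ∧ χ = tensorOp K *ᵥ φ ∧ (∀ u i, ‖e u i‖ = 1) ∧ ∃ z : ℂ, z ≠ 0 ∧
      ∀ x, χ x = z * (∏ u, if u ∈ I then
        (if nbrSign G x u = 1 then e u 0 else e u 1) else e u (x u)) * graphState G x := by
  have hdec : ∀ u, ∃ K, IsClifford K ∧ ∃ e : Fin 2 → ℂ, (∀ i, ‖e i‖ = 1) ∧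
      U u = K * if u ∈ I then hadamard * !![e 0, 0; 0, e 1] * hadamard
        else !![e 0, 0; 0, e 1] := by
    intro u
    by_cases hu : u ∈ I
    · obtain ⟨d, hd⟩ := hX u hu
      simpa only [if_pos hu] using exists_eq_mul_hadamard_diagonal (h.unitary u) hd
    · obtain ⟨d, hd⟩ := hZ u hu
      simpa only [if_neg hu] using exists_eq_mul_diagonal (h.unitary u) hd
  choose K hK e he hUe using hdec
  obtain ⟨z, hz, hφ⟩ := h.eq_smul
  refine ⟨_, fun u => (K u)ᴴ, e, fun u => (hK u).conjTranspose, rfl, he, z, hz, fun x => ?_⟩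
  rw [hφ, Matrix.mulVec_smul, Matrix.mulVec_mulVec, tensorOp_mul, Pi.smul_apply, smul_eq_mul,
    mul_assoc]
  congr 1
  have hD : ∀ u, (K u)ᴴ * U u = if u ∈ I then hadamard * !![e u 0, 0; 0, e u 1] * hadamard
      else !![e u 0, 0; 0, e u 1] := fun u => by
    rw [hUe u, ← Matrix.mul_assoc, (hK u).unitary, Matrix.one_mul]
  rw [tensorOp_mulVec_graphState hI (d := e) (α := fun u => (e u 0 + e u 1) / 2)
    (β := fun u => (e u 0 - e u 1) / 2)]
  · congr 1
    refine Finset.prod_congr rfl fun u _ => ?_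
    split_ifs with h1 h2
    · rw [h2]; ring
    · rw [(mul_self_eq_one_iff.1 (nbrSign_mul_self G x u)).resolve_left h2]; ring
    · rfl
  · intro u hu i j
    rw [hD, if_neg hu]
    rcases fin_two_cases i with rfl | rfl <;> rcases fin_two_cases j with rfl | rfl <;> simp
  · intro u hu i j
    rw [hD, if_pos hu, hadamard_mul_diagonal_mul]
    rcases fin_two_cases i with rfl | rfl <;> rcases fin_two_cases j with rfl | rfl <;> simp

end NormalForm

end CircleGraphStates

/-! ### States without zero amplitudes are graph states up to phases. -/

namespace CircleGraphStates
open Function Matrix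

section BitFlips

set_option linter.unusedSectionVars false

variable {V : Type*} [Fintype V] [DecidableEq V]

/-- The operator `|0⟩⟨1|` at `a` and `|0⟩⟨0|` elsewhere has expectation `star (χ 0) * χ (flipAt 0 a)
≠ 0`. Its Pauli expansion has only `X`, `Y` at `a` and `1`, `Z` elsewhere, so one of these strings
has nonzero expectation. -/
theorem exists_expect_ne_zero {χ : (V → Fin 2) → ℂ} (h0 : ∀ x, χ x ≠ 0) (a : V) :
    ∃ q : V → ZMod 2 × ZMod 2, (∀ u, (q u).1 = if u = a then 1 else 0) ∧
      expect χ (fun u => pauli (q u)) ≠ 0 := by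
  let A : V → Matrix (Fin 2) (Fin 2) ℂ := fun w => if w = a then !![0, 1; 0, 0] else !![1, 0; 0, 0]
  have h11 : (1 : Fin 2) + 1 = 0 := by decide
  have hA : ∀ x, (tensorOp A *ᵥ χ) x =
      (∏ w, if x w = 0 then 1 else 0) * χ (flipAt x a) := by
    intro x
    rw [tensorOp_mulVec_of_monomial (f := fun w i => if w = a then i + 1 else i)
      (d := fun w i => if i = 0 then 1 else 0)]
    · congr 2
      funext w
      by_cases hw : w = a
      · subst hw; simp
      · simp [hw, flipAt_of_ne]
    · intro w i j
      by_cases hw : w = a <;> rcases fin_two_cases i with rfl | rfl <;>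
        rcases fin_two_cases j with rfl | rfl <;> simp [A, hw, h11]
  have hne : expect χ A ≠ 0 := by
    have : expect χ A = star χ 0 * χ (flipAt 0 a) := by
      rw [expect, dotProduct, Finset.sum_eq_single 0]
      · rw [hA]; simp
      · intro x _ hx
        obtain ⟨w, hw⟩ := Function.ne_iff.1 hx
        rw [hA, Finset.prod_eq_zero (Finset.mem_univ w), zero_mul, mul_zero]
        exact if_neg hw
      · simp
    rw [this]
    exact mul_ne_zero (star_ne_zero.2 (h0 0)) (h0 _)
  rw [expect_eq_sum] at hne
  obtain ⟨q, -, hq⟩ := Finset.exists_ne_zero_of_sum_ne_zero hne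
  refine ⟨q, fun u => ?_, right_ne_zero_of_mul hq⟩
  have hu := Finset.prod_ne_zero_iff.1 (left_ne_zero_of_mul hq) u (Finset.mem_univ u)
  revert hu
  by_cases h : u = a
  · rw [if_pos h]
    refine pauli_cases (p := fun c => pauliCoeff (A u) c ≠ 0 → c.1 = 1) ?_ ?_ ?_ ?_ (q u) <;>
      simp [A, h, pauliCoeff, Matrix.trace_fin_two]
  · rw [if_neg h]
    refine pauli_cases (p := fun c => pauliCoeff (A u) c ≠ 0 → c.1 = 0) ?_ ?_ ?_ ?_ (q u) <;>
      simp [A, h, pauliCoeff, Matrix.trace_fin_two]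

/-- The change of the amplitudes of `χ` when the bit `a` is flipped is given by the phase `κ` and
the parity of the bits in `Z`. -/
def HasFlipRule (χ : (V → Fin 2) → ℂ) (a : V) (κ : ℂ) (Z : Finset V) : Prop :=
  ∀ x, χ (flipAt x a) = (if x a = 0 then κ else κ⁻¹) * (∏ b ∈ Z, sgn (x b)) * χ x

/-- By the dichotomy the string found above stabilizes `χ` up to a sign; this is the flip rule. The
phase is real for `X` at `a` and imaginary for `Y`. -/
theorem HasPauliDichotomy.exists_hasFlipRule {χ : (V → Fin 2) → ℂ} (h : HasPauliDichotomy χ)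
    (h0 : ∀ x, χ x ≠ 0) (a : V) :
    ∃ (κ : ℂ) (Z : Finset V), (κ = 1 ∨ κ = -1 ∨ κ = Complex.I ∨ κ = -Complex.I) ∧ a ∉ Z ∧
      HasFlipRule χ a κ Z := by
  have h11 : (1 : Fin 2) + 1 = 0 := by decide
  obtain ⟨q, hq, hne⟩ := exists_expect_ne_zero h0 a
  obtain ⟨ε, hε, hεχ⟩ : ∃ ε : ℂ, (ε = 1 ∨ ε = -1) ∧ pauliString q *ᵥ χ = ε • χ := by
    rcases h q with e | e | e
    · exact ⟨1, Or.inl rfl, by rw [e, one_smul]⟩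
    · exact ⟨-1, Or.inr rfl, by rw [e, neg_one_smul]⟩
    · exact absurd e hne
  let Z : Finset V := (Finset.univ.erase a).filter fun u => (q u).2 ≠ 0
  let k : Fin 2 → ℂ := fun i =>
    if (q a).2 = 0 then 1 else if i = 0 then -Complex.I else Complex.I
  have hrule : ∀ x, ε * χ x = k (x a) * (∏ b ∈ Z, sgn (x b)) * χ (flipAt x a) := by
    intro x
    have e := congrFun hεχ x
    rw [Pi.smul_apply, smul_eq_mul] at e
    rw [← e, pauliString, tensorOp_mulVec_of_monomial (f := fun w i => if w = a then i + 1 else i)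
      (d := fun w i => if w = a then k i else if (q w).2 = 0 then 1 else sgn i)]
    · congr 1
      · rw [← Finset.mul_prod_erase _ _ (Finset.mem_univ a), if_pos rfl, Finset.prod_filter]
        congr 1
        refine Finset.prod_congr rfl fun w hw => ?_
        rw [if_neg (Finset.ne_of_mem_erase hw), ite_not]
      · congr 1
        funext w
        by_cases hw : w = a
        · subst hw; simp
        · simp [hw, flipAt_of_ne]
    · intro w i j
      have hw := hq w
      rw [← Prod.mk.eta (p := q w), hw]
      by_cases hwa : w = a
      · subst hwa
        rcases zmod_two_cases (q w).2 with h2 | h2 <;> rcases fin_two_cases i with rfl | rfl <;>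
          rcases fin_two_cases j with rfl | rfl <;> simp [h2, k, h11]
      · rcases zmod_two_cases (q w).2 with h2 | h2 <;> rcases fin_two_cases i with rfl | rfl <;>
          rcases fin_two_cases j with rfl | rfl <;> simp [h2, hwa]
  have hZ : ∀ x : V → Fin 2, (∏ b ∈ Z, sgn (x b)) * ∏ b ∈ Z, sgn (x b) = 1 := fun x => by
    rw [← Finset.prod_mul_distrib]
    exact Finset.prod_eq_one fun b _ => sgn_mul_self _
  have hε2 : ε * ε = 1 := by rcases hε with rfl | rfl <;> simp
  have hI := Complex.I_mul_I
  refine ⟨if (q a).2 = 0 then ε else ε * Complex.I, Z, ?_, by simp [Z], fun x => ?_⟩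
  · split_ifs
    · rcases hε with rfl | rfl <;> simp
    · rcases hε with rfl | rfl <;> simp
  · have hr := hrule x
    have hz := hZ x
    set N := ∏ b ∈ Z, sgn (x b)
    have hinv : ε⁻¹ = ε := inv_eq_of_mul_eq_one_left hε2
    rcases zmod_two_cases (q a).2 with h2 | h2
    · simp only [k, h2, if_true, one_mul] at hr ⊢
      rw [hinv, ite_self]
      linear_combination (-χ (flipAt x a)) * hz - N * hr
    · rcases fin_two_cases (x a) with hx | hx
      · simp [k, h2, hx] at hr ⊢
        linear_combination (-χ (flipAt x a)) * hz - Complex.I * N * hr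
          + N * N * χ (flipAt x a) * hI
      · simp [k, h2, hx, hinv] at hr ⊢
        linear_combination (-χ (flipAt x a)) * hz + Complex.I * N * hr
          + N * N * χ (flipAt x a) * hI

theorem graphState_hasFlipRule (G : SimpleGraph V) [DecidableRel G.Adj] (a : V) :
    HasFlipRule (graphState G) a 1 (Finset.univ.filter (G.Adj a)) := by
  intro x
  rw [graphState_flipAt, nbrSign, inv_one, ite_self, one_mul]
  congr 1
  refine Finset.prod_congr ?_ fun _ _ => rfl
  ext; simp

theorem HasFlipRule.second_difference {χ : (V → Fin 2) → ℂ} {a b : V} (hab : a ≠ b) {κ : ℂ}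
    {Z : Finset V} (h : HasFlipRule χ b κ Z) :
    χ (flipAt (flipAt 0 a) b) * χ 0 =
      (if a ∈ Z then -1 else 1) * (χ (flipAt 0 a) * χ (flipAt 0 b)) := by
  have h1 := h (flipAt 0 a)
  have h2 := h 0
  have hN : ∏ c ∈ Z, sgn (flipAt (0 : V → Fin 2) a c) = if a ∈ Z then -1 else 1 := by
    have : ∀ c, sgn (flipAt (0 : V → Fin 2) a c) = if c = a then -1 else 1 := by
      intro c
      by_cases hc : c = a
      · subst hc; simp
      · simp [hc, flipAt_of_ne]
    simp only [this, Finset.prod_ite_eq']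
  rw [hN, flipAt_of_ne _ hab.symm] at h1
  simp only [Pi.zero_apply, if_true, sgn_zero, Finset.prod_const_one, mul_one] at h1 h2
  rw [h1, h2]
  ring

/-- A state with Pauli dichotomy and nonzero amplitudes is a graph state up to Clifford operators;
the graph is determined by the second differences of the phases of the amplitudes. -/
theorem HasPauliDichotomy.exists_graph {χ : (V → Fin 2) → ℂ} (h : HasPauliDichotomy χ)
    (h0 : ∀ x, χ x ≠ 0) : ∃ H : SimpleGraph V, CliffordEquiv (graphState H) χ ∧
      ∀ a b, a ≠ b → (H.Adj a b → χ (flipAt (flipAt 0 a) b) * χ 0 =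
        -(χ (flipAt 0 a) * χ (flipAt 0 b))) ∧ (¬ H.Adj a b → χ (flipAt (flipAt 0 a) b) * χ 0 =
        χ (flipAt 0 a) * χ (flipAt 0 b)) := by
  classical
  choose κ Z hκ ha hrule using h.exists_hasFlipRule h0
  -- Flips at `a` and `b` commute, so the sign of the second difference is the same in either order.
  have hsymm : ∀ a b, b ∈ Z a → a ∈ Z b := by
    intro a b hab
    by_contra hba
    have hne : a ≠ b := by rintro rfl; exact ha a hab
    have h1 := (hrule b).second_difference hne
    have h2 := (hrule a).second_difference hne.symm
    rw [if_neg hba, one_mul] at h1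
    rw [if_pos hab, flipAt_comm, h1] at h2
    have := mul_ne_zero (h0 (flipAt 0 a)) (h0 (flipAt 0 b))
    exact this (by linear_combination (1 / 2) * h2)
  let H : SimpleGraph V :=
    { Adj := fun a b => b ∈ Z a
      symm := ⟨hsymm⟩
      loopless := ⟨ha⟩ }
  have hκ0 : ∀ a, κ a ≠ 0 := by
    intro a
    rcases hκ a with e | e | e | e <;> simp [e]
  have hH : ∀ x a, nbrSign H x a = ∏ b ∈ Z a, sgn (x b) := by
    intro x a
    refine Finset.prod_congr ?_ fun _ _ => rfl
    ext b
    simp [H]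
  -- These diagonal Clifford phases cancel the factors `κ` and leave the flip rule of `H`.
  let d : V → Fin 2 → ℂ := fun w i => if i = 0 then 1 else (κ w)⁻¹
  obtain ⟨c, hc⟩ := eq_smul_graphState (G := H) (f := fun x => (∏ w, d w (x w)) * χ x) (by
    intro x a
    have h11 : (1 : Fin 2) + 1 = 0 := by decide
    have hp := prod_flipAt d x a
    rw [hrule a x, hH]
    rcases fin_two_cases (x a) with hx | hx
    · simp only [hx, d, if_true, one_mul, zero_add, one_ne_zero, if_false] at hp ⊢
      rw [hp]
      field_simp [hκ0 a]
    · simp only [hx, d, if_true, one_mul, h11, one_ne_zero, if_false] at hp ⊢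
      rw [← hp]
      ring)
  have hc0 : c ≠ 0 := by
    rintro rfl
    have := congrFun hc 0
    simp [d, h0] at this
  refine ⟨H, ⟨c, hc0, fun w => phaseMatrix (κ w), fun w => isClifford_phaseMatrix (hκ w), ?_⟩,
    fun a b hab => ?_⟩
  · funext x
    rw [Pi.smul_apply, tensorOp_mulVec_of_monomial (f := fun _ i => i)
      (d := fun w i => (d w i)⁻¹)]
    · have e := congrFun hc x
      rw [Pi.smul_apply] at e
      rw [Finset.prod_inv_distrib, smul_eq_mul, mul_left_comm, ← smul_eq_mul c, ← e, ← mul_assoc,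
        inv_mul_cancel₀, one_mul]
      refine Finset.prod_ne_zero_iff.2 fun w _ => ?_
      dsimp only [d]
      split_ifs
      · exact one_ne_zero
      · exact inv_ne_zero (hκ0 w)
    · intro w i j
      rcases fin_two_cases i with rfl | rfl <;> rcases fin_two_cases j with rfl | rfl <;>
        simp [phaseMatrix, d]
  · rw [(hrule b).second_difference hab]
    have hiff : H.Adj a b ↔ a ∈ Z b := ⟨hsymm a b, hsymm b a⟩
    rw [hiff]
    exact ⟨fun e => by rw [if_pos e, neg_one_mul], fun e => by rw [if_neg e, one_mul]⟩

end BitFlips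

end CircleGraphStates

/-! ### Reduction of phases to local complementations. -/

namespace CircleGraphStates
open Function Matrix

section LocalEquivalence

set_option linter.unusedSectionVars false

variable {V : Type*} [Fintype V] [DecidableEq V]

theorem nbrSign_flipAt_zero (G : SimpleGraph V) [DecidableRel G.Adj] (a u : V) :
    nbrSign G (flipAt 0 a) u = if G.Adj a u then -1 else 1 := by
  have h0 : nbrSign G 0 u = 1 := Finset.prod_eq_one fun _ _ => by simp
  split_ifs with h
  · rw [nbrSign_flipAt_of_adj _ h.symm, h0]
  · rw [nbrSign_flipAt_of_not_adj _ fun h' => h h'.symm, h0]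

theorem nbrSign_flipAt_flipAt_zero (G : SimpleGraph V) [DecidableRel G.Adj] (a b u : V) :
    nbrSign G (flipAt (flipAt 0 a) b) u =
      (if G.Adj a u then -1 else 1) * (if G.Adj b u then -1 else 1) := by
  by_cases h : G.Adj b u
  · rw [nbrSign_flipAt_of_adj _ h.symm, nbrSign_flipAt_zero, if_pos h, mul_neg_one]
  · rw [nbrSign_flipAt_of_not_adj _ fun h' => h h'.symm, nbrSign_flipAt_zero, if_neg h, mul_one]

/-- The second differences of the phases which arise from an independent set. -/
theorem prod_phase_second_difference (G : SimpleGraph V) [DecidableRel G.Adj] (I : Finset V)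
    {e : V → Fin 2 → ℂ} (he : ∀ u i, e u i ≠ 0) {a b : V} (hab : a ≠ b)
    {p : (V → Fin 2) → V → ℂ} (hp : ∀ x u, p x u = if u ∈ I then
      (if nbrSign G x u = 1 then e u 0 else e u 1) else e u (x u)) :
    (∏ u, p (flipAt (flipAt 0 a) b) u) * ∏ u, p 0 u =
      (∏ u ∈ I with G.Adj a u ∧ G.Adj b u, (e u 0 / e u 1) ^ 2) *
        ((∏ u, p (flipAt 0 a) u) * ∏ u, p (flipAt 0 b) u) := by
  classical
  have hI : ∏ u ∈ I with G.Adj a u ∧ G.Adj b u, (e u 0 / e u 1) ^ 2 =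
      ∏ u, if u ∈ I ∧ G.Adj a u ∧ G.Adj b u then (e u 0 / e u 1) ^ 2 else 1 := by
    rw [← Finset.prod_filter]
    refine Finset.prod_congr ?_ fun _ _ => rfl
    ext; simp
  rw [hI, ← Finset.prod_mul_distrib, ← Finset.prod_mul_distrib, ← Finset.prod_mul_distrib]
  refine Finset.prod_congr rfl fun u _ => ?_
  have h0 : nbrSign G 0 u = 1 := Finset.prod_eq_one fun _ _ => by simp
  have h1 : (-1 : ℂ) ≠ 1 := by norm_num
  have e0 := he u 0
  have e1 := he u 1
  simp only [hp, nbrSign_flipAt_zero, nbrSign_flipAt_flipAt_zero, h0]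
  -- For `u ∈ I` flipping both `a` and `b` restores the parity exactly when `u` is adjacent to both;
  -- this is the only case with a nontrivial factor. For `u ∉ I` the phase depends on one bit and `a
  -- ≠ b`.
  by_cases hu : u ∈ I
  · by_cases ha : G.Adj a u <;> by_cases hb : G.Adj b u <;> simp [hu, ha, hb, h1]
    · field_simp
    · ring
  · by_cases ha : u = a
    · subst ha
      simp [hu, flipAt_of_ne _ hab]
    · by_cases hb : u = b
      · subst hb
        simp [hu, flipAt_of_ne _ ha, mul_comm]
      · simp [hu, flipAt_of_ne _ ha, flipAt_of_ne _ hb]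

theorem exists_int_of_prod_eq {ι : Type*} {T : Finset ι} {t : ι → ℂ} (ht : ∀ u, ‖t u‖ = 1)
    {p : Prop} [Decidable p] (h : ∏ u ∈ T, t u = if p then -1 else 1) :
    ∃ m : ℤ, ∑ u ∈ T, (t u).arg / Real.pi = m ∧ (Odd m ↔ p) := by
  have hpi : (Real.pi : ℂ) ≠ 0 := by exact_mod_cast Real.pi_ne_zero
  have hpI : (Real.pi : ℂ) * Complex.I ≠ 0 := mul_ne_zero hpi Complex.I_ne_zero
  have hexp : Complex.exp ((∑ u ∈ T, (t u).arg / Real.pi : ℝ) * (Real.pi * Complex.I)) =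
      if p then -1 else 1 := by
    rw [← h]
    push_cast
    rw [Finset.sum_mul, Complex.exp_sum]
    refine Finset.prod_congr rfl fun u _ => ?_
    have : ((t u).arg : ℂ) / Real.pi * (Real.pi * Complex.I) = (t u).arg * Complex.I := by
      field_simp
    rw [this]
    have e := Complex.norm_mul_exp_arg_mul_I (t u)
    rwa [ht, Complex.ofReal_one, one_mul] at e
  generalize (∑ u ∈ T, (t u).arg / Real.pi) = r at hexp ⊢
  by_cases hp : p
  · rw [if_pos hp, ← Complex.exp_pi_mul_I, Complex.exp_eq_exp_iff_exists_int] at hexp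
    obtain ⟨n, hn⟩ := hexp
    have : (r : ℂ) = ((2 * n + 1 : ℤ) : ℂ) := by
      apply mul_right_cancel₀ hpI
      rw [hn]
      push_cast
      ring
    exact ⟨2 * n + 1, by exact_mod_cast this, by simp [hp]⟩
  · rw [if_neg hp, Complex.exp_eq_one_iff] at hexp
    obtain ⟨n, hn⟩ := hexp
    have : (r : ℂ) = ((2 * n : ℤ) : ℂ) := by
      apply mul_right_cancel₀ hpI
      rw [hn]
      push_cast
      ring
    exact ⟨2 * n, by exact_mod_cast this, by simp [hp]⟩

/-- The second differences of `χ` and of the graph state of `G` differ by the product of `(e u 0 / e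
u 1) ^ 2` over common neighbours in `I`, which is therefore a sign. Its parity is a pair sum of
weights, so rounding gives `A` such that complementing `G` at the vertices of `A` yields `H`. -/
theorem IsCircleGraph.cliffordEquiv_of_phases {G : SimpleGraph V} (hG : IsCircleGraph G)
    {I : Finset V} (hI : ∀ u ∈ I, ∀ v ∈ I, ¬ G.Adj u v) {e : V → Fin 2 → ℂ}
    (he : ∀ u i, ‖e u i‖ = 1) {z : ℂ} (hz : z ≠ 0) {χ : (V → Fin 2) → ℂ}
    (hQ : HasPauliDichotomy χ) (hχ : ∀ x, χ x = z * (∏ u, if u ∈ I then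
      (if nbrSign G x u = 1 then e u 0 else e u 1) else e u (x u)) * graphState G x) :
    CliffordEquiv (graphState G) χ := by
  classical
  have he0 : ∀ u i, e u i ≠ 0 := fun u i h => by simpa [h] using he u i
  set p : (V → Fin 2) → V → ℂ := fun x u => if u ∈ I then
      (if nbrSign G x u = 1 then e u 0 else e u 1) else e u (x u) with hp
  have hp0 : ∀ x, ∏ u, p x u ≠ 0 := fun x => Finset.prod_ne_zero_iff.2 fun u _ => by
    simp only [hp]
    split_ifs <;> exact he0 _ _
  have h0 : ∀ x, χ x ≠ 0 := fun x => by
    rw [hχ]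
    exact mul_ne_zero (mul_ne_zero hz (hp0 x)) (graphState_ne_zero G x)
  obtain ⟨H, hHχ, hH⟩ := hQ.exists_graph h0
  have hpair : ∀ a b, ∃ m : ℤ, a ≠ b →
      (∑ u ∈ I with G.Adj a u ∧ G.Adj b u, ((e u 0 / e u 1) ^ 2).arg / Real.pi = m ∧
        (Odd m ↔ ¬ (G.Adj a b ↔ H.Adj a b))) := by
    intro a b
    by_cases hab : a = b
    · exact ⟨0, fun h => absurd hab h⟩
    obtain ⟨m, hm⟩ := exists_int_of_prod_eq (T := I.filter fun u => G.Adj a u ∧ G.Adj b u)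
      (t := fun u => (e u 0 / e u 1) ^ 2) (fun u => by simp [he])
      (p := ¬ (G.Adj a b ↔ H.Adj a b)) (by
        have h1 := prod_phase_second_difference G I he0 hab (p := p) fun _ _ => rfl
        have h2 := (graphState_hasFlipRule G b).second_difference hab
        simp only [Finset.mem_filter, Finset.mem_univ, true_and, G.adj_comm b a] at h2
        obtain ⟨h3, h4⟩ := hH a b hab
        simp only [hχ] at h3 h4
        have hne : z * z * (graphState G (flipAt 0 a) * graphState G (flipAt 0 b)) *
            ((∏ u, p (flipAt 0 a) u) * ∏ u, p (flipAt 0 b) u) ≠ 0 :=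
          mul_ne_zero (mul_ne_zero (mul_ne_zero hz hz) (mul_ne_zero (graphState_ne_zero _ _)
            (graphState_ne_zero _ _))) (mul_ne_zero (hp0 _) (hp0 _))
        generalize (∏ u ∈ I with G.Adj a u ∧ G.Adj b u, (e u 0 / e u 1) ^ 2) = t at h1 ⊢
        generalize graphState G (flipAt (flipAt 0 a) b) = g₁ at *
        generalize graphState G (flipAt 0 a) = g₂ at *
        generalize graphState G (flipAt 0 b) = g₃ at *
        generalize graphState G 0 = g₄ at *
        generalize (∏ u, p (flipAt (flipAt 0 a) b) u) = p₁ at *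
        generalize (∏ u, p (flipAt 0 a) u) = p₂ at *
        generalize (∏ u, p (flipAt 0 b) u) = p₃ at *
        generalize (∏ u, p 0 u) = p₄ at *
        apply mul_right_cancel₀ hne
        by_cases hGab : G.Adj a b <;> by_cases hHab : H.Adj a b
        · have h := h3 hHab
          simp only [hGab, hHab, if_true, iff_self, not_true, if_false] at h2 ⊢
          linear_combination (-1) * h + (-z * z * g₂ * g₃) * h1 + z * z * p₁ * p₄ * h2
        · have h := h4 hHab
          simp only [hGab, hHab, if_true, iff_false, not_true, not_false_iff] at h2 ⊢
          linear_combination (-1) * h + (-z * z * g₂ * g₃) * h1 + z * z * p₁ * p₄ * h2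
        · have h := h3 hHab
          simp only [hGab, hHab, if_true, false_iff, not_true, not_false_iff, if_false] at h2 ⊢
          linear_combination h + (-z * z * g₂ * g₃) * h1 - z * z * p₁ * p₄ * h2
        · have h := h4 hHab
          simp only [hGab, hHab, iff_self, not_true, if_false] at h2 ⊢
          linear_combination h + (-z * z * g₂ * g₃) * h1 - z * z * p₁ * p₄ * h2)
    exact ⟨m, fun _ => hm⟩
  choose m hm using hpair
  have hI' : G.IsIndepSet (I : Set V) := fun u hu v hv _ => hI u hu v hv
  obtain ⟨A, hA, hodd⟩ := hG.exists_odd_weight I hI' _ m fun a b hab => (hm a b hab).1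
  have hHG : H = CircleGraphStates.localComplementSeq G A.toList := by
    rw [← rLocalComplement_one_eq_localComplementSeq G A fun u hu v hv =>
      hI' (hA hu) (hA hv)]
    ext a b
    rw [rLocalComplement_one_adj]
    by_cases hab : a = b
    · subst hab; simp
    · have h1 := (hm a b hab).2
      have h2 := hodd a b hab
      tauto
  exact (CliffordEquiv.localComplementSeq G A.toList).trans (hHG ▸ hHχ)

theorem IsCircleGraph.cliffordEquiv {C : SimpleGraph V} (hC : IsCircleGraph C)
    {φ : (V → Fin 2) → ℂ} (hφ : HasPauliDichotomy φ) {U : V → Matrix (Fin 2) (Fin 2) ℂ}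
    (hU : ∀ u, (U u)ᴴ * U u = 1) (h : φ = tensorOp U *ᵥ graphState C) :
    CliffordEquiv (graphState C) φ := by
  classical
  obtain ⟨U', hU', haxis, hφU⟩ := exists_all_mapsPauli hφ hU h
  have hrep : IsAxisRepresentation φ C U' := ⟨hU', haxis, 1, one_ne_zero, by rw [hφU, one_smul]⟩
  obtain ⟨l, W, hW, hX, hindep⟩ := hrep.exists_isIndepSet
  have hI : ∀ u ∈ Finset.univ.filter (fun u => ¬ HasZAxis (W u)),
      ∀ v ∈ Finset.univ.filter (fun u => ¬ HasZAxis (W u)), ¬ (CircleGraphStates.localComplementSeq C l).Adj u v :=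
    fun u hu v hv => hindep u v (Finset.mem_filter.1 hu).2 (Finset.mem_filter.1 hv).2
  obtain ⟨χ, K, e, hK, hχ, he, z, hz, hχe⟩ := hW.exists_phases hI
    (fun u hu => hX u (Finset.mem_filter.1 hu).2)
    (fun u hu => not_not.1 fun h => hu (Finset.mem_filter.2 ⟨Finset.mem_univ u, h⟩))
  have h1 := (hC.localComplementSeq l).cliffordEquiv_of_phases hI he hz
    (hχ ▸ hφ.tensorOp hK) hχe
  exact (CliffordEquiv.localComplementSeq C l).trans
    (h1.trans (CliffordEquiv.symm ⟨1, one_ne_zero, K, hK, by rw [hχ, one_smul]⟩))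

/-- Between unit vectors the scalar has absolute value one, so it is a global phase. -/
theorem CliffordEquiv.lcEquivalent {ψ φ : (V → Fin 2) → ℂ} (h : CliffordEquiv ψ φ)
    (hψ : IsUnitVector ψ) (hφ : IsUnitVector φ) : LCEquivalent ψ φ := by
  obtain ⟨z, -, K, hK, rfl⟩ := h
  have hKψ := hψ.mulVec (tensorOp_unitary fun u => (hK u).unitary)
  have hz : ‖z‖ = 1 := by
    have e : ∑ x, ‖(z • (tensorOp K *ᵥ ψ)) x‖ ^ 2 = ‖z‖ ^ 2 * ∑ x, ‖(tensorOp K *ᵥ ψ) x‖ ^ 2 := by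
      rw [Finset.mul_sum]
      exact Finset.sum_congr rfl fun x _ => by rw [Pi.smul_apply, norm_smul, mul_pow]
    rw [IsUnitVector, e, hKψ, mul_one] at hφ
    exact (pow_eq_one_iff_of_nonneg (norm_nonneg z) two_ne_zero).1 hφ
  refine ⟨z.arg, K, fun u => (hK u).mem_cliffordGroup, ?_⟩
  have e := Complex.norm_mul_exp_arg_mul_I z
  rw [hz, Complex.ofReal_one, one_mul, mul_comm] at e
  rw [e]

/-- `LU = LC` for circle graph states. -/
theorem IsCircleGraph.luEqLC {C : SimpleGraph V} (hC : IsCircleGraph C) :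
    LUEqLC (graphState C) := by
  rintro φ hφ ⟨U, hU, h⟩
  exact (hC.cliffordEquiv hφ.hasPauliDichotomy
    (fun u => Matrix.mem_unitaryGroup_iff'.1 (hU u)) h).lcEquivalent
    (isUnitVector_graphState C) hφ.1

end LocalEquivalence

end CircleGraphStates

theorem mainTheorem1 {V : Type*} [Fintype V] [DecidableEq V] (C : SimpleGraph V)
    (hC : CircleGraphStates.IsCircleGraph C) :
    (∀ (r : ℕ) (S : V → ℕ), 1 ≤ r →
      CircleGraphStates.IsIndependentMultiset C S →
      CircleGraphStates.IsIncident C r S →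
        (∃ A : Set V, C.IsIndepSet A ∧
          CircleGraphStates.rLocalComplement C r S =
            CircleGraphStates.rLocalComplement C 1 (A.indicator 1)) ∧
        (∃ l : List V,
          CircleGraphStates.rLocalComplement C r S =
            CircleGraphStates.localComplementSeq C l) ∧
        CircleGraphStates.IsCircleGraph (CircleGraphStates.rLocalComplement C r S)) ∧
    CircleGraphStates.LUEqLC (CircleGraphStates.graphState C) := by
  refine ⟨fun r S hr hS hi => ?_, hC.luEqLC⟩
  obtain ⟨A, hA, h⟩ := hC.rLocalComplement_eq hr hS hi
  have h' := h.trans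
    (CircleGraphStates.rLocalComplement_one_eq_localComplementSeq C A hA)
  refine ⟨⟨A, hA, h⟩, ⟨_, h'⟩, ?_⟩
  rw [h']
  exact hC.localComplementSeq _
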